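/- **Setting.** Let $\Omega=(-1,1)$, $\Omega_1=(-1,0)$, $\Omega_2=(0,1)$, $T>0$. For $i=1,2$ let $\phi_i\in(0,1)$ and let $\pi_i,\mu_{o,i},\mu_{w,i}:[0,1]\to\mathbb R$ be Lipschitz continuous, with $\pi_i$ and $\mu_{o,i}$ (strictly) increasing, $\mu_{w,i}$ (strictly) decreasing, $\mu_{o,i}(0)=0$, $\mu_{w,i}(1)=0$. Let $q,\rho_o,\rho_w,g\in\mathbb R$ and put $$\lambda_i=\frac{\mu_{o,i}\mu_{w,i}}{\mu_{o,i}+\mu_{w,i}},\qquad f_i=\frac{\mu_{o,i}}{\mu_{o,i}+\mu_{w,i}}\,q+\lambda_i(\rho_o-\rho_w)g,\qquad \varphi_i(s)=\int_0^s\lambda_i(a)\pi_i'(a)\,da .$$ Let $G_i:[0,1]^2\to\mathbb R$ be Lipschitz continuous, non-decreasing in the first and non-increasing in the second argument, with $G_i(a,a)=f_i(a)$, and let $\underline u,\overline u\in L^\infty(0,T)$ with values in $[0,1]$ a.e. Define the graphs $\tilde\pi_i(s)=\{\pi_i(s)\}$ for $0<s<1$, $\tilde\pi_i(0)=(-\infty,\pi_i(0)]$,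 $\tilde\pi_i(1)=[\pi_i(1),+\infty)$. **Bounded-flux solutions.** Given $u_0$, a function $u$ is a *weak solution* if (1) $u\in L^\infty(\Omega\times(0,T))$, $0\le u\le1$ a.e.; (2) $\varphi_i(u)\in L^2(0,T;H^1(\Omega_i))$, $i=1,2$; (3) for a.e. $t\in(0,T)$, $\tilde\pi_1(u_1(t))\cap\tilde\pi_2(u_2(t))\ne\emptyset$, where $u_i$ is the trace of $u_{|\Omega_i}$ on $\{x=0\}$; (4) for all $\psi\in\mathcal D(\overline\Omega\times[0,T))$, with $u(\pm1,\cdot)$ the traces of $u$ on $\{x=\pm1\}$, $$\int_0^T\sum_{i}\int_{\Omega_i}\phi_i u\,\partial_t\psi\,dx\,dt+\sum_i\int_{\Omega_i}\phi_iu_0\,\psi(\cdot,0)\,dx+\int_0^T\sum_i\int_{\Omega_i}\big[f_i(u)-\partial_x\varphi_i(u)\big]\partial_x\psi\,dx\,dt$$ $$+\int_0^TG_1(\underline u(t),u(-1,t))\psi(-1,t)\,dt-\int_0^TG_2(u(1,t),\overline u(t))\psi(1,t)\,dt=0 .$$ It is a *bounded-flux solution* if moreover $\partial_x\varphi_i(u)\in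 L^\infty(\Omega_i\times(0,T))$ for $i=1,2$. **Scheme.** For integers $N,M\ge1$ put $\delta x=1/N$, $\delta t=T/M$, $x_j=j/N$, $t^n=nT/M$, and let $i$ be the index with $(x_j,x_{j+1})\subset\Omega_i$ where a cell is concerned (and the layer containing $x_j$ for $F_j$, $j\notin\{-N,0,N\}$). A discrete solution is given by values $u^n_{j+1/2}\in[0,1]$ ($-N\le j\le N-1$, $0\le n\le M$) with $u^0_{j+1/2}=\frac1{\delta x}\int_{x_j}^{x_{j+1}}u_0\,dx$ and, for $0\le n\le M-1$, $$\phi_i\frac{u^{n+1}_{j+1/2}-u^n_{j+1/2}}{\delta t}\,\delta x+F^{n+1}_{j+1}-F^{n+1}_j=0,$$ where $F_j^{n+1}=G_i(u^{n+1}_{j-1/2},u^{n+1}_{j+1/2})-\frac{\varphi_i(u^{n+1}_{j+1/2})-\varphi_i(u^{n+1}_{j-1/2})}{\delta x}$ for $j\notin\{-N,0,N\}$, $F_{-N}^{n+1}=G_1(\underline u^{n+1},u^{n+1}_{-N+1/2})$, $F_N^{n+1}=G_2(u^{n+1}_{N-1/2},\overline u^{n+1})$, with $\underline u^{n+1},\overline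 u^{n+1}$ the means of $\underline u,\overline u$ over $(t^n,t^{n+1})$, and $$F_0^{n+1}=G_1(u^{n+1}_{-1/2},c)-\frac{2(\varphi_1(c)-\varphi_1(u^{n+1}_{-1/2}))}{\delta x}=G_2(d,u^{n+1}_{1/2})-\frac{2(\varphi_2(u^{n+1}_{1/2})-\varphi_2(d))}{\delta x}$$ for some $c,d\in[0,1]$ (depending on $n$) with $\tilde\pi_1(c)\cap\tilde\pi_2(d)\neq\emptyset$. The discrete solution $u_{\mathcal D}$ is the function equal to $u^{n+1}_{j+1/2}$ on $(x_j,x_{j+1})\times(t^n,t^{n+1}]$. **Theorem.** Let $u_0\in L^\infty(\Omega)$, $0\le u_0\le1$ a.e., with $\partial_x\varphi_i(u_0)\in L^\infty(\Omega_i)$ for $i=1,2$ and $\tilde\pi_1(u_{0,1})\cap\tilde\pi_2(u_{0,2})\ne\emptyset$, where $u_{0,i}$ is the trace of ${u_0}_{|\Omega_i}$ on $\{x=0\}$. Let $(M_p)_p,(N_p)_p$ be sequences of positive integers tending to $+\infty$, let $u_{\mathcal D_p}$ be the associated discrete solutions, and let $u$ be an adherence value (limit of a subsequence) of $(u_{\mathcal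 D_p})_p$ in $L^r(\Omega\times(0,T))$ for some $r\in[1,\infty)$. Then $u$ is a bounded-flux solution. Moreover, a bounded-flux solution exists. -/

import Mathlib

open Set Filter Topology MeasureTheory

noncomputable section

namespace TwoPhase

/-! The medium is `(-1,1)`; its two layers are indexed by `Fin 2`: index `0` is the left layer
`(-1,0)` and index `1` the right layer `(0,1)`. Space-time points are pairs `(x, t)`.
Saturations take values in `[0,1]`; all constitutive functions are only constrained, and only
used, on `[0,1]`. -/

/-- The two homogeneous layers. -/
def layer (i : Fin 2) : Set ℝ := if i = 0 then Ioo (-1) 0 else Ioo 0 1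

/-- Rock and fluid data: porosities, capillary pressures, mobilities of oil and water, total flow
rate, densities and gravity. -/
structure Rock where
  porosity : Fin 2 → ℝ
  /-- capillary pressure -/
  cap : Fin 2 → ℝ → ℝ
  /-- oil mobility -/
  muO : Fin 2 → ℝ → ℝ
  /-- water mobility -/
  muW : Fin 2 → ℝ → ℝ
  /-- total flow rate -/
  q : ℝ
  rhoO : ℝ
  rhoW : ℝ
  grav : ℝ
  porosity_mem : ∀ i, porosity i ∈ Ioo (0 : ℝ) 1
  cap_strictMono : ∀ i, StrictMonoOn (cap i) (Icc 0 1)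
  cap_lipschitz : ∀ i, ∃ K, LipschitzOnWith K (cap i) (Icc 0 1)
  muO_strictMono : ∀ i, StrictMonoOn (muO i) (Icc 0 1)
  muO_lipschitz : ∀ i, ∃ K, LipschitzOnWith K (muO i) (Icc 0 1)
  muO_zero : ∀ i, muO i 0 = 0
  muW_strictAnti : ∀ i, StrictAntiOn (muW i) (Icc 0 1)
  muW_lipschitz : ∀ i, ∃ K, LipschitzOnWith K (muW i) (Icc 0 1)
  muW_one : ∀ i, muW i 1 = 0

namespace Rock

variable (R : Rock)

/-- `λ_i = μ_{o,i} μ_{w,i} / (μ_{o,i} + μ_{w,i})`. -/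
def lam (i : Fin 2) (s : ℝ) : ℝ := R.muO i s * R.muW i s / (R.muO i s + R.muW i s)

/-- The convective flux `f_i = μ_{o,i} / (μ_{o,i} + μ_{w,i}) q + λ_i (ρ_o - ρ_w) g`. -/
def f (i : Fin 2) (s : ℝ) : ℝ :=
  R.muO i s / (R.muO i s + R.muW i s) * R.q + R.lam i s * (R.rhoO - R.rhoW) * R.grav

/-- `φ_i(s) = ∫_0^s λ_i(a) π_i'(a) da`. -/
def phi (i : Fin 2) (s : ℝ) : ℝ := ∫ a in (0 : ℝ)..s, R.lam i a * deriv (R.cap i) a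

/-- The maximal monotone graph extending the capillary pressure:
`{π_i(s)}` for `0 < s < 1`, `(-∞, π_i(0)]` for `s = 0`, `[π_i(1), ∞)` for `s = 1`
(and empty for `s` outside `[0,1]`). -/
def capGraph (i : Fin 2) (s : ℝ) : Set ℝ :=
  {p | (s = 0 ∧ p ≤ R.cap i 0) ∨ (0 < s ∧ s < 1 ∧ p = R.cap i s) ∨ (s = 1 ∧ R.cap i 1 ≤ p)}

/-- The capillary pressures of the saturations `a` (left) and `b` (right) are connected in the
graph sense. -/
def Connected (a b : ℝ) : Prop := (R.capGraph 0 a ∩ R.capGraph 1 b).Nonempty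

end Rock

/-- The data of the problem: rock data, a final time, the monotone numerical fluxes `G_i`
(consistent with `f_i`) and the boundary data on `x = -1` and `x = 1`. -/
structure Problem extends Rock where
  T : ℝ
  G : Fin 2 → ℝ → ℝ → ℝ
  /-- boundary datum at `x = -1` -/
  uL : ℝ → ℝ
  /-- boundary datum at `x = 1` -/
  uR : ℝ → ℝ
  T_pos : 0 < T
  G_lipschitz : ∀ i, ∃ K,
    LipschitzOnWith K (fun p : ℝ × ℝ => G i p.1 p.2) (Icc 0 1 ×ˢ Icc 0 1)
  G_mono : ∀ i, ∀ b ∈ Icc (0 : ℝ) 1, MonotoneOn (fun a => G i a b) (Icc 0 1)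
  G_anti : ∀ i, ∀ a ∈ Icc (0 : ℝ) 1, AntitoneOn (fun b => G i a b) (Icc 0 1)
  G_diag : ∀ i, ∀ a ∈ Icc (0 : ℝ) 1, G i a a = toRock.f i a
  uL_meas : AEStronglyMeasurable uL (volume.restrict (Ioo 0 T))
  uL_mem : ∀ᵐ t ∂(volume.restrict (Ioo 0 T)), uL t ∈ Icc (0 : ℝ) 1
  uR_meas : AEStronglyMeasurable uR (volume.restrict (Ioo 0 T))
  uR_mem : ∀ᵐ t ∂(volume.restrict (Ioo 0 T)), uR t ∈ Icc (0 : ℝ) 1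

/-! ### Weak derivatives and traces -/

/-- `w` is the weak derivative of `v` on the open set `S ⊆ ℝ`. -/
def HasWeakDeriv (S : Set ℝ) (v w : ℝ → ℝ) : Prop :=
  LocallyIntegrableOn v S ∧ LocallyIntegrableOn w S ∧
    ∀ η : ℝ → ℝ, ContDiff ℝ (⊤ : ℕ∞) η → HasCompactSupport η → tsupport η ⊆ S →
      ∫ x in S, v x * deriv η x = - ∫ x in S, w x * η x

/-- `w` is the weak derivative in space `∂_x v` of `v` on the open set `Q ⊆ ℝ × ℝ`. -/
def HasWeakDerivX (Q : Set (ℝ × ℝ)) (v w : ℝ × ℝ → ℝ) : Prop :=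
  LocallyIntegrableOn v Q ∧ LocallyIntegrableOn w Q ∧
    ∀ η : ℝ × ℝ → ℝ, ContDiff ℝ (⊤ : ℕ∞) η → HasCompactSupport η → tsupport η ⊆ Q →
      ∫ p in Q, v p * deriv (fun y => η (y, p.2)) p.1 = - ∫ p in Q, w p * η p

/-- `γ` is the trace at the point `a` of the function `w` on `S`, i.e. the limit of `w` at `a`
along `S`, up to modifying `w` on a null set. -/
def HasTrace (S : Set ℝ) (a : ℝ) (w : ℝ → ℝ) (γ : ℝ) : Prop :=
  Tendsto w (𝓝[S] a ⊓ ae volume) (𝓝 γ)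

namespace Problem

variable (P : Problem)

/-- The space-time cylinder `Ω_i × (0,T)`. -/
def cyl (i : Fin 2) : Set (ℝ × ℝ) := layer i ×ˢ Ioo 0 P.T

/-- The whole space-time cylinder `Ω × (0,T)`, `Ω = (-1,1)`. -/
def domain : Set (ℝ × ℝ) := Ioo (-1) 1 ×ˢ Ioo 0 P.T

/-- `γ` is the trace on `{x = a} × (0,T)` of the restriction of `u` to `Ω_i × (0,T)`. -/
def HasLateralTrace (i : Fin 2) (a : ℝ) (u : ℝ × ℝ → ℝ) (γ : ℝ → ℝ) : Prop :=
  ∀ᵐ t ∂(volume.restrict (Ioo 0 P.T)), HasTrace (layer i) a (fun x => u (x, t)) (γ t)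

/-- Test functions: smooth functions with compact support in `[-1,1] × [0,T)`, given as
restrictions of smooth compactly supported functions on `ℝ × (-∞,T)`. -/
def IsTest (ψ : ℝ × ℝ → ℝ) : Prop :=
  ContDiff ℝ (⊤ : ℕ∞) ψ ∧ HasCompactSupport ψ ∧ tsupport ψ ⊆ {p | p.2 < P.T}

/-- The integral identity of weak solutions. Here `w i` stands for `∂_x φ_i(u)` on
`Ω_i × (0,T)`, and `γL`, `γR` for the traces of `u` on `x = -1` and `x = 1`. -/
def WeakIdentity (u₀ : ℝ → ℝ) (u : ℝ × ℝ → ℝ) (w : Fin 2 → ℝ × ℝ → ℝ) (γL γR : ℝ → ℝ)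
    (ψ : ℝ × ℝ → ℝ) : Prop :=
  (∑ i, ∫ p in P.cyl i, P.porosity i * u p * deriv (fun s => ψ (p.1, s)) p.2)
    + (∑ i, ∫ x in layer i, P.porosity i * u₀ x * ψ (x, 0))
    + (∑ i, ∫ p in P.cyl i, (P.f i (u p) - w i p) * deriv (fun y => ψ (y, p.2)) p.1)
    + (∫ t in Ioo 0 P.T, P.G 0 (P.uL t) (γL t) * ψ (-1, t))
    - (∫ t in Ioo 0 P.T, P.G 1 (γR t) (P.uR t) * ψ (1, t)) = 0

/-- Weak solutions with initial datum `u₀`. The condition `φ_i(u) ∈ L²(0,T;H¹(Ω_i))` says that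
`φ_i(u)` and its weak derivative in `x` are square integrable on `Ω_i × (0,T)`. Weak derivatives
and traces are unique up to null sets. -/
def IsWeakSolution (u₀ : ℝ → ℝ) (u : ℝ × ℝ → ℝ) : Prop :=
  AEStronglyMeasurable u (volume.restrict P.domain) ∧
  (∀ᵐ p ∂(volume.restrict P.domain), u p ∈ Icc (0 : ℝ) 1) ∧
  ∃ (w : Fin 2 → ℝ × ℝ → ℝ) (γ : Fin 2 → ℝ → ℝ) (γL γR : ℝ → ℝ),
    (∀ i, MemLp (fun p => P.phi i (u p)) 2 (volume.restrict (P.cyl i)) ∧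
      MemLp (w i) 2 (volume.restrict (P.cyl i)) ∧
      HasWeakDerivX (P.cyl i) (fun p => P.phi i (u p)) (w i)) ∧
    (∀ i, P.HasLateralTrace i 0 u (γ i)) ∧
    P.HasLateralTrace 0 (-1) u γL ∧
    P.HasLateralTrace 1 1 u γR ∧
    (∀ᵐ t ∂(volume.restrict (Ioo 0 P.T)), P.Connected (γ 0 t) (γ 1 t)) ∧
    ∀ ψ, P.IsTest ψ → P.WeakIdentity u₀ u w γL γR ψ

/-- Bounded-flux solutions: weak solutions such that `∂_x φ_i(u) ∈ L^∞(Ω_i × (0,T))`. -/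
def IsBoundedFluxSolution (u₀ : ℝ → ℝ) (u : ℝ × ℝ → ℝ) : Prop :=
  P.IsWeakSolution u₀ u ∧
  ∀ i, ∃ w : ℝ × ℝ → ℝ, HasWeakDerivX (P.cyl i) (fun p => P.phi i (u p)) w ∧
    MemLp w ⊤ (volume.restrict (P.cyl i))

/-- Initial data `u₀ ∈ L^∞(-1,1)`, `0 ≤ u₀ ≤ 1`, with `∂_x φ_i(u₀) ∈ L^∞(Ω_i)` and whose traces
at `x = 0` have connected capillary pressures. -/
structure IsRegularInitial (u₀ : ℝ → ℝ) : Prop where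
  meas : AEStronglyMeasurable u₀ (volume.restrict (Ioo (-1) 1))
  mem : ∀ᵐ x ∂(volume.restrict (Ioo (-1 : ℝ) 1)), u₀ x ∈ Icc (0 : ℝ) 1
  bounded_deriv : ∀ i, ∃ w : ℝ → ℝ, HasWeakDeriv (layer i) (fun x => P.phi i (u₀ x)) w ∧
    MemLp w ⊤ (volume.restrict (layer i))
  connected : ∃ a b : ℝ, HasTrace (layer 0) 0 u₀ a ∧ HasTrace (layer 1) 0 u₀ b ∧
    P.Connected a b

/-! ### The implicit finite volume scheme

`δx = 1/N`, `x_j = j/N` for `-N ≤ j ≤ N`, `δt = T/M`, `t^n = nT/M` for `0 ≤ n ≤ M`.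
A discrete unknown is `v : ℕ → ℤ → ℝ`, where `v n j` is the value `u_{j+1/2}^n` in the cell
`(x_j, x_{j+1})`, `-N ≤ j ≤ N-1`. -/

/-- The layer that contains the cell `(x_j, x_{j+1})`. -/
def cellLayer (j : ℤ) : Fin 2 := if j < 0 then 0 else 1

/-- The mean value of `g` over `(t^n, t^{n+1})`. -/
def timeMean (M : ℕ) (g : ℝ → ℝ) (n : ℕ) : ℝ :=
  1 / (P.T / M) * ∫ t in (n * (P.T / M))..((n + 1) * (P.T / M)), g t

/-- The numerical flux on the left of the interface, between the last left cell (value `a`) and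
the left interface value `c`. -/
def interfaceFluxL (N : ℕ) (a c : ℝ) : ℝ :=
  P.G 0 a c - 2 * (P.phi 0 c - P.phi 0 a) / (1 / N)

/-- The numerical flux on the right of the interface, between the right interface value `d` and
the first right cell (value `b`). -/
def interfaceFluxR (N : ℕ) (d b : ℝ) : ℝ :=
  P.G 1 d b - 2 * (P.phi 1 b - P.phi 1 d) / (1 / N)

/-- The numerical flux `F_j` through `x_j`, `-N ≤ j ≤ N`, at one time level, for the cell values
`U`, the boundary values `l` and `r` and the left interface value `c`. -/
def flux (N : ℕ) (l r : ℝ) (U : ℤ → ℝ) (c : ℝ) (j : ℤ) : ℝ :=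
  if j = -N then P.G 0 l (U (-N))
  else if j = N then P.G 1 (U (N - 1)) r
  else if j = 0 then P.interfaceFluxL N (U (-1)) c
  else P.G (cellLayer j) (U (j - 1)) (U j)
    - (P.phi (cellLayer j) (U j) - P.phi (cellLayer j) (U (j - 1))) / (1 / N)

/-- `v` is the family of cell values of a discrete solution of the scheme with initial datum `u₀`
on the mesh with parameters `N`, `M`. The interface values at time level `n` are `c n`
(left) and `d n` (right). -/
def IsDiscreteSolution (u₀ : ℝ → ℝ) (N M : ℕ) (v : ℕ → ℤ → ℝ) : Prop :=
  (∀ j ∈ Ico (-N : ℤ) N, v 0 j = 1 / (1 / N) * ∫ x in ((j : ℝ) / N)..((j + 1) / N), u₀ x) ∧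
  (∀ n ≤ M, ∀ j ∈ Ico (-N : ℤ) N, v n j ∈ Icc (0 : ℝ) 1) ∧
  ∃ c d : ℕ → ℝ, ∀ n < M,
    c (n + 1) ∈ Icc (0 : ℝ) 1 ∧ d (n + 1) ∈ Icc (0 : ℝ) 1 ∧
    P.interfaceFluxL N (v (n + 1) (-1)) (c (n + 1))
      = P.interfaceFluxR N (d (n + 1)) (v (n + 1) 0) ∧
    P.Connected (c (n + 1)) (d (n + 1)) ∧
    ∀ j ∈ Ico (-N : ℤ) N,
      P.porosity (cellLayer j) * ((v (n + 1) j - v n j) / (P.T / M)) * (1 / N)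
        + P.flux N (P.timeMean M P.uL n) (P.timeMean M P.uR n) (v (n + 1)) (c (n + 1)) (j + 1)
        - P.flux N (P.timeMean M P.uL n) (P.timeMean M P.uR n) (v (n + 1)) (c (n + 1)) j = 0

/-- The piecewise constant function with value `v (n+1) j` on `(x_j, x_{j+1}) × (t^n, t^{n+1}]`
and `v 0 j` on `(x_j, x_{j+1}) × {0}`. -/
def discreteFun (N M : ℕ) (v : ℕ → ℤ → ℝ) : ℝ × ℝ → ℝ :=
  fun p => v ⌈p.2 / (P.T / M)⌉₊ ⌊p.1 / (1 / (N : ℝ))⌋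

/-- `u` is an adherence value in `L^r(Ω × (0,T))` of the sequence `U`. -/
def IsAdherenceValue (r : ENNReal) (U : ℕ → ℝ × ℝ → ℝ) (u : ℝ × ℝ → ℝ) : Prop :=
  MemLp u r (volume.restrict P.domain) ∧
  ∃ k : ℕ → ℕ, StrictMono k ∧
    Tendsto (fun p => eLpNorm (U (k p) - u) r (volume.restrict P.domain)) atTop (𝓝 0)

end Problem

end TwoPhase

end

/-! The whole proof rests on a maximum principle for the numerical fluxes
(`Problem.IsStep.abs_flux_le`). Suppose the flux at the new level is largest at a face that is not
on the boundary. The balances of the two adjacent cells show that, over the time step, the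
saturation has not increased on the left of the face nor decreased on its right. A monotone flux is
then at most what it was for the old cell values. At `x = 0` the same argument works because the
pairs of saturations with connected pressures are totally ordered componentwise
(`Rock.Connected.monotone`), and the boundary fluxes are values of the bounded function `G`. At time
zero a bound `C` comes from the Lipschitz continuity of `φ_i(u₀)` and its connected traces, so all
fluxes at all levels are bounded by a `C` independent of the mesh.

Bounded fluxes make `φ_i(u_D)` Lipschitz in space up to the mesh size. The limit `φ_i(u)` is
therefore Lipschitz in space for almost every time, which gives the bound on its weak derivative.
Since `φ_i` is strictly increasing, its inverse is uniformly continuous and these facts transfer to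
`u`: traces exist, and discrete values close to a face converge to them. The interface values differ
from the neighbouring cell values by `O(1/N)` after applying `φ_i`, so they have the same limits,
and connectedness is a closed condition.

For the weak formulation, the discrete time derivative tested with `ψ` has its limit computed in two
ways: at fixed `x` by summation by parts in time (`SchemeLimit.tendsto_integral_massRate`), and at
fixed `t` through the balance and the weak convergence of difference quotients (`tendsto_massRate`).
Equality of the two limits is the required identity (`SchemeLimit.weakIdentity`).

Existence of a solution needs discrete solutions and a convergent subsequence. One implicit step is
a fixed point of an order-preserving map on `[0,1]`-valued sequences (`exists_implicit_step`).
Compactness comes from asymptotic equicontinuity (`Problem.exists_equicontinuity`), where regularity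
in time follows from regularity in space and the mass balance of a block of cells. -/

namespace TwoPhase

/-! ### Constitutive functions and the interface graph. -/

/-- Continuous injective functions on `[0,1]` have a uniformly continuous inverse. -/
theorem exists_modulus_inverse {f : ℝ → ℝ} (hf : ContinuousOn f (Icc 0 1))
    (hi : InjOn f (Icc 0 1)) {ε : ℝ} (hε : 0 < ε) :
    ∃ η > 0, ∀ s ∈ Icc (0 : ℝ) 1, ∀ t ∈ Icc (0 : ℝ) 1, |f s - f t| ≤ η → |s - t| ≤ ε := by
  have hK : IsCompact ((Icc (0 : ℝ) 1 ×ˢ Icc (0 : ℝ) 1) ∩ {p : ℝ × ℝ | ε ≤ |p.1 - p.2|}) :=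
    (isCompact_Icc.prod isCompact_Icc).inter_right
      (isClosed_le continuous_const (by fun_prop))
  have hc : ContinuousOn (fun p : ℝ × ℝ => |f p.1 - f p.2|)
      ((Icc (0 : ℝ) 1 ×ˢ Icc (0 : ℝ) 1) ∩ {p : ℝ × ℝ | ε ≤ |p.1 - p.2|}) := by
    refine ((hf.comp continuous_fst.continuousOn fun p hp => hp.1.1).sub
      (hf.comp continuous_snd.continuousOn fun p hp => hp.1.2)).abs
  rcases ((Icc (0 : ℝ) 1 ×ˢ Icc (0 : ℝ) 1) ∩ {p : ℝ × ℝ | ε ≤ |p.1 - p.2|}).eq_empty_or_nonempty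
    with he | hne
  · refine ⟨1, one_pos, fun s hs t ht _ => ?_⟩
    by_contra h
    have : ((s, t) : ℝ × ℝ) ∈ (∅ : Set (ℝ × ℝ)) := he ▸ ⟨⟨hs, ht⟩, (not_le.1 h).le⟩
    exact this
  · obtain ⟨p, hp, hmin⟩ := hK.exists_isMinOn hne hc
    have hpos : 0 < |f p.1 - f p.2| := by
      rw [abs_pos, sub_ne_zero]
      intro h
      have h1 := hi hp.1.1 hp.1.2 h
      have h2 : ε ≤ |p.1 - p.2| := hp.2
      rw [h1, sub_self, abs_zero] at h2
      linarith
    -- Half of the minimum over pairs at distance at least `ε`, since the hypothesis on `|f s - f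
    -- t|` is a non-strict inequality.
    refine ⟨|f p.1 - f p.2| / 2, by positivity, fun s hs t ht h => ?_⟩
    by_contra h'
    have : |f p.1 - f p.2| ≤ |f s - f t| :=
      hmin (show (s, t) ∈ _ from ⟨⟨hs, ht⟩, (not_le.1 h').le⟩)
    linarith

namespace Rock

variable (R : Rock)

theorem cap_continuousOn (i : Fin 2) : ContinuousOn (R.cap i) (Icc 0 1) :=
  (R.cap_lipschitz i).choose_spec.continuousOn

theorem muO_continuousOn (i : Fin 2) : ContinuousOn (R.muO i) (Icc 0 1) :=
  (R.muO_lipschitz i).choose_spec.continuousOn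

theorem muW_continuousOn (i : Fin 2) : ContinuousOn (R.muW i) (Icc 0 1) :=
  (R.muW_lipschitz i).choose_spec.continuousOn

theorem muO_nonneg (i : Fin 2) {s : ℝ} (hs : s ∈ Icc (0 : ℝ) 1) : 0 ≤ R.muO i s := by
  rw [← R.muO_zero i]
  exact (R.muO_strictMono i).monotoneOn ⟨le_rfl, zero_le_one⟩ hs hs.1

theorem muW_nonneg (i : Fin 2) {s : ℝ} (hs : s ∈ Icc (0 : ℝ) 1) : 0 ≤ R.muW i s := by
  rw [← R.muW_one i]
  exact (R.muW_strictAnti i).antitoneOn hs ⟨zero_le_one, le_rfl⟩ hs.2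

theorem muO_pos (i : Fin 2) {s : ℝ} (hs : s ∈ Ioc (0 : ℝ) 1) : 0 < R.muO i s := by
  rw [← R.muO_zero i]
  exact R.muO_strictMono i ⟨le_rfl, zero_le_one⟩ ⟨hs.1.le, hs.2⟩ hs.1

theorem muW_pos (i : Fin 2) {s : ℝ} (hs : s ∈ Ico (0 : ℝ) 1) : 0 < R.muW i s := by
  rw [← R.muW_one i]
  exact R.muW_strictAnti i ⟨hs.1, hs.2.le⟩ ⟨zero_le_one, le_rfl⟩ hs.2

/-- The two mobilities vanish at opposite ends of `[0,1]`, so the denominator in `λ_i` and `f_i`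
never does. -/
theorem mu_add_pos (i : Fin 2) {s : ℝ} (hs : s ∈ Icc (0 : ℝ) 1) :
    0 < R.muO i s + R.muW i s := by
  rcases hs.1.eq_or_lt with h | h
  · have := R.muW_pos i (s := s) ⟨hs.1, by rw [← h]; exact one_pos⟩
    linarith [R.muO_nonneg i hs]
  · linarith [R.muO_pos i (s := s) ⟨h, hs.2⟩, R.muW_nonneg i hs]

theorem lam_pos (i : Fin 2) {s : ℝ} (hs : s ∈ Ioo (0 : ℝ) 1) : 0 < R.lam i s :=
  div_pos (mul_pos (R.muO_pos i ⟨hs.1, hs.2.le⟩) (R.muW_pos i ⟨hs.1.le, hs.2⟩))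
    (R.mu_add_pos i ⟨hs.1.le, hs.2.le⟩)

theorem lam_continuousOn (i : Fin 2) : ContinuousOn (R.lam i) (Icc 0 1) :=
  ((R.muO_continuousOn i).mul (R.muW_continuousOn i)).div
    ((R.muO_continuousOn i).add (R.muW_continuousOn i)) fun _ hs => (R.mu_add_pos i hs).ne'

/-- Only the open interval is covered: outside `[0,1]` the capillary pressure is arbitrary, so its
two-sided derivative at an end point carries no information. -/
theorem exists_lam_mul_deriv_cap_bound (i : Fin 2) :
    ∃ L : ℝ, 0 < L ∧ ∀ s ∈ Ioo (0 : ℝ) 1, |R.lam i s * deriv (R.cap i) s| ≤ L := by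
  obtain ⟨K, hK⟩ := R.cap_lipschitz i
  obtain ⟨B, hB⟩ := isCompact_Icc.exists_bound_of_continuousOn (R.lam_continuousOn i)
  refine ⟨|B| * K + 1, by positivity, fun s hs => ?_⟩
  have h1 : ‖deriv (R.cap i) s‖ ≤ K :=
    norm_deriv_le_of_lipschitzOn (Icc_mem_nhds hs.1 hs.2) hK
  have h2 := hB s ⟨hs.1.le, hs.2.le⟩
  rw [abs_mul]
  rw [Real.norm_eq_abs] at h1 h2
  have := mul_le_mul (h2.trans (le_abs_self B)) h1 (abs_nonneg _) (abs_nonneg _)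
  linarith

theorem integrableOn_lam_mul_deriv_cap (i : Fin 2) :
    IntegrableOn (fun s => R.lam i s * deriv (R.cap i) s) (Ioo 0 1) := by
  obtain ⟨L, -, hL⟩ := R.exists_lam_mul_deriv_cap_bound i
  refine IntegrableOn.of_bound (C := L) (by simp) ?_ ?_
  · exact ((R.lam_continuousOn i).mono Ioo_subset_Icc_self).aestronglyMeasurable
      measurableSet_Ioo |>.mul (measurable_deriv _).aestronglyMeasurable
  · exact (ae_restrict_iff' measurableSet_Ioo).2 (ae_of_all _ hL)

theorem intervalIntegrable_lam_mul_deriv_cap (i : Fin 2) {a b : ℝ} (ha : a ∈ Icc (0 : ℝ) 1)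
    (hb : b ∈ Icc (0 : ℝ) 1) :
    IntervalIntegrable (fun s => R.lam i s * deriv (R.cap i) s) volume a b := by
  have h := R.integrableOn_lam_mul_deriv_cap i
  rw [← intervalIntegrable_iff_integrableOn_Ioo_of_le zero_le_one] at h
  exact h.mono_set (by rw [uIcc_of_le (zero_le_one' ℝ)]; exact uIcc_subset_Icc ha hb)

theorem phi_sub (i : Fin 2) {a b : ℝ} (ha : a ∈ Icc (0 : ℝ) 1) (hb : b ∈ Icc (0 : ℝ) 1) :
    R.phi i b - R.phi i a = ∫ s in a..b, R.lam i s * deriv (R.cap i) s :=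
  intervalIntegral.integral_interval_sub_left
    (R.intervalIntegrable_lam_mul_deriv_cap i ⟨le_rfl, zero_le_one⟩ hb)
    (R.intervalIntegrable_lam_mul_deriv_cap i ⟨le_rfl, zero_le_one⟩ ha)

theorem exists_phi_lipschitz (i : Fin 2) :
    ∃ L : ℝ, 0 < L ∧ ∀ a ∈ Icc (0 : ℝ) 1, ∀ b ∈ Icc (0 : ℝ) 1,
      |R.phi i a - R.phi i b| ≤ L * |a - b| := by
  obtain ⟨L, hL0, hL⟩ := R.exists_lam_mul_deriv_cap_bound i
  refine ⟨L, hL0, fun a ha b hb => ?_⟩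
  rw [R.phi_sub i hb ha]
  rw [← Real.norm_eq_abs]
  refine intervalIntegral.norm_integral_le_of_norm_le_const_ae ?_
  -- The interval of integration is half-open and may contain `1`, where the integrand is not
  -- controlled.
  filter_upwards [Measure.ae_ne volume (1 : ℝ)] with s hs1 hs
  have h1 : s ∈ Ioc (0 : ℝ) 1 :=
    ⟨(le_min hb.1 ha.1).trans_lt hs.1, hs.2.trans (max_le hb.2 ha.2)⟩
  exact hL s ⟨h1.1, lt_of_le_of_ne h1.2 hs1⟩

theorem phi_continuousOn (i : Fin 2) : ContinuousOn (R.phi i) (Icc 0 1) := by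
  obtain ⟨L, hL0, hL⟩ := R.exists_phi_lipschitz i
  exact (LipschitzOnWith.of_dist_le_mul (K := ⟨L, hL0.le⟩) fun a ha b hb => hL a ha b hb).continuousOn

theorem deriv_cap_nonneg (i : Fin 2) {s : ℝ} (hs : s ∈ Ioo (0 : ℝ) 1) :
    0 ≤ deriv (R.cap i) s := by
  rw [← derivWithin_of_isOpen isOpen_Ioo hs]
  exact ((R.cap_strictMono i).monotoneOn.mono Ioo_subset_Icc_self).derivWithin_nonneg

/-- There is no lower bound on `π_i'`, so strictness is indirect. If `φ_i` took equal values at `a <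
b`, then `λ_i π_i'` would vanish almost everywhere between them, hence so would `π_i'` because `λ_i
> 0` there. As `π_i` is absolutely continuous, it would satisfy `π_i(a) = π_i(b)`. -/
theorem phi_strictMonoOn (i : Fin 2) : StrictMonoOn (R.phi i) (Icc 0 1) := by
  intro a ha b hb hab
  have hsub : Ioo a b ⊆ Ioo (0 : ℝ) 1 := Ioo_subset_Ioo ha.1 hb.2
  have hint := R.intervalIntegrable_lam_mul_deriv_cap i ha hb
  have hnn : ∀ᵐ s ∂volume.restrict (Ioc a b), 0 ≤ R.lam i s * deriv (R.cap i) s := by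
    rw [← restrict_Ioo_eq_restrict_Ioc]
    refine (ae_restrict_iff' measurableSet_Ioo).2 (ae_of_all _ fun s hs => ?_)
    exact mul_nonneg (R.lam_pos i (hsub hs)).le (R.deriv_cap_nonneg i (hsub hs))
  have h0 : 0 ≤ R.phi i b - R.phi i a := by
    rw [R.phi_sub i ha hb]
    exact intervalIntegral.integral_nonneg_of_ae_restrict hab.le
      (by rw [← restrict_Ioc_eq_restrict_Icc]; exact hnn)
  rcases h0.eq_or_lt with h | h
  swap
  · linarith
  exfalso
  rw [R.phi_sub i ha hb] at h
  have h1 := (intervalIntegral.integral_eq_zero_iff_of_le_of_nonneg_ae hab.le hnn hint).1 h.symm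
  obtain ⟨K, hK⟩ := R.cap_lipschitz i
  have hac : AbsolutelyContinuousOnInterval (R.cap i) a b :=
    (hK.mono (uIcc_subset_Icc ha hb)).absolutelyContinuousOnInterval
  have h2 := hac.integral_deriv_eq_sub
  have h3 : ∫ s in a..b, deriv (R.cap i) s = 0 := by
    rw [intervalIntegral.integral_of_le hab.le]
    refine integral_eq_zero_of_ae ?_
    rw [← restrict_Ioo_eq_restrict_Ioc] at h1 ⊢
    filter_upwards [h1, ae_restrict_mem measurableSet_Ioo] with s hs hs'
    exact (mul_eq_zero.1 hs).resolve_left (R.lam_pos i (hsub hs')).ne'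
  have := R.cap_strictMono i ha hb hab
  linarith

/-- All estimates of the scheme concern `φ_i(u)`; this is what turns them into estimates on `u`,
with one `η` for both layers. -/
theorem exists_phi_modulus {ε : ℝ} (hε : 0 < ε) :
    ∃ η > 0, ∀ i, ∀ s ∈ Icc (0 : ℝ) 1, ∀ t ∈ Icc (0 : ℝ) 1,
      |R.phi i s - R.phi i t| ≤ η → |s - t| ≤ ε := by
  choose η hη h using fun i =>
    exists_modulus_inverse (R.phi_continuousOn i) (R.phi_strictMonoOn i).injOn hε
  refine ⟨min (η 0) (η 1), lt_min (hη 0) (hη 1), fun i s hs t ht hst => h i s hs t ht ?_⟩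
  fin_cases i
  · exact hst.trans (min_le_left _ _)
  · exact hst.trans (min_le_right _ _)

theorem f_zero (i : Fin 2) : R.f i 0 = 0 := by simp [f, lam, R.muO_zero]

theorem f_one (i : Fin 2) : R.f i 1 = R.q := by
  have := R.mu_add_pos i (s := 1) ⟨zero_le_one, le_rfl⟩
  rw [R.muW_one, add_zero] at this
  simp [f, lam, R.muW_one, this.ne']

/-- The vertical half-lines at `0` and `1` point outwards, so extending the pressure to a graph
keeps it strictly increasing. -/
theorem capGraph_lt {i : Fin 2} {a b p p' : ℝ} (hp : p ∈ R.capGraph i a)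
    (hp' : p' ∈ R.capGraph i b) (hab : a < b) : p < p' := by
  have m0 : (0 : ℝ) ∈ Icc (0 : ℝ) 1 := ⟨le_rfl, zero_le_one⟩
  have m1 : (1 : ℝ) ∈ Icc (0 : ℝ) 1 := ⟨zero_le_one, le_rfl⟩
  rcases hp with ⟨rfl, h⟩ | ⟨h0, h1, rfl⟩ | ⟨rfl, h⟩ <;>
    rcases hp' with ⟨rfl, h'⟩ | ⟨h0', h1', rfl⟩ | ⟨rfl, h'⟩
  · exact absurd hab (lt_irrefl _)
  · exact h.trans_lt (R.cap_strictMono i m0 ⟨h0'.le, h1'.le⟩ h0')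
  · exact (h.trans_lt (R.cap_strictMono i m0 m1 hab)).trans_le h'
  · linarith
  · exact R.cap_strictMono i ⟨h0.le, h1.le⟩ ⟨h0'.le, h1'.le⟩ hab
  · exact (R.cap_strictMono i ⟨h0.le, h1.le⟩ m1 h1).trans_le h'
  · linarith
  · linarith
  · exact absurd hab (lt_irrefl _)

/-- If `c < c'` but `d' < d`, the two common pressures would be ordered one way by the left graph
and the other way by the right graph. This total order is what makes the interface behave like a
monotone flux. -/
theorem Connected.monotone {R : Rock} {c d c' d' : ℝ} (h : R.Connected c d)
    (h' : R.Connected c' d') : (c ≤ c' ∧ d ≤ d') ∨ (c' ≤ c ∧ d' ≤ d) := by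
  obtain ⟨p, hp0, hp1⟩ := h
  obtain ⟨p', hp0', hp1'⟩ := h'
  rcases lt_trichotomy c c' with h | h | h
  · refine Or.inl ⟨h.le, not_lt.1 fun hd => ?_⟩
    exact lt_asymm (R.capGraph_lt hp0 hp0' h) (R.capGraph_lt hp1' hp1 hd)
  · rcases le_total d d' with hd | hd
    · exact Or.inl ⟨h.le, hd⟩
    · exact Or.inr ⟨h.ge, hd⟩
  · refine Or.inr ⟨h.le, not_lt.1 fun hd => ?_⟩
    exact lt_asymm (R.capGraph_lt hp0' hp0 h) (R.capGraph_lt hp1 hp1' hd)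

/-- Eliminates the existentially quantified pressure. What remains is a combination of closed
conditions, which passes to limits. -/
theorem connected_iff {c d : ℝ} (hc : c ∈ Icc (0 : ℝ) 1) (hd : d ∈ Icc (0 : ℝ) 1) :
    R.Connected c d ↔ (c = 0 ∨ d = 1 ∨ R.cap 0 c ≤ R.cap 1 d) ∧
      (d = 0 ∨ c = 1 ∨ R.cap 1 d ≤ R.cap 0 c) := by
  constructor
  · rintro ⟨p, hp, hp'⟩
    rcases hp with ⟨rfl, h⟩ | ⟨h0, h1, rfl⟩ | ⟨rfl, h⟩ <;>
      rcases hp' with ⟨rfl, h'⟩ | ⟨h0', h1', h'⟩ | ⟨rfl, h'⟩ <;> simp_all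
    all_goals linarith
  · rintro ⟨h1, h2⟩
    have key : ∀ i : Fin 2, ∀ s ∈ Icc (0 : ℝ) 1, R.cap i s ∈ R.capGraph i s := by
      intro i s hs
      rcases hs.1.eq_or_lt with rfl | h
      · exact Or.inl ⟨rfl, le_rfl⟩
      rcases hs.2.eq_or_lt with rfl | h'
      · exact Or.inr (Or.inr ⟨rfl, le_rfl⟩)
      · exact Or.inr (Or.inl ⟨h, h', rfl⟩)
    have key0 : ∀ i : Fin 2, ∀ p ≤ R.cap i 0, p ∈ R.capGraph i 0 :=
      fun i p hp => Or.inl ⟨rfl, hp⟩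
    have key1 : ∀ i : Fin 2, ∀ p, R.cap i 1 ≤ p → p ∈ R.capGraph i 1 :=
      fun i p hp => Or.inr (Or.inr ⟨rfl, hp⟩)
    rcases h1 with rfl | rfl | h1
    · rcases h2 with rfl | h | h
      · exact ⟨min (R.cap 0 0) (R.cap 1 0), key0 0 _ (min_le_left _ _), key0 1 _ (min_le_right _ _)⟩
      · norm_num at h
      · exact ⟨R.cap 1 d, key0 0 _ h, key 1 _ hd⟩
    · rcases h2 with h | rfl | h
      · norm_num at h
      · exact ⟨max (R.cap 0 1) (R.cap 1 1), key1 0 _ (le_max_left _ _), key1 1 _ (le_max_right _ _)⟩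
      · exact ⟨R.cap 0 c, key 0 _ hc, key1 1 _ h⟩
    · rcases h2 with rfl | rfl | h
      · exact ⟨R.cap 0 c, key 0 _ hc, key0 1 _ h1⟩
      · exact ⟨R.cap 1 d, key1 0 _ h1, key 1 _ hd⟩
      · exact ⟨R.cap 0 c, key 0 _ hc, by rw [le_antisymm h1 h]; exact key 1 _ hd⟩

theorem Connected.of_tendsto {c d : ℕ → ℝ} {c' d' : ℝ} (hc : ∀ k, c k ∈ Icc (0 : ℝ) 1)
    (hd : ∀ k, d k ∈ Icc (0 : ℝ) 1) (hcc : Tendsto c atTop (𝓝 c')) (hdd : Tendsto d atTop (𝓝 d'))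
    (h : ∀ k, R.Connected (c k) (d k)) : R.Connected c' d' := by
  have hc' : c' ∈ Icc (0 : ℝ) 1 := isClosed_Icc.mem_of_tendsto hcc (Eventually.of_forall hc)
  have hd' : d' ∈ Icc (0 : ℝ) 1 := isClosed_Icc.mem_of_tendsto hdd (Eventually.of_forall hd)
  have hcapc : Tendsto (fun k => R.cap 0 (c k)) atTop (𝓝 (R.cap 0 c')) :=
    (R.cap_continuousOn 0 c' hc').tendsto.comp
      (tendsto_nhdsWithin_iff.2 ⟨hcc, Eventually.of_forall hc⟩)
  have hcapd : Tendsto (fun k => R.cap 1 (d k)) atTop (𝓝 (R.cap 1 d')) :=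
    (R.cap_continuousOn 1 d' hd').tendsto.comp
      (tendsto_nhdsWithin_iff.2 ⟨hdd, Eventually.of_forall hd⟩)
  rw [R.connected_iff hc' hd']
  have hk := fun k => (R.connected_iff (hc k) (hd k)).1 (h k)
  constructor
  · by_contra! hcon
    obtain ⟨h0, h1, h2⟩ := hcon
    have := (hcc.eventually_ne h0).and ((hdd.eventually_ne h1).and (hcapd.eventually_lt hcapc h2))
    obtain ⟨k, k0, k1, k2⟩ := this.exists
    rcases (hk k).1 with h | h | h
    exacts [k0 h, k1 h, absurd h (not_le.2 k2)]
  · by_contra! hcon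
    obtain ⟨h0, h1, h2⟩ := hcon
    have := (hdd.eventually_ne h0).and ((hcc.eventually_ne h1).and (hcapc.eventually_lt hcapd h2))
    obtain ⟨k, k0, k1, k2⟩ := this.exists
    rcases (hk k).2 with h | h | h
    exacts [k0 h, k1 h, absurd h (not_le.2 k2)]

end Rock

namespace Problem

variable (P : Problem)

theorem exists_G_lipschitz :
    ∃ K : ℝ, 0 < K ∧ ∀ i, ∀ a ∈ Icc (0 : ℝ) 1, ∀ b ∈ Icc (0 : ℝ) 1, ∀ a' ∈ Icc (0 : ℝ) 1,
      ∀ b' ∈ Icc (0 : ℝ) 1, |P.G i a b - P.G i a' b'| ≤ K * (|a - a'| + |b - b'|) := by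
  choose K hK using P.G_lipschitz
  refine ⟨K 0 + K 1 + 1, by positivity, fun i a ha b hb a' ha' b' hb' => ?_⟩
  have h := (hK i).dist_le_mul (a, b) ⟨ha, hb⟩ (a', b') ⟨ha', hb'⟩
  rw [Prod.dist_eq, Real.dist_eq, Real.dist_eq, Real.dist_eq] at h
  have h2 : max |a - a'| |b - b'| ≤ |a - a'| + |b - b'| :=
    max_le_add_of_nonneg (abs_nonneg _) (abs_nonneg _)
  refine h.trans (mul_le_mul ?_ h2 (by positivity) (by positivity))
  have h0 := (K 0).2
  have h1 := (K 1).2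
  fin_cases i <;> simp only [Fin.zero_eta, Fin.mk_one] <;> linarith [(K 0).coe_nonneg, (K 1).coe_nonneg]

theorem exists_G_bound :
    ∃ B : ℝ, 0 < B ∧ ∀ i, ∀ a ∈ Icc (0 : ℝ) 1, ∀ b ∈ Icc (0 : ℝ) 1, |P.G i a b| ≤ B := by
  obtain ⟨K, hK0, hK⟩ := P.exists_G_lipschitz
  have m0 : (0 : ℝ) ∈ Icc (0 : ℝ) 1 := ⟨le_rfl, zero_le_one⟩
  refine ⟨K * 2, by positivity, fun i a ha b hb => ?_⟩
  have h := hK i a ha b hb 0 m0 0 m0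
  rw [P.G_diag i 0 m0, P.f_zero, sub_zero, sub_zero, sub_zero] at h
  refine h.trans (mul_le_mul_of_nonneg_left ?_ hK0.le)
  rw [abs_of_nonneg ha.1, abs_of_nonneg hb.1]
  linarith [ha.2, hb.2]

theorem exists_phi_lipschitz :
    ∃ L : ℝ, 0 < L ∧ ∀ i, ∀ a ∈ Icc (0 : ℝ) 1, ∀ b ∈ Icc (0 : ℝ) 1,
      |P.phi i a - P.phi i b| ≤ L * |a - b| := by
  choose L hL0 hL using P.toRock.exists_phi_lipschitz
  refine ⟨max (L 0) (L 1), lt_max_of_lt_left (hL0 0), fun i a ha b hb => (hL i a ha b hb).trans ?_⟩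
  refine mul_le_mul_of_nonneg_right ?_ (abs_nonneg _)
  fin_cases i
  · exact le_max_left _ _
  · exact le_max_right _ _

/-- Read off from the diagonal of the Lipschitz function `G`, without using the formula for `f`. -/
theorem f_continuousOn (i : Fin 2) : ContinuousOn (P.f i) (Icc 0 1) := by
  obtain ⟨K, hK⟩ := P.G_lipschitz i
  have : ContinuousOn (fun s => P.G i s s) (Icc 0 1) :=
    hK.continuousOn.comp (f := fun s : ℝ => (s, s)) (by fun_prop) fun s hs => ⟨hs, hs⟩
  exact this.congr fun s hs => (P.G_diag i s hs).symm

end Problem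

/-! ### Monotone numerical fluxes and their maximum principle. -/

namespace Problem

variable (P : Problem)

/-- The numerical flux between two cells of the same layer. -/
noncomputable def cellFlux (N : ℕ) (i : Fin 2) (a b : ℝ) : ℝ :=
  P.G i a b - (P.phi i b - P.phi i a) / (1 / N)

theorem flux_left (N : ℕ) (l r : ℝ) (U : ℤ → ℝ) (c : ℝ) :
    P.flux N l r U c (-N) = P.G 0 l (U (-N)) := by simp [flux]

theorem flux_right {N : ℕ} (hN : 0 < N) (l r : ℝ) (U : ℤ → ℝ) (c : ℝ) :
    P.flux N l r U c N = P.G 1 (U (N - 1)) r := by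
  have : ¬ ((N : ℤ) = -N) := by omega
  simp [flux, this]

theorem flux_zero {N : ℕ} (hN : 0 < N) (l r : ℝ) (U : ℤ → ℝ) (c : ℝ) :
    P.flux N l r U c 0 = P.interfaceFluxL N (U (-1)) c := by
  have h1 : ¬ ((0 : ℤ) = -N) := by omega
  have h2 : ¬ ((0 : ℤ) = N) := by omega
  simp only [flux, h1, h2, if_false, if_true]

theorem flux_interior {N : ℕ} (l r : ℝ) (U : ℤ → ℝ) (c : ℝ) {j : ℤ} (h1 : -(N : ℤ) < j)
    (h2 : j < N) (h0 : j ≠ 0) :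
    P.flux N l r U c j = P.cellFlux N (cellLayer j) (U (j - 1)) (U j) := by
  simp only [flux, h1.ne', h2.ne, h0, if_false, cellFlux]

theorem cellFlux_mono {N : ℕ} (i : Fin 2) {a b a' b' : ℝ} (ha : a ∈ Icc (0 : ℝ) 1)
    (hb : b ∈ Icc (0 : ℝ) 1) (ha' : a' ∈ Icc (0 : ℝ) 1) (hb' : b' ∈ Icc (0 : ℝ) 1)
    (haa : a ≤ a') (hbb : b' ≤ b) : P.cellFlux N i a b ≤ P.cellFlux N i a' b' := by
  have h1 : P.G i a b ≤ P.G i a' b := P.G_mono i b hb ha ha' haa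
  have h2 : P.G i a' b ≤ P.G i a' b' := P.G_anti i a' ha' hb' hb hbb
  have h3 := (P.phi_strictMonoOn i).monotoneOn ha ha' haa
  have h4 := (P.phi_strictMonoOn i).monotoneOn hb' hb hbb
  have h5 : (P.phi i b' - P.phi i a') / (1 / N) ≤ (P.phi i b - P.phi i a) / (1 / (N : ℝ)) :=
    div_le_div_of_nonneg_right (by linarith) (by positivity)
  unfold cellFlux
  linarith

theorem interfaceFluxL_eq (N : ℕ) (a c : ℝ) :
    P.interfaceFluxL N a c = P.G 0 a c - 2 * N * (P.phi 0 c - P.phi 0 a) := by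
  unfold interfaceFluxL
  rw [div_div_eq_mul_div, div_one]
  ring

theorem interfaceFluxR_eq (N : ℕ) (d b : ℝ) :
    P.interfaceFluxR N d b = P.G 1 d b - 2 * N * (P.phi 1 b - P.phi 1 d) := by
  unfold interfaceFluxR
  rw [div_div_eq_mul_div, div_one]
  ring

theorem cellFlux_eq (N : ℕ) (i : Fin 2) (a b : ℝ) :
    P.cellFlux N i a b = P.G i a b - N * (P.phi i b - P.phi i a) := by
  unfold cellFlux
  rw [div_div_eq_mul_div, div_one]
  ring

theorem interfaceFluxL_mono {N : ℕ} {a c a' c' : ℝ} (ha : a ∈ Icc (0 : ℝ) 1)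
    (hc : c ∈ Icc (0 : ℝ) 1) (ha' : a' ∈ Icc (0 : ℝ) 1) (hc' : c' ∈ Icc (0 : ℝ) 1)
    (haa : a ≤ a') (hcc : c' ≤ c) : P.interfaceFluxL N a c ≤ P.interfaceFluxL N a' c' := by
  have h1 : P.G 0 a c ≤ P.G 0 a' c := P.G_mono 0 c hc ha ha' haa
  have h2 : P.G 0 a' c ≤ P.G 0 a' c' := P.G_anti 0 a' ha' hc' hc hcc
  have h3 := (P.phi_strictMonoOn 0).monotoneOn ha ha' haa
  have h4 := (P.phi_strictMonoOn 0).monotoneOn hc' hc hcc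
  have h5 : 2 * (N : ℝ) * (P.phi 0 c' - P.phi 0 a') ≤ 2 * N * (P.phi 0 c - P.phi 0 a) :=
    mul_le_mul_of_nonneg_left (by linarith) (by positivity)
  rw [interfaceFluxL_eq, interfaceFluxL_eq]
  linarith

theorem interfaceFluxR_mono {N : ℕ} {d b d' b' : ℝ} (hd : d ∈ Icc (0 : ℝ) 1)
    (hb : b ∈ Icc (0 : ℝ) 1) (hd' : d' ∈ Icc (0 : ℝ) 1) (hb' : b' ∈ Icc (0 : ℝ) 1)
    (hdd : d ≤ d') (hbb : b' ≤ b) : P.interfaceFluxR N d b ≤ P.interfaceFluxR N d' b' := by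
  have h1 : P.G 1 d b ≤ P.G 1 d' b := P.G_mono 1 b hb hd hd' hdd
  have h2 : P.G 1 d' b ≤ P.G 1 d' b' := P.G_anti 1 d' hd' hb' hb hbb
  have h3 := (P.phi_strictMonoOn 1).monotoneOn hd hd' hdd
  have h4 := (P.phi_strictMonoOn 1).monotoneOn hb' hb hbb
  have h5 : 2 * (N : ℝ) * (P.phi 1 b' - P.phi 1 d') ≤ 2 * N * (P.phi 1 b - P.phi 1 d) :=
    mul_le_mul_of_nonneg_left (by linarith) (by positivity)
  rw [interfaceFluxR_eq, interfaceFluxR_eq]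
  linarith

/-- The two connected pairs are comparable: if `(c, d) ≤ (c', d')` the right fluxes are compared,
otherwise the left ones. Equality of the left and right fluxes is required only for the first
configuration, because the initial cell averages, paired with the traces of `u₀`, need not satisfy
it. -/
theorem interfaceFlux_le_max {N : ℕ} {a b c d a' b' c' d' : ℝ} (ha : a ∈ Icc (0 : ℝ) 1)
    (hb : b ∈ Icc (0 : ℝ) 1) (hc : c ∈ Icc (0 : ℝ) 1) (hd : d ∈ Icc (0 : ℝ) 1)
    (ha' : a' ∈ Icc (0 : ℝ) 1) (hb' : b' ∈ Icc (0 : ℝ) 1) (hc' : c' ∈ Icc (0 : ℝ) 1)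
    (hd' : d' ∈ Icc (0 : ℝ) 1) (haa : a ≤ a') (hbb : b' ≤ b) (h : P.Connected c d)
    (h' : P.Connected c' d') (heq : P.interfaceFluxL N a c = P.interfaceFluxR N d b) :
    P.interfaceFluxL N a c ≤ max (P.interfaceFluxL N a' c') (P.interfaceFluxR N d' b') := by
  rcases h.monotone h' with ⟨-, h2⟩ | ⟨h1, -⟩
  · rw [heq]
    exact le_max_of_le_right (P.interfaceFluxR_mono hd hb hd' hb' h2 hbb)
  · exact le_max_of_le_left (P.interfaceFluxL_mono ha hc ha' hc' haa h1)

theorem min_le_interfaceFlux {N : ℕ} {a b c d a' b' c' d' : ℝ} (ha : a ∈ Icc (0 : ℝ) 1)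
    (hb : b ∈ Icc (0 : ℝ) 1) (hc : c ∈ Icc (0 : ℝ) 1) (hd : d ∈ Icc (0 : ℝ) 1)
    (ha' : a' ∈ Icc (0 : ℝ) 1) (hb' : b' ∈ Icc (0 : ℝ) 1) (hc' : c' ∈ Icc (0 : ℝ) 1)
    (hd' : d' ∈ Icc (0 : ℝ) 1) (haa : a ≤ a') (hbb : b' ≤ b) (h : P.Connected c d)
    (h' : P.Connected c' d') (heq : P.interfaceFluxL N a' c' = P.interfaceFluxR N d' b') :
    min (P.interfaceFluxL N a c) (P.interfaceFluxR N d b) ≤ P.interfaceFluxL N a' c' := by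
  rcases h.monotone h' with ⟨-, h2⟩ | ⟨h1, -⟩
  · rw [heq]
    exact min_le_of_right_le (P.interfaceFluxR_mono hd hb hd' hb' h2 hbb)
  · exact min_le_of_left_le (P.interfaceFluxL_mono ha hc ha' hc' haa h1)

/-- The interior numerical fluxes of the cell values `U` are bounded by `C`. -/
def FluxBounded (N : ℕ) (C : ℝ) (U : ℤ → ℝ) : Prop :=
  (∀ j : ℤ, -(N : ℤ) < j → j < N → j ≠ 0 →
    |P.cellFlux N (cellLayer j) (U (j - 1)) (U j)| ≤ C) ∧
  ∃ c ∈ Icc (0 : ℝ) 1, ∃ d ∈ Icc (0 : ℝ) 1, P.Connected c d ∧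
    |P.interfaceFluxL N (U (-1)) c| ≤ C ∧ |P.interfaceFluxR N d (U 0)| ≤ C

/-- One step of the implicit scheme, from the cell values `W` to the cell values `U`, with boundary
values `l` and `r` and interface values `c` and `d`. -/
structure IsStep (N : ℕ) (δ l r : ℝ) (W U : ℤ → ℝ) (c d : ℝ) : Prop where
  left_mem : c ∈ Icc (0 : ℝ) 1
  right_mem : d ∈ Icc (0 : ℝ) 1
  flux_eq : P.interfaceFluxL N (U (-1)) c = P.interfaceFluxR N d (U 0)
  connected : P.Connected c d
  balance : ∀ j ∈ Ico (-N : ℤ) N,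
    P.porosity (cellLayer j) * ((U j - W j) / δ) * (1 / N)
      + P.flux N l r U c (j + 1) - P.flux N l r U c j = 0

variable {P}

theorem IsStep.le_of_flux_le {N : ℕ} (hN : 0 < N) {δ l r : ℝ} (hδ : 0 < δ) {W U : ℤ → ℝ} {c d : ℝ}
    (h : P.IsStep N δ l r W U c d) {j : ℤ} (hj : j ∈ Ico (-N : ℤ) N)
    (hF : P.flux N l r U c (j + 1) ≤ P.flux N l r U c j) : W j ≤ U j := by
  by_contra! hcon
  have hb := h.balance j hj
  have hN' : (0 : ℝ) < N := by exact_mod_cast hN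
  have h1 : 0 < (W j - U j) / δ := div_pos (by linarith) hδ
  have h2 : 0 < P.porosity (cellLayer j) * ((W j - U j) / δ) * (1 / N) :=
    mul_pos (mul_pos (P.porosity_mem _).1 h1) (by positivity)
  have h3 : P.porosity (cellLayer j) * ((W j - U j) / δ) * (1 / N)
    = -(P.porosity (cellLayer j) * ((U j - W j) / δ) * (1 / N)) := by ring
  linarith

theorem IsStep.le_of_le_flux {N : ℕ} (hN : 0 < N) {δ l r : ℝ} (hδ : 0 < δ) {W U : ℤ → ℝ} {c d : ℝ}
    (h : P.IsStep N δ l r W U c d) {j : ℤ} (hj : j ∈ Ico (-N : ℤ) N)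
    (hF : P.flux N l r U c j ≤ P.flux N l r U c (j + 1)) : U j ≤ W j := by
  by_contra! hcon
  have hb := h.balance j hj
  have hN' : (0 : ℝ) < N := by exact_mod_cast hN
  have h1 : 0 < (U j - W j) / δ := div_pos (by linarith) hδ
  have h2 : 0 < P.porosity (cellLayer j) * ((U j - W j) / δ) * (1 / N) :=
    mul_pos (mul_pos (P.porosity_mem _).1 h1) (by positivity)
  linarith

/-- Maximum principle for the numerical fluxes. -/
theorem IsStep.abs_flux_le {N : ℕ} (hN : 0 < N) {δ l r : ℝ} (hδ : 0 < δ) {W U : ℤ → ℝ} {c d : ℝ}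
    (h : P.IsStep N δ l r W U c d) (hl : l ∈ Icc (0 : ℝ) 1) (hr : r ∈ Icc (0 : ℝ) 1)
    (hW : ∀ j ∈ Ico (-N : ℤ) N, W j ∈ Icc (0 : ℝ) 1)
    (hU : ∀ j ∈ Ico (-N : ℤ) N, U j ∈ Icc (0 : ℝ) 1) {C : ℝ}
    (hC : ∀ i, ∀ a ∈ Icc (0 : ℝ) 1, ∀ b ∈ Icc (0 : ℝ) 1, |P.G i a b| ≤ C)
    (hWC : P.FluxBounded N C W) {k : ℤ} (hk : k ∈ Icc (-N : ℤ) N) :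
    |P.flux N l r U c k| ≤ C := by
  obtain ⟨hint, c₀, hc₀, d₀, hd₀, hcd₀, hL, hR⟩ := hWC
  have hbl : |P.flux N l r U c (-N)| ≤ C := by
    rw [flux_left]; exact hC 0 l hl _ (hU _ ⟨le_rfl, by omega⟩)
  have hbr : |P.flux N l r U c N| ≤ C := by
    rw [P.flux_right hN]; exact hC 1 _ (hU _ ⟨by omega, by omega⟩) r hr
  have hne : (Finset.Icc (-N : ℤ) N).Nonempty := ⟨k, by simpa using hk⟩
  rw [abs_le]
  constructor
  -- At a face of minimal flux, `e1` and `e2` say that the cell on the right has not gained and the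
  -- cell on the left has not lost, so the flux there is at least the one that `W` had.
  · obtain ⟨j, hj, hmin⟩ := Finset.exists_min_image _ (fun j => P.flux N l r U c j) hne
    have hj' := Finset.mem_Icc.1 hj
    refine le_trans ?_ (hmin k (by simpa using hk))
    rcases eq_or_ne j (-N) with rfl | h1
    · exact (abs_le.1 hbl).1
    rcases eq_or_ne j N with rfl | h2
    · exact (abs_le.1 hbr).1
    have hjI : j ∈ Ico (-N : ℤ) N := ⟨hj'.1, by omega⟩
    have hjI' : j - 1 ∈ Ico (-N : ℤ) N := ⟨by omega, by omega⟩
    have e1 : U j ≤ W j := h.le_of_le_flux hN hδ hjI (hmin (j + 1) (Finset.mem_Icc.2 (by omega)))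
    have e2 : W (j - 1) ≤ U (j - 1) := h.le_of_flux_le hN hδ hjI' (by
      rw [sub_add_cancel]; exact hmin (j - 1) (Finset.mem_Icc.2 (by omega)))
    rcases eq_or_ne j 0 with rfl | h0
    -- At the interface `W` has two one-sided fluxes for the pair `(c₀, d₀)`; both are bounded, and
    -- one of them serves for the comparison.
    · rw [P.flux_zero hN]
      refine le_trans ?_ (P.min_le_interfaceFlux (hW _ hjI') (hW _ hjI) hc₀ hd₀ (hU _ hjI')
        (hU _ hjI) h.left_mem h.right_mem e2 e1 hcd₀ h.connected h.flux_eq)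
      exact le_min (abs_le.1 hL).1 (abs_le.1 hR).1
    · rw [P.flux_interior l r U c (by omega) (by omega) h0]
      exact ((abs_le.1 (hint j (by omega) (by omega) h0)).1).trans
        (P.cellFlux_mono _ (hW _ hjI') (hW _ hjI) (hU _ hjI') (hU _ hjI) e2 e1)
  -- Mirror image: at a face of maximal flux both balances have the opposite sign.
  · obtain ⟨j, hj, hmax⟩ := Finset.exists_max_image _ (fun j => P.flux N l r U c j) hne
    have hj' := Finset.mem_Icc.1 hj
    refine (hmax k (by simpa using hk)).trans ?_
    rcases eq_or_ne j (-N) with rfl | h1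
    · exact (abs_le.1 hbl).2
    rcases eq_or_ne j N with rfl | h2
    · exact (abs_le.1 hbr).2
    have hjI : j ∈ Ico (-N : ℤ) N := ⟨hj'.1, by omega⟩
    have hjI' : j - 1 ∈ Ico (-N : ℤ) N := ⟨by omega, by omega⟩
    have e1 : W j ≤ U j := h.le_of_flux_le hN hδ hjI (hmax (j + 1) (Finset.mem_Icc.2 (by omega)))
    have e2 : U (j - 1) ≤ W (j - 1) := h.le_of_le_flux hN hδ hjI' (by
      rw [sub_add_cancel]; exact hmax (j - 1) (Finset.mem_Icc.2 (by omega)))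
    rcases eq_or_ne j 0 with rfl | h0
    · rw [P.flux_zero hN]
      refine (P.interfaceFlux_le_max (hU _ hjI') (hU _ hjI) h.left_mem h.right_mem (hW _ hjI')
        (hW _ hjI) hc₀ hd₀ e2 e1 h.connected hcd₀ h.flux_eq).trans ?_
      exact max_le (abs_le.1 hL).2 (abs_le.1 hR).2
    · rw [P.flux_interior l r U c (by omega) (by omega) h0]
      exact (P.cellFlux_mono _ (hU _ hjI') (hU _ hjI) (hW _ hjI') (hW _ hjI) e2 e1).trans
        (abs_le.1 (hint j (by omega) (by omega) h0)).2

theorem IsStep.fluxBounded {N : ℕ} (hN : 0 < N) {δ l r : ℝ} {W U : ℤ → ℝ} {c d : ℝ}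
    (h : P.IsStep N δ l r W U c d) {C : ℝ}
    (hF : ∀ k ∈ Icc (-N : ℤ) N, |P.flux N l r U c k| ≤ C) : P.FluxBounded N C U := by
  refine ⟨fun j h1 h2 h0 => ?_, c, h.left_mem, d, h.right_mem, h.connected, ?_, ?_⟩
  · rw [← P.flux_interior l r U c h1 h2 h0]
    exact hF j ⟨h1.le, h2.le⟩
  · rw [← P.flux_zero hN l r U c]
    exact hF 0 ⟨by omega, by omega⟩
  · rw [← h.flux_eq, ← P.flux_zero hN l r U c]
    exact hF 0 ⟨by omega, by omega⟩

variable (P)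

theorem timeMean_mem {M : ℕ} {g : ℝ → ℝ}
    (hg : AEStronglyMeasurable g (volume.restrict (Ioo 0 P.T)))
    (hm : ∀ᵐ t ∂(volume.restrict (Ioo 0 P.T)), g t ∈ Icc (0 : ℝ) 1) {n : ℕ} (hn : n < M) :
    P.timeMean M g n ∈ Icc (0 : ℝ) 1 := by
  have hM : (0 : ℝ) < M := by exact_mod_cast (Nat.zero_le n).trans_lt hn
  have hT := P.T_pos
  set δ := P.T / M with hδ
  have hδ0 : 0 < δ := by positivity
  have hle : (n : ℝ) * δ ≤ (n + 1) * δ := by nlinarith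
  have hsub : Ioo ((n : ℝ) * δ) ((n + 1) * δ) ⊆ Ioo 0 P.T := by
    refine Ioo_subset_Ioo (by positivity) ?_
    have : ((n : ℝ) + 1) ≤ M := by exact_mod_cast hn
    calc ((n : ℝ) + 1) * δ ≤ M * δ := by gcongr
      _ = P.T := by rw [hδ]; field_simp
  have hm' := ae_restrict_of_ae_restrict_of_subset hsub hm
  have hint : IntegrableOn g (Ioo ((n : ℝ) * δ) ((n + 1) * δ)) := by
    refine IntegrableOn.of_bound (C := 1) (by simp) (hg.mono_measure (Measure.restrict_mono hsub le_rfl)) ?_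
    filter_upwards [hm'] with t ht
    rw [Real.norm_eq_abs, abs_of_nonneg ht.1]
    exact ht.2
  have hi0 : 0 ≤ ∫ t in Ioo ((n : ℝ) * δ) ((n + 1) * δ), g t :=
    integral_nonneg_of_ae (hm'.mono fun t ht => ht.1)
  have hi1 : ∫ t in Ioo ((n : ℝ) * δ) ((n + 1) * δ), g t ≤ δ := by
    calc ∫ t in Ioo ((n : ℝ) * δ) ((n + 1) * δ), g t
        ≤ ∫ t in Ioo ((n : ℝ) * δ) ((n + 1) * δ), (1 : ℝ) :=
          integral_mono_ae hint (by simp) (hm'.mono fun t ht => ht.2)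
      _ = δ := by simp [hle]; ring
  unfold timeMean
  rw [← hδ, intervalIntegral.integral_of_le hle, integral_Ioc_eq_integral_Ioo]
  refine ⟨by positivity, ?_⟩
  rw [one_div_mul_eq_div]
  exact (div_le_one hδ0).2 hi1

end Problem

/-! ### Bounded weak derivatives and the discretisation of the initial datum. -/

/-- Mollification estimate for functions with a bounded weak derivative. -/
theorem HasWeakDeriv.abs_sub_integral_bump_le {a b L : ℝ} {v w : ℝ → ℝ}
    (h : HasWeakDeriv (Ioo a b) v w) (hvi : IntegrableOn v (Ioo a b))
    (hw : ∀ᵐ x ∂volume.restrict (Ioo a b), |w x| ≤ L) (hL : 0 ≤ L)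
    (ρ : ContDiffBump (0 : ℝ)) {x y : ℝ} (hxy : x ≤ y) (hx : a < x - ρ.rOut)
    (hy : y + ρ.rOut < b) :
    |(∫ s in Ioo a b, v s * ρ.normed volume (x - s)) -
      ∫ s in Ioo a b, v s * ρ.normed volume (y - s)| ≤ L * (y - x + 2 * ρ.rOut) := by
  have hρc : Continuous (ρ.normed volume) := ρ.continuous_normed
  have hρs : ContDiff ℝ (⊤ : ℕ∞) (ρ.normed volume) := ρ.contDiff_normed
  have hρi : ∀ p q, IntervalIntegrable (ρ.normed volume) volume p q :=
    fun p q => hρc.intervalIntegrable p q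
  have hr := ρ.rOut_pos
  set R : ℝ → ℝ := fun s => ∫ τ in (0 : ℝ)..s, ρ.normed volume τ with hR
  have hRd : ∀ s, HasDerivAt R (ρ.normed volume s) s := fun s =>
    intervalIntegral.integral_hasDerivAt_right (hρi _ _)
      hρc.aestronglyMeasurable.stronglyMeasurableAtFilter hρc.continuousAt
  have hRs : ContDiff ℝ (⊤ : ℕ∞) R := by
    refine contDiff_infty_iff_deriv.2 ⟨fun s => (hRd s).differentiableAt, ?_⟩
    rw [show deriv R = ρ.normed volume from funext fun s => (hRd s).deriv]
    exact hρs
  -- The derivative of this test function is the difference of the two shifted bumps, so testing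
  -- with it produces the difference of the mollified values. It has values in `[0,1]` and support
  -- in `[x - rOut, y + rOut]`, whence the bound `L` times the length of that interval.
  set η : ℝ → ℝ := fun s => R (y - s) - R (x - s) with hη
  have hηs : ContDiff ℝ (⊤ : ℕ∞) η :=
    (hRs.comp (contDiff_const.sub contDiff_id)).sub (hRs.comp (contDiff_const.sub contDiff_id))
  have hηd : ∀ s, deriv η s = ρ.normed volume (x - s) - ρ.normed volume (y - s) := by
    intro s
    have h1 : HasDerivAt (fun s => R (y - s)) (ρ.normed volume (y - s) * (-1)) s :=
      (hRd (y - s)).comp s ((hasDerivAt_id s).const_sub y)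
    have h2 : HasDerivAt (fun s => R (x - s)) (ρ.normed volume (x - s) * (-1)) s :=
      (hRd (x - s)).comp s ((hasDerivAt_id s).const_sub x)
    have h3 : deriv η s = _ := (h1.sub h2).deriv
    rw [h3]
    ring
  have hηeq : ∀ s, η s = ∫ τ in (x - s)..(y - s), ρ.normed volume τ := fun s =>
    intervalIntegral.integral_interval_sub_left (hρi _ _) (hρi _ _)
  have hη0 : ∀ s, 0 ≤ η s := fun s => by
    rw [hηeq]
    exact intervalIntegral.integral_nonneg (by linarith) fun _ _ => ρ.nonneg_normed _
  have hη1 : ∀ s, η s ≤ 1 := fun s => by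
    rw [hηeq, intervalIntegral.integral_of_le (by linarith), ← ρ.integral_normed (μ := volume)]
    exact setIntegral_le_integral ρ.integrable_normed (ae_of_all _ ρ.nonneg_normed)
  have hzero : ∀ τ, ρ.rOut ≤ |τ| → ρ.normed volume τ = 0 := by
    intro τ hτ
    by_contra hne
    have : τ ∈ Function.support (ρ.normed volume) := hne
    rw [ρ.support_normed_eq, mem_ball_zero_iff, Real.norm_eq_abs] at this
    linarith
  have hsupp : Function.support η ⊆ Icc (x - ρ.rOut) (y + ρ.rOut) := by
    intro s hs
    by_contra hcon
    apply hs
    rw [hηeq]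
    have hcase : s < x - ρ.rOut ∨ y + ρ.rOut < s := by
      by_contra! h'
      exact hcon ⟨h'.1, h'.2⟩
    have : ∀ τ ∈ uIcc (x - s) (y - s), ρ.normed volume τ = (fun _ => (0 : ℝ)) τ := by
      intro τ hτ
      rw [uIcc_of_le (by linarith)] at hτ
      apply hzero
      rcases hcase with h' | h'
      · exact le_trans (by linarith [hτ.1]) (le_abs_self τ)
      · exact le_trans (by linarith [hτ.2]) (neg_le_abs τ)
    rw [intervalIntegral.integral_congr this]
    simp
  have hsub : Icc (x - ρ.rOut) (y + ρ.rOut) ⊆ Ioo a b := fun s hs =>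
    ⟨hx.trans_le hs.1, hs.2.trans_lt hy⟩
  have htest := h.2.2 η hηs (HasCompactSupport.of_support_subset_isCompact isCompact_Icc hsupp)
    ((closure_minimal hsupp isClosed_Icc).trans hsub)
  obtain ⟨B, hB⟩ := (ρ.hasCompactSupport_normed (μ := volume)).exists_bound_of_continuous hρc
  have hvρ : ∀ z, IntegrableOn (fun s => v s * ρ.normed volume (z - s)) (Ioo a b) := by
    intro z
    refine Integrable.mul_bdd (c := B) hvi ?_ (ae_of_all _ fun s => hB _)
    exact (hρc.comp (continuous_const.sub continuous_id)).aestronglyMeasurable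
  have e1 : (∫ s in Ioo a b, v s * ρ.normed volume (x - s)) -
      ∫ s in Ioo a b, v s * ρ.normed volume (y - s) = ∫ s in Ioo a b, v s * deriv η s := by
    rw [← integral_sub (hvρ x) (hvρ y)]
    refine integral_congr_ae (ae_of_all _ fun s => ?_)
    simp only [hηd]
    ring
  rw [e1, htest, abs_neg, ← Real.norm_eq_abs]
  have e2 : ∫ s in Ioo a b, w s * η s = ∫ s in Icc (x - ρ.rOut) (y + ρ.rOut), w s * η s := by
    refine setIntegral_eq_of_subset_of_forall_sdiff_eq_zero measurableSet_Ioo hsub ?_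
    intro s hs
    have : η s = 0 := by
      by_contra hne
      exact hs.2 (hsupp hne)
    simp [this]
  rw [e2]
  have e3 := norm_setIntegral_le_of_norm_le_const_ae' (μ := volume)
    (s := Icc (x - ρ.rOut) (y + ρ.rOut)) (f := fun s => w s * η s) (C := L) (by simp) ?_
  · refine e3.trans (le_of_eq ?_)
    rw [Real.volume_real_Icc_of_le (by linarith)]
    ring
  · have hw' := (ae_restrict_iff' measurableSet_Ioo).1 hw
    filter_upwards [hw'] with s hs hs'
    rw [norm_mul, Real.norm_eq_abs, Real.norm_eq_abs, abs_of_nonneg (hη0 s)]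
    calc |w s| * η s ≤ L * 1 := mul_le_mul (hs (hsub hs')) (hη1 s) (hη0 s) hL
      _ = L := mul_one L

/-- A function with a bounded weak derivative is Lipschitz continuous off a null set. -/
theorem HasWeakDeriv.exists_lipschitz {a b : ℝ} {v w : ℝ → ℝ} (h : HasWeakDeriv (Ioo a b) v w)
    (hvi : IntegrableOn v (Ioo a b)) (hw : MemLp w ⊤ (volume.restrict (Ioo a b))) :
    ∃ L : ℝ, 0 ≤ L ∧ ∃ A : Set ℝ, (∀ᵐ x ∂volume.restrict (Ioo a b), x ∈ A) ∧
      ∀ x ∈ A, ∀ y ∈ A, |v x - v y| ≤ L * |x - y| := by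
  set L := (eLpNorm w ⊤ (volume.restrict (Ioo a b))).toReal with hLdef
  have hL : ∀ᵐ x ∂volume.restrict (Ioo a b), |w x| ≤ L := by
    filter_upwards [ae_le_eLpNormEssSup (f := w) (μ := volume.restrict (Ioo a b))] with x hx
    rw [← eLpNorm_exponent_top] at hx
    rw [hLdef, ← Real.norm_eq_abs, ← toReal_enorm]
    exact ENNReal.toReal_mono hw.2.ne hx
  -- The ratio of outer to inner radius stays equal to `2`; a bounded ratio is what almost
  -- everywhere convergence of the mollifications requires.
  set ρ : ℕ → ContDiffBump (0 : ℝ) := fun n =>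
    { rIn := 1 / (2 * ((n : ℝ) + 1))
      rOut := 1 / ((n : ℝ) + 1)
      rIn_pos := by positivity
      rIn_lt_rOut := by
        apply one_div_lt_one_div_of_lt <;> nlinarith [Nat.cast_nonneg (α := ℝ) n] } with hρ
  have hρ0 : Tendsto (fun n => (ρ n).rOut) atTop (𝓝 0) := tendsto_one_div_add_atTop_nhds_zero_nat
  have hloc : LocallyIntegrable (indicator (Ioo a b) v) volume :=
    ((integrable_indicator_iff measurableSet_Ioo).2 hvi).locallyIntegrable
  have hconv := ContDiffBump.ae_convolution_tendsto_right_of_locallyIntegrable (K := 2)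
    (μ := volume) (φ := ρ) hρ0 (Eventually.of_forall fun n => by
      simp only [hρ]; apply le_of_eq; field_simp) hloc
  -- The good points are those where the mollifications converge to `v` itself; the mollified
  -- estimate passes to the limit between any two of them.
  set A : Set ℝ := Ioo a b ∩ {x | Tendsto (fun n => ∫ s in Ioo a b,
    v s * (ρ n).normed volume (x - s)) atTop (𝓝 (v x))} with hA
  have key : ∀ x ∈ A, ∀ y ∈ A, x ≤ y → |v x - v y| ≤ L * (y - x) := by
    intro x hx y hy hxy
    have hlim : Tendsto (fun n => L * (y - x + 2 * (ρ n).rOut)) atTop (𝓝 (L * (y - x))) := by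
      have := ((hρ0.const_mul 2).const_add (y - x)).const_mul L
      simpa using this
    refine le_of_tendsto_of_tendsto ((hx.2.sub hy.2).abs) hlim ?_
    have hsmall := hρ0.eventually_lt_const (u := min (x - a) (b - y))
      (lt_min (by linarith [hx.1.1]) (by linarith [hy.1.2]))
    filter_upwards [hsmall] with n hn
    have h1 := hn.trans_le (min_le_left _ _)
    have h2 := hn.trans_le (min_le_right _ _)
    exact h.abs_sub_integral_bump_le hvi hL ENNReal.toReal_nonneg (ρ n) hxy (by linarith)
      (by linarith)
  refine ⟨L, ENNReal.toReal_nonneg, A, ?_, fun x hx y hy => ?_⟩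
  · filter_upwards [ae_restrict_mem measurableSet_Ioo, ae_restrict_of_ae hconv] with x hx hc
    refine ⟨hx, ?_⟩
    rw [indicator_of_mem hx] at hc
    refine hc.congr fun n => ?_
    rw [convolution_eq_swap, ← integral_indicator measurableSet_Ioo]
    refine integral_congr_ae (ae_of_all _ fun s => ?_)
    by_cases hs : s ∈ Ioo a b
    · simp [hs, mul_comm]
    · simp [hs]
  · rcases le_total x y with hxy | hxy
    · rw [abs_sub_comm x y, abs_of_nonneg (a := y - x) (by linarith)]
      exact key x hx y hy hxy
    · rw [abs_sub_comm, abs_of_nonneg (a := x - y) (by linarith)]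
      exact key y hy x hx hxy

/-- Every neighbourhood of `a` meets `S` in a non-empty open set, hence in positive measure. Limits
in the sense of `HasTrace` are therefore not vacuous, and points with almost sure properties can be
picked arbitrarily near `a`. -/
theorem neBot_nhdsWithin_inf_ae {S : Set ℝ} (hS : IsOpen S) {a : ℝ} (ha : a ∈ closure S) :
    (𝓝[S] a ⊓ ae (volume : Measure ℝ)).NeBot := by
  rw [inf_neBot_iff]
  intro s hs t ht
  obtain ⟨U, hU, haU, hUs⟩ := mem_nhdsWithin.1 hs
  have hne : (U ∩ S).Nonempty := mem_closure_iff.1 ha U hU haU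
  have hpos := (hU.inter hS).measure_pos volume hne
  rw [← measure_inter_conull ht] at hpos
  obtain ⟨x, hx, hxt⟩ := nonempty_of_measure_ne_zero hpos.ne'
  exact ⟨x, hUs hx, hxt⟩

theorem exists_layer_eq (i : Fin 2) : ∃ a : ℝ, layer i = Ioo a (a + 1) ∧ -1 ≤ a ∧ a ≤ 0 := by
  fin_cases i
  · exact ⟨-1, by simp [layer], by norm_num, by norm_num⟩
  · exact ⟨0, by simp [layer], by norm_num, by norm_num⟩

theorem isOpen_layer (i : Fin 2) : IsOpen (layer i) := by
  obtain ⟨a, h, -⟩ := exists_layer_eq i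
  rw [h]; exact isOpen_Ioo

theorem measurableSet_layer (i : Fin 2) : MeasurableSet (layer i) := (isOpen_layer i).measurableSet

theorem layer_subset (i : Fin 2) : layer i ⊆ Ioo (-1) 1 := by
  obtain ⟨a, h, h1, h2⟩ := exists_layer_eq i
  rw [h]; exact Ioo_subset_Ioo h1 (by linarith)

namespace Problem

variable (P : Problem)

/-- Since `φ_i` is controlled only on `[0,1]`, it is replaced by its continuous extension, constant
on each side. -/
theorem aestronglyMeasurable_phi_comp {α : Type*} [MeasurableSpace α] {μ : Measure α} {u : α → ℝ}
    (i : Fin 2) (hu : AEStronglyMeasurable u μ) (hm : ∀ᵐ x ∂μ, u x ∈ Icc (0 : ℝ) 1) :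
    AEStronglyMeasurable (fun x => P.phi i (u x)) μ := by
  have hc : Continuous (fun s => IccExtend (zero_le_one' ℝ) ((Icc 0 1).domRestrict (P.phi i)) s) :=
    (continuousOn_iff_continuous_domRestrict.1 (P.phi_continuousOn i)).Icc_extend'
  refine (hc.comp_aestronglyMeasurable hu).congr ?_
  filter_upwards [hm] with x hx
  rw [IccExtend_of_mem _ _ hx]
  rfl

/-- Bounds for `φ_i` of a mean value. -/
theorem abs_phi_mean_sub_le {u : ℝ → ℝ} {i : Fin 2} {p q L : ℝ} (hpq : p < q) {A : Set ℝ}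
    (hu : AEStronglyMeasurable u (volume.restrict (Ioo p q)))
    (hA : ∀ᵐ x ∂volume.restrict (Ioo p q), x ∈ A) (hL0 : 0 ≤ L)
    (hA01 : ∀ x ∈ A, u x ∈ Icc (0 : ℝ) 1)
    (hL : ∀ x ∈ A, ∀ y ∈ A, |P.phi i (u x) - P.phi i (u y)| ≤ L * |x - y|) {x : ℝ} (hx : x ∈ A)
    (hxI : x ∈ Ioo p q) (hm : 1 / (q - p) * ∫ s in p..q, u s ∈ Icc (0 : ℝ) 1) :
    |P.phi i (1 / (q - p) * ∫ s in p..q, u s) - P.phi i (u x)| ≤ L * (q - p) := by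
  have hint : Integrable u (volume.restrict (Ioo p q)) := by
    refine IntegrableOn.of_bound (C := 1) (by simp) hu ?_
    filter_upwards [hA] with x hx
    rw [Real.norm_eq_abs, abs_of_nonneg (hA01 x hx).1]
    exact (hA01 x hx).2
  have hμ : volume.restrict (Ioo p q) ≠ 0 := by
    rw [Ne, Measure.restrict_eq_zero, Real.volume_Ioo]
    simpa using hpq
  have hnull : volume.restrict (Ioo p q) ((A ∩ Ioo p q)ᶜ) = 0 := by
    have : ∀ᵐ x ∂volume.restrict (Ioo p q), x ∈ A ∩ Ioo p q := by
      filter_upwards [hA, ae_restrict_mem measurableSet_Ioo] with x h1 h2 using ⟨h1, h2⟩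
    exact this
  have havg : ⨍ s in Ioo p q, u s = 1 / (q - p) * ∫ s in p..q, u s := by
    rw [setAverage_eq, Real.volume_real_Ioo_of_le hpq.le, intervalIntegral.integral_of_le hpq.le,
      integral_Ioc_eq_integral_Ioo, smul_eq_mul, one_div]
  have hmono := (P.phi_strictMonoOn i).monotoneOn
  have hd : ∀ y ∈ A ∩ Ioo p q, |P.phi i (u y) - P.phi i (u x)| ≤ L * (q - p) := by
    intro y hy
    refine (hL y hy.1 x hx).trans (mul_le_mul_of_nonneg_left ?_ hL0)
    rw [abs_le]
    constructor <;> linarith [hy.2.1, hy.2.2, hxI.1, hxI.2]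
  rw [← havg] at hm ⊢
  -- The mean of `u` is not attained in general, but it lies between two values of `u` at good
  -- points, and `φ_i` is monotone.
  obtain ⟨y, hy, hy'⟩ := exists_notMem_null_le_average hμ hint hnull
  obtain ⟨z, hz, hz'⟩ := exists_notMem_null_average_le hμ hint hnull
  rw [notMem_compl_iff] at hy hz
  have h1 := hmono (hA01 y hy.1) hm hy'
  have h2 := hmono hm (hA01 z hz.1) hz'
  have h3 := abs_le.1 (hd y hy)
  have h4 := abs_le.1 (hd z hz)
  rw [abs_le]
  constructor <;> linarith [h3.1, h4.2]

variable {P}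

theorem IsRegularInitial.aestronglyMeasurable_layer {u₀ : ℝ → ℝ} (h : P.IsRegularInitial u₀)
    (i : Fin 2) : AEStronglyMeasurable u₀ (volume.restrict (layer i)) :=
  h.meas.mono_measure (Measure.restrict_mono (layer_subset i) le_rfl)

theorem IsRegularInitial.mem_layer {u₀ : ℝ → ℝ} (h : P.IsRegularInitial u₀) (i : Fin 2) :
    ∀ᵐ x ∂volume.restrict (layer i), u₀ x ∈ Icc (0 : ℝ) 1 :=
  ae_restrict_of_ae_restrict_of_subset (layer_subset i) h.mem

theorem IsRegularInitial.exists_lipschitz {u₀ : ℝ → ℝ} (h : P.IsRegularInitial u₀) :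
    ∃ L : ℝ, 0 ≤ L ∧ ∀ i, ∃ A : Set ℝ, (∀ᵐ x ∂volume.restrict (layer i), x ∈ A) ∧
      (∀ x ∈ A, u₀ x ∈ Icc (0 : ℝ) 1) ∧
      ∀ x ∈ A, ∀ y ∈ A, |P.phi i (u₀ x) - P.phi i (u₀ y)| ≤ L * |x - y| := by
  have key : ∀ i, ∃ L : ℝ, 0 ≤ L ∧ ∃ A : Set ℝ, (∀ᵐ x ∂volume.restrict (layer i), x ∈ A) ∧
      (∀ x ∈ A, u₀ x ∈ Icc (0 : ℝ) 1) ∧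
      ∀ x ∈ A, ∀ y ∈ A, |P.phi i (u₀ x) - P.phi i (u₀ y)| ≤ L * |x - y| := by
    intro i
    obtain ⟨w, hw, hwL⟩ := h.bounded_deriv i
    have hmeas := h.aestronglyMeasurable_layer i
    have hmem := h.mem_layer i
    obtain ⟨a, ha, -⟩ := exists_layer_eq i
    rw [ha] at hw hwL hmeas hmem ⊢
    obtain ⟨B, hB⟩ := isCompact_Icc.exists_bound_of_continuousOn (P.phi_continuousOn i)
    have hint : IntegrableOn (fun x => P.phi i (u₀ x)) (Ioo a (a + 1)) := by
      refine IntegrableOn.of_bound (C := B) (by simp)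
        (P.aestronglyMeasurable_phi_comp i hmeas hmem) ?_
      filter_upwards [hmem] with x hx using hB _ hx
    obtain ⟨L, hL0, A, hA, hAL⟩ := hw.exists_lipschitz hint hwL
    refine ⟨L, hL0, A ∩ {x | u₀ x ∈ Icc (0 : ℝ) 1}, ?_, fun x hx => hx.2,
      fun x hx y hy => hAL x hx.1 y hy.1⟩
    filter_upwards [hA, hmem] with x h1 h2 using ⟨h1, h2⟩
  choose L hL0 A hA hA01 hAL using key
  refine ⟨L 0 + L 1, add_nonneg (hL0 0) (hL0 1), fun i => ⟨A i, hA i, hA01 i, fun x hx y hy => ?_⟩⟩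
  refine (hAL i x hx y hy).trans (mul_le_mul_of_nonneg_right ?_ (abs_nonneg _))
  have h0 := hL0 0
  have h1 := hL0 1
  fin_cases i <;> simp only [Fin.zero_eta, Fin.mk_one] <;> linarith

end Problem

theorem Rock.Connected.mem {R : Rock} {a b : ℝ} (h : R.Connected a b) :
    a ∈ Icc (0 : ℝ) 1 ∧ b ∈ Icc (0 : ℝ) 1 := by
  have key : ∀ i s p, p ∈ R.capGraph i s → s ∈ Icc (0 : ℝ) 1 := by
    rintro i s p (⟨rfl, -⟩ | ⟨h0, h1, -⟩ | ⟨rfl, -⟩)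
    · exact ⟨le_rfl, zero_le_one⟩
    · exact ⟨h0.le, h1.le⟩
    · exact ⟨zero_le_one, le_rfl⟩
  obtain ⟨p, hp, hp'⟩ := h
  exact ⟨key _ _ _ hp, key _ _ _ hp'⟩

namespace Problem

theorem cell_subset_layer {N : ℕ} (hN : 0 < N) {j : ℤ} (hj : j ∈ Ico (-N : ℤ) N) :
    Ioo ((j : ℝ) / N) ((j + 1) / N) ⊆ layer (cellLayer j) := by
  have hN' : (0 : ℝ) < N := by exact_mod_cast hN
  have h1 : (-N : ℝ) ≤ j := by exact_mod_cast hj.1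
  have h2 : (j : ℝ) + 1 ≤ N := by exact_mod_cast hj.2
  unfold cellLayer layer
  split_ifs with h3 h4 h4
  · refine Ioo_subset_Ioo ?_ ?_
    · rw [le_div_iff₀ hN']; linarith
    · have : (j : ℝ) + 1 ≤ 0 := by exact_mod_cast h3
      exact div_nonpos_of_nonpos_of_nonneg this hN'.le
  · simp at h4
  · simp at h4
  · refine Ioo_subset_Ioo ?_ ?_
    · have : (0 : ℝ) ≤ j := by exact_mod_cast not_lt.1 h3
      positivity
    · rw [div_le_one hN']; exact h2

variable {P : Problem}

/-- The Lipschitz bound between `x` and a good point `y` survives the passage `y → z`. -/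
theorem phi_trace_le {u₀ : ℝ → ℝ} {i : Fin 2} {A : Set ℝ} {L a : ℝ}
    (hA : ∀ᵐ x ∂volume.restrict (layer i), x ∈ A) (hA01 : ∀ x ∈ A, u₀ x ∈ Icc (0 : ℝ) 1)
    (hAL : ∀ x ∈ A, ∀ y ∈ A, |P.phi i (u₀ x) - P.phi i (u₀ y)| ≤ L * |x - y|)
    (ha : a ∈ Icc (0 : ℝ) 1) {z : ℝ} (hz : z ∈ closure (layer i)) (h : HasTrace (layer i) z u₀ a)
    {x : ℝ} (hx : x ∈ A) : |P.phi i (u₀ x) - P.phi i a| ≤ L * |x - z| := by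
  have := neBot_nhdsWithin_inf_ae (isOpen_layer i) hz
  have hev : ∀ᶠ y in 𝓝[layer i] z ⊓ ae volume, y ∈ A := by
    have h1 : ∀ᶠ y in 𝓝[layer i] z ⊓ ae volume, y ∈ layer i :=
      mem_inf_of_left self_mem_nhdsWithin
    have h2 : ∀ᶠ y in 𝓝[layer i] z ⊓ ae volume, y ∈ layer i → y ∈ A :=
      mem_inf_of_right ((ae_restrict_iff' (measurableSet_layer i)).1 hA)
    filter_upwards [h1, h2] with y h1 h2 using h2 h1
  have h1 : Tendsto (fun y => P.phi i (u₀ y)) (𝓝[layer i] z ⊓ ae volume) (𝓝 (P.phi i a)) :=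
    (P.phi_continuousOn i a ha).tendsto.comp
      (tendsto_nhdsWithin_iff.2 ⟨h, hev.mono fun y hy => hA01 y hy⟩)
  have h2 : Tendsto (fun y => L * |x - y|) (𝓝[layer i] z ⊓ ae volume) (𝓝 (L * |x - z|)) := by
    have : Tendsto (fun y : ℝ => L * |x - y|) (𝓝 z) (𝓝 (L * |x - z|)) := by
      apply Continuous.tendsto; fun_prop
    exact this.mono_left (inf_le_left.trans nhdsWithin_le_nhds)
  refine le_of_tendsto_of_tendsto (tendsto_const_nhds.sub h1).abs h2 ?_
  filter_upwards [hev] with y hy using hAL x hx y hy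

/-- The discrete initial values are close to the initial datum and have bounded fluxes. -/
theorem IsRegularInitial.exists_bound {u₀ : ℝ → ℝ} (h : P.IsRegularInitial u₀) :
    ∃ C : ℝ, 0 < C ∧ (∀ i, ∀ a ∈ Icc (0 : ℝ) 1, ∀ b ∈ Icc (0 : ℝ) 1, |P.G i a b| ≤ C) ∧
      ∀ (N : ℕ), 0 < N → ∀ U : ℤ → ℝ,
        (∀ j ∈ Ico (-N : ℤ) N, U j = 1 / (1 / N) * ∫ x in ((j : ℝ) / N)..((j + 1) / N), u₀ x) →
        (∀ j ∈ Ico (-N : ℤ) N, U j ∈ Icc (0 : ℝ) 1) →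
        P.FluxBounded N C U ∧ ∀ j ∈ Ico (-N : ℤ) N,
          ∀ᵐ x ∂volume.restrict (Ioo ((j : ℝ) / N) ((j + 1) / N)),
            |P.phi (cellLayer j) (U j) - P.phi (cellLayer j) (u₀ x)| ≤ C / N := by
  obtain ⟨L, hL0, hL⟩ := h.exists_lipschitz
  choose A hA hA01 hAL using hL
  obtain ⟨B, hB0, hB⟩ := P.exists_G_bound
  obtain ⟨a, b, ha, hb, hab⟩ := h.connected
  obtain ⟨ha01, hb01⟩ := hab.mem
  -- `B` bounds the convective part. Neighbouring averages have values of `φ_i` within `L/N + 2L/N +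
  -- L/N`, which the factor `N` turns into `4L`. At the interface the difference is only `2L/N`, but
  -- the half cell gives the factor `2N`.
  refine ⟨B + 4 * L, by positivity, fun i a ha b hb => (hB i a ha b hb).trans (by linarith),
    fun N hN U hU hU01 => ?_⟩
  have hN' : (0 : ℝ) < N := by exact_mod_cast hN
  have hlen : ∀ j : ℤ, ((j : ℝ) + 1) / N - j / N = 1 / N := fun j => by field_simp; ring
  have hlt : ∀ j : ℤ, (j : ℝ) / N < (j + 1) / N := fun j => by
    have : (0 : ℝ) < 1 / N := by positivity
    linarith [hlen j]
  have hcA : ∀ j ∈ Ico (-N : ℤ) N,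
      ∀ᵐ x ∂volume.restrict (Ioo ((j : ℝ) / N) ((j + 1) / N)), x ∈ A (cellLayer j) :=
    fun j hj => ae_restrict_of_ae_restrict_of_subset (cell_subset_layer hN hj) (hA _)
  have hclose : ∀ j ∈ Ico (-N : ℤ) N, ∀ x ∈ A (cellLayer j),
      x ∈ Ioo ((j : ℝ) / N) ((j + 1) / N) →
      |P.phi (cellLayer j) (U j) - P.phi (cellLayer j) (u₀ x)| ≤ L / N := by
    intro j hj x hx hxI
    have hUj := hU j hj
    have hU01j := hU01 j hj
    rw [← hlen j] at hUj
    rw [hUj] at hU01j ⊢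
    refine (P.abs_phi_mean_sub_le (hlt j) ((h.aestronglyMeasurable_layer _).mono_measure
      (Measure.restrict_mono (cell_subset_layer hN hj) le_rfl)) (hcA j hj) hL0 (hA01 _) (hAL _)
      hx hxI hU01j).trans ?_
    rw [hlen j, mul_one_div]
  have hex : ∀ j ∈ Ico (-N : ℤ) N, ∃ x ∈ A (cellLayer j), x ∈ Ioo ((j : ℝ) / N) ((j + 1) / N) := by
    intro j hj
    have hne : volume.restrict (Ioo ((j : ℝ) / N) ((j + 1) / N)) ≠ 0 := by
      rw [Ne, Measure.restrict_eq_zero, Real.volume_Ioo]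
      simpa using hlt j
    have := ae_neBot.2 hne
    obtain ⟨x, h1, h2⟩ := ((hcA j hj).and (ae_restrict_mem measurableSet_Ioo)).exists
    exact ⟨x, h1, h2⟩
  have h2N : 2 * (N : ℝ) * (2 * L / N) = 4 * L := by field_simp; ring
  -- The traces of the initial datum serve as interface values of the initial level.
  refine ⟨⟨fun j h1 h2 h0 => ?_, a, ha01, b, hb01, hab, ?_, ?_⟩, fun j hj => ?_⟩
  · have hj : j ∈ Ico (-N : ℤ) N := ⟨h1.le, h2⟩
    have hj' : j - 1 ∈ Ico (-N : ℤ) N := ⟨by omega, by omega⟩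
    have hl : cellLayer (j - 1) = cellLayer j := by
      unfold cellLayer; split_ifs <;> first | rfl | omega
    obtain ⟨x, hx, hxI⟩ := hex j hj
    obtain ⟨y, hy, hyI⟩ := hex (j - 1) hj'
    have e1 := hclose j hj x hx hxI
    have e2 := hclose (j - 1) hj' y hy hyI
    rw [hl] at hy e2
    have e3 := hAL _ x hx y hy
    have e4 : |x - y| ≤ 2 / N := by
      have := hlen j
      push_cast at hyI
      rw [sub_add_cancel] at hyI
      have e5 : ((j : ℝ) - 1) / N = j / N - 1 / N := by ring
      have e6 : (2 : ℝ) / N = 1 / N + 1 / N := by ring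
      rw [e5] at hyI
      rw [abs_le]
      constructor <;> linarith [hyI.1, hyI.2, hxI.1, hxI.2]
    have e7 : |P.phi (cellLayer j) (U j) - P.phi (cellLayer j) (U (j - 1))| ≤ 4 * L / N := by
      have e8 : L * |x - y| ≤ L * (2 / N) := mul_le_mul_of_nonneg_left e4 hL0
      have e9 : 4 * L / (N : ℝ) = L / N + L * (2 / N) + L / N := by ring
      rw [e9]
      rw [abs_le] at e1 e2 e3 ⊢
      constructor <;> linarith [e1.1, e2.1, e3.1, e1.2, e2.2, e3.2]
    rw [cellFlux_eq]
    refine (abs_sub _ _).trans (add_le_add (hB _ _ (hU01 _ hj') _ (hU01 _ hj)) ?_)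
    rw [abs_mul, abs_of_pos hN']
    refine (mul_le_mul_of_nonneg_left e7 hN'.le).trans (le_of_eq ?_)
    field_simp
  · have hj : (-1 : ℤ) ∈ Ico (-N : ℤ) N := ⟨by omega, by omega⟩
    obtain ⟨x, hx, hxI⟩ := hex (-1) hj
    have e1 := hclose (-1) hj x hx hxI
    have hl : cellLayer (-1) = 0 := rfl
    rw [hl] at hx e1
    have hcl : (0 : ℝ) ∈ closure (layer 0) := by
      rw [show layer 0 = Ioo (-1) 0 from rfl, closure_Ioo (by norm_num)]
      exact ⟨by norm_num, le_rfl⟩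
    have e2 := phi_trace_le (hA 0) (hA01 0) (hAL 0) ha01 hcl ha hx
    have e3 : |x - 0| ≤ 1 / N := by
      push_cast at hxI
      rw [sub_zero, abs_le]
      have e5 : (-1 : ℝ) / N = - (1 / N) := by ring
      have e6 : ((-1 : ℝ) + 1) / N = 0 := by simp
      rw [e5, e6] at hxI
      exact ⟨hxI.1.le, hxI.2.le.trans (by positivity)⟩
    have e7 : |P.phi 0 a - P.phi 0 (U (-1))| ≤ 2 * L / N := by
      have e8 : L * |x - 0| ≤ L * (1 / N) := mul_le_mul_of_nonneg_left e3 hL0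
      have e9 : 2 * L / (N : ℝ) = L / N + L * (1 / N) := by ring
      rw [e9]
      rw [abs_le] at e1 e2 ⊢
      constructor <;> linarith [e1.1, e2.1, e1.2, e2.2]
    rw [interfaceFluxL_eq]
    refine (abs_sub _ _).trans (add_le_add (hB _ _ (hU01 _ hj) _ ha01) ?_)
    rw [abs_mul, abs_of_pos (by positivity : (0 : ℝ) < 2 * N), ← h2N]
    exact mul_le_mul_of_nonneg_left e7 (by positivity)
  · have hj : (0 : ℤ) ∈ Ico (-N : ℤ) N := ⟨by omega, by omega⟩
    obtain ⟨x, hx, hxI⟩ := hex 0 hj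
    have e1 := hclose 0 hj x hx hxI
    have hl : cellLayer 0 = 1 := rfl
    rw [hl] at hx e1
    have hcl : (0 : ℝ) ∈ closure (layer 1) := by
      rw [show layer 1 = Ioo 0 1 from rfl, closure_Ioo (by norm_num)]
      exact ⟨le_rfl, by norm_num⟩
    have e2 := phi_trace_le (hA 1) (hA01 1) (hAL 1) hb01 hcl hb hx
    have e3 : |x - 0| ≤ 1 / N := by
      push_cast at hxI
      rw [sub_zero, abs_le]
      rw [zero_div, zero_add] at hxI
      exact ⟨(by linarith [hxI.1, show (0 : ℝ) ≤ 1 / N by positivity]), hxI.2.le⟩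
    have e7 : |P.phi 1 (U 0) - P.phi 1 b| ≤ 2 * L / N := by
      have e8 : L * |x - 0| ≤ L * (1 / N) := mul_le_mul_of_nonneg_left e3 hL0
      have e9 : 2 * L / (N : ℝ) = L / N + L * (1 / N) := by ring
      rw [e9]
      rw [abs_le] at e1 e2 ⊢
      constructor <;> linarith [e1.1, e2.1, e1.2, e2.2]
    rw [interfaceFluxR_eq]
    refine (abs_sub _ _).trans (add_le_add (hB _ _ hb01 _ (hU01 _ hj)) ?_)
    rw [abs_mul, abs_of_pos (by positivity : (0 : ℝ) < 2 * N), ← h2N]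
    exact mul_le_mul_of_nonneg_left e7 (by positivity)
  · filter_upwards [hcA j hj, ae_restrict_mem measurableSet_Ioo] with x hx hxI
    refine (hclose j hj x hx hxI).trans (div_le_div_of_nonneg_right (by linarith) hN'.le)

/-- A discrete solution is a sequence of steps of the scheme with uniformly bounded fluxes. -/
structure IsBoundedScheme (P : Problem) (u₀ : ℝ → ℝ) (C : ℝ) (N M : ℕ) (v : ℕ → ℤ → ℝ)
    (c d : ℕ → ℝ) : Prop where
  pos_N : 0 < N
  pos_M : 0 < M
  mem : ∀ n ≤ M, ∀ j ∈ Ico (-N : ℤ) N, v n j ∈ Icc (0 : ℝ) 1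
  initial : ∀ j ∈ Ico (-N : ℤ) N, ∀ᵐ x ∂volume.restrict (Ioo ((j : ℝ) / N) ((j + 1) / N)),
    |P.phi (cellLayer j) (v 0 j) - P.phi (cellLayer j) (u₀ x)| ≤ C / N
  step : ∀ n < M, P.IsStep N (P.T / M) (P.timeMean M P.uL n) (P.timeMean M P.uR n) (v n)
    (v (n + 1)) (c (n + 1)) (d (n + 1))
  flux_le : ∀ n < M, ∀ k ∈ Icc (-N : ℤ) N, |P.flux N (P.timeMean M P.uL n) (P.timeMean M P.uR n)
    (v (n + 1)) (c (n + 1)) k| ≤ C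

/-- Induction on the time level: the flux bound at one level is exactly what the maximum principle
needs for the next, so the constant never deteriorates and depends on neither `N` nor `M`. -/
theorem IsRegularInitial.exists_isBoundedScheme {u₀ : ℝ → ℝ} (h : P.IsRegularInitial u₀) :
    ∃ C : ℝ, 0 < C ∧ (∀ i, ∀ a ∈ Icc (0 : ℝ) 1, ∀ b ∈ Icc (0 : ℝ) 1, |P.G i a b| ≤ C) ∧
      ∀ N M : ℕ, 0 < N → 0 < M → ∀ v, P.IsDiscreteSolution u₀ N M v →
        ∃ c d, IsBoundedScheme P u₀ C N M v c d := by
  obtain ⟨C, hC0, hC, hinit⟩ := h.exists_bound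
  refine ⟨C, hC0, hC, fun N M hN hM v hv => ?_⟩
  obtain ⟨hv0, hv01, c, d, hcd⟩ := hv
  obtain ⟨hb0, hclose⟩ := hinit N hN (v 0) hv0 (hv01 0 (Nat.zero_le _))
  have hM' : (0 : ℝ) < M := by exact_mod_cast hM
  have hδ : 0 < P.T / M := div_pos P.T_pos hM'
  have hstep : ∀ n < M, P.IsStep N (P.T / M) (P.timeMean M P.uL n) (P.timeMean M P.uR n) (v n)
      (v (n + 1)) (c (n + 1)) (d (n + 1)) := fun n hn => by
    obtain ⟨h1, h2, h3, h4, h5⟩ := hcd n hn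
    exact ⟨h1, h2, h3, h4, h5⟩
  have hflux : ∀ n < M, P.FluxBounded N C (v n) → ∀ k ∈ Icc (-N : ℤ) N,
      |P.flux N (P.timeMean M P.uL n) (P.timeMean M P.uR n) (v (n + 1)) (c (n + 1)) k| ≤ C :=
    fun n hn hb k hk => (hstep n hn).abs_flux_le hN hδ (P.timeMean_mem P.uL_meas P.uL_mem hn)
      (P.timeMean_mem P.uR_meas P.uR_mem hn) (hv01 n hn.le) (hv01 (n + 1) hn) hC hb hk
  have hbd : ∀ n, n ≤ M → P.FluxBounded N C (v n) := by
    intro n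
    induction n with
    | zero => exact fun _ => hb0
    | succ n ih =>
      intro hn
      exact (hstep n hn).fluxBounded hN (hflux n hn (ih (by omega)))
  exact ⟨c, d, hN, hM, hv01, hclose, hstep, fun n hn => hflux n hn (hbd n hn.le)⟩

end Problem

/-! ### Solvability of the implicit scheme. -/

/-- The generalized inverse of a continuous strictly increasing function on `[0,1]`. -/
theorem exists_graph_inverse {f : ℝ → ℝ} (hf : ContinuousOn f (Icc 0 1))
    (hm : StrictMonoOn f (Icc 0 1)) :
    ∃ r : ℝ → ℝ, Continuous r ∧ (∀ p, r p ∈ Icc (0 : ℝ) 1) ∧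
      (∀ p, (r p = 0 ∧ p ≤ f 0) ∨ (0 < r p ∧ r p < 1 ∧ p = f (r p)) ∨ (r p = 1 ∧ f 1 ≤ p)) ∧
      (∀ p ≤ f 0, r p = 0) ∧ ∀ p, f 1 ≤ p → r p = 1 := by
  set κ : ℝ → ℝ := fun s => (projIcc (0 : ℝ) 1 zero_le_one s : ℝ) with hκ
  have hκc : Continuous κ := continuous_subtype_val.comp continuous_projIcc
  have hκm : ∀ s, κ s ∈ Icc (0 : ℝ) 1 := fun s => (projIcc (0 : ℝ) 1 zero_le_one s).2
  have hκle : ∀ s ≤ 0, κ s = 0 := fun s hs => by simp [hκ, projIcc_of_le_left _ hs]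
  have hκge : ∀ s, 1 ≤ s → κ s = 1 := fun s hs => by simp [hκ, projIcc_of_right_le _ hs]
  have hκid : ∀ s ∈ Icc (0 : ℝ) 1, κ s = s := fun s hs => by simp [hκ, projIcc_of_mem _ hs]
  have hκmono : Monotone κ := fun s t hst => monotone_projIcc _ hst
  have hκlip : ∀ s t, s ≤ t → κ t - κ s ≤ t - s := by
    intro s t hst
    have := abs_projIcc_sub_projIcc (h := zero_le_one' ℝ) (c := t) (d := s)
    rw [abs_of_nonneg (sub_nonneg.2 hst)] at this
    exact (le_abs_self _).trans this
  -- Extending `f` with slope one on both sides gives an increasing homeomorphism of `ℝ`. Its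
  -- inverse, clipped to `[0,1]`, is the inverse of the graph.
  set g : ℝ → ℝ := fun s => f (κ s) + (s - κ s) with hg
  have hgc : Continuous g :=
    (hf.comp_continuous hκc hκm).add (continuous_id.sub hκc)
  have hgm : StrictMono g := by
    intro s t hst
    have h1 := hκlip s t hst.le
    rcases (hκmono hst.le).eq_or_lt with h | h
    · simp only [hg, h]; linarith
    · have := hm (hκm s) (hκm t) h
      simp only [hg]; linarith
  have hgs : Function.Surjective g := by
    refine hgc.surjective ?_ ?_
    · refine tendsto_atTop_mono' _ (f₁ := fun s => s + (f 1 - 1)) ?_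
        (tendsto_atTop_add_const_right _ _ tendsto_id)
      filter_upwards [eventually_ge_atTop (1 : ℝ)] with s hs
      simp only [hg, hκge s hs]; linarith
    · refine tendsto_atBot_mono' _ (f₁ := fun s => s + f 0) ?_
        (tendsto_atBot_add_const_right _ _ tendsto_id)
      filter_upwards [eventually_le_atBot (0 : ℝ)] with s hs
      simp only [hg, hκle s hs]; linarith
  set e := hgm.orderIsoOfSurjective g hgs with he
  have hge : ∀ p, g (e.symm p) = p := fun p => e.apply_symm_apply p
  refine ⟨fun p => κ (e.symm p), hκc.comp e.symm.continuous, fun p => hκm _, fun p => ?_,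
    fun p hp => ?_, fun p hp => ?_⟩
  · beta_reduce
    have h := hge p
    simp only [hg] at h
    rcases le_or_gt (e.symm p) 0 with h0 | h0
    · left
      rw [hκle _ h0] at h ⊢
      exact ⟨rfl, by linarith⟩
    rcases le_or_gt 1 (e.symm p) with h1 | h1
    · right; right
      rw [hκge _ h1] at h ⊢
      exact ⟨rfl, by linarith⟩
    · right; left
      rw [hκid _ ⟨h0.le, h1.le⟩] at h ⊢
      exact ⟨h0, h1, by linarith⟩
  · apply hκle
    rw [← hgm.le_iff_le, hge]
    simpa [hg, hκle 0 le_rfl] using hp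
  · apply hκge
    rw [← hgm.le_iff_le, hge]
    simpa [hg, hκge 1 le_rfl] using hp

/-- Monotone and Lipschitz numerical fluxes on `[0,1]²`. -/
structure IsMonotoneFlux (K : ℝ) (Φ : ℝ → ℝ → ℝ) : Prop where
  mono : ∀ a ∈ Icc (0 : ℝ) 1, ∀ b ∈ Icc (0 : ℝ) 1, ∀ a' ∈ Icc (0 : ℝ) 1, ∀ b' ∈ Icc (0 : ℝ) 1,
    a ≤ a' → b' ≤ b → Φ a b ≤ Φ a' b'
  lip_left : ∀ a ∈ Icc (0 : ℝ) 1, ∀ a' ∈ Icc (0 : ℝ) 1, ∀ b ∈ Icc (0 : ℝ) 1, a ≤ a' →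
    Φ a' b ≤ Φ a b + K * (a' - a)
  lip_right : ∀ a ∈ Icc (0 : ℝ) 1, ∀ b ∈ Icc (0 : ℝ) 1, ∀ b' ∈ Icc (0 : ℝ) 1, b ≤ b' →
    Φ a b ≤ Φ a b' + K * (b' - b)

/-- Solvability of one step of an implicit monotone scheme. -/
theorem exists_implicit_step {N : ℕ} {K lam q : ℝ} (hK : 0 ≤ K) (hlam : 0 < lam) {p : ℤ → ℝ}
    (hp : ∀ j, p j ∈ Ioo (0 : ℝ) 1) {Φ : ℤ → ℝ → ℝ → ℝ}
    (hΦ : ∀ j ∈ Icc (-N : ℤ) N, IsMonotoneFlux K (Φ j))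
    (h0l : ∀ j ∈ Ico (-N : ℤ) N, 0 ≤ Φ j 0 0) (h0r : ∀ j ∈ Ioc (-N : ℤ) N, Φ j 0 0 ≤ 0)
    (h1l : ∀ j ∈ Ico (-N : ℤ) N, Φ j 1 1 ≤ q) (h1r : ∀ j ∈ Ioc (-N : ℤ) N, q ≤ Φ j 1 1)
    {W : ℤ → ℝ} (hW : ∀ j ∈ Ico (-N : ℤ) N, W j ∈ Icc (0 : ℝ) 1) :
    ∃ U : ℤ → ℝ, (∀ j, U j ∈ Icc (0 : ℝ) 1) ∧ ∀ j ∈ Ico (-N : ℤ) N,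
      p j * (U j - W j) + lam * (Φ (j + 1) (U j) (U (j + 1)) - Φ j (U (j - 1)) (U j)) = 0 := by
  classical
  -- The residual of cell `j` grows in `U j` at rate at most `1 + 2 * lam * K`, since `p j < 1` and
  -- each of the two fluxes contributes `lam * K`. With this `τ` the map `U ↦ U - τ · residual` is
  -- order-preserving.
  set τ : ℝ := 1 / (1 + 2 * lam * K) with hτ
  have hτpos : 0 < τ := by positivity
  have hτeq : τ * (1 + 2 * lam * K) = 1 := by rw [hτ]; field_simp
  have m0 : (0 : ℝ) ∈ Icc (0 : ℝ) 1 := ⟨le_rfl, zero_le_one⟩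
  have m1 : (1 : ℝ) ∈ Icc (0 : ℝ) 1 := ⟨zero_le_one, le_rfl⟩
  set S : (ℤ → ℝ) → ℤ → ℝ := fun U j => if j ∈ Ico (-N : ℤ) N then
    U j - τ * (p j * (U j - W j) + lam * (Φ (j + 1) (U j) (U (j + 1)) - Φ j (U (j - 1)) (U j)))
    else 0 with hS
  have hmono : ∀ U V : ℤ → ℝ, (∀ j, U j ∈ Icc (0 : ℝ) 1) → (∀ j, V j ∈ Icc (0 : ℝ) 1) →
      (∀ j, U j ≤ V j) → ∀ j, S U j ≤ S V j := by
    intro U V hU hV hUV j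
    simp only [hS]
    split_ifs with hj
    swap
    · exact le_rfl
    have hj1 : j + 1 ∈ Icc (-N : ℤ) N := ⟨by have := hj.1; omega, by have := hj.2; omega⟩
    have hj0 : j ∈ Icc (-N : ℤ) N := ⟨hj.1, hj.2.le⟩
    have e1 : Φ (j + 1) (V j) (V (j + 1)) ≤ Φ (j + 1) (U j) (U (j + 1)) + K * (V j - U j) :=
      ((hΦ _ hj1).mono _ (hV _) _ (hV _) _ (hV _) _ (hU _) le_rfl (hUV _)).trans
        ((hΦ _ hj1).lip_left _ (hU _) _ (hV _) _ (hU _) (hUV _))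
    have e2 : Φ j (U (j - 1)) (U j) ≤ Φ j (V (j - 1)) (V j) + K * (V j - U j) :=
      ((hΦ _ hj0).lip_right _ (hU _) _ (hU _) _ (hV _) (hUV _)).trans
        (add_le_add_left ((hΦ _ hj0).mono _ (hU _) _ (hV _) _ (hV _) _ (hV _) (hUV _) le_rfl) _)
    have e3 : p j * (V j - U j) ≤ V j - U j := by
      nlinarith [hUV j, (hp j).2]
    have e4 : lam * (Φ (j + 1) (V j) (V (j + 1)) - Φ j (V (j - 1)) (V j)) ≤
        lam * (Φ (j + 1) (U j) (U (j + 1)) - Φ j (U (j - 1)) (U j)) +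
          2 * lam * K * (V j - U j) := by
      have := mul_le_mul_of_nonneg_left (show Φ (j + 1) (V j) (V (j + 1)) - Φ j (V (j - 1)) (V j) ≤
        Φ (j + 1) (U j) (U (j + 1)) - Φ j (U (j - 1)) (U j) + 2 * (K * (V j - U j)) by linarith)
        hlam.le
      linarith
    have e5 : τ * ((p j * (V j - W j) + lam * (Φ (j + 1) (V j) (V (j + 1)) - Φ j (V (j - 1)) (V j)))
        - (p j * (U j - W j) + lam * (Φ (j + 1) (U j) (U (j + 1)) - Φ j (U (j - 1)) (U j))))
        ≤ τ * ((1 + 2 * lam * K) * (V j - U j)) :=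
      mul_le_mul_of_nonneg_left (by linarith) hτpos.le
    rw [← mul_assoc, hτeq, one_mul] at e5
    linarith
  -- The constant states `0` and `1` are a subsolution and a supersolution, which keeps
  -- `[0,1]`-valued sequences invariant.
  have hS0 : ∀ j, 0 ≤ S (fun _ => 0) j := by
    intro j
    simp only [hS]
    split_ifs with hj
    swap
    · exact le_rfl
    have e1 := h0l j hj
    have e2 := h0r (j + 1) ⟨by have := hj.1; omega, by have := hj.2; omega⟩
    have e3 := mul_nonneg (hp j).1.le (hW j hj).1
    have e4 : 0 ≤ lam * (Φ j 0 0 - Φ (j + 1) 0 0) := mul_nonneg hlam.le (by linarith)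
    have e5 := mul_nonneg hτpos.le (add_nonneg e3 e4)
    linarith
  have hS1 : ∀ j, S (fun _ => 1) j ≤ 1 := by
    intro j
    simp only [hS]
    split_ifs with hj
    swap
    · exact zero_le_one
    have e1 := h1l j hj
    have e2 := h1r (j + 1) ⟨by have := hj.1; omega, by have := hj.2; omega⟩
    have e3 : 0 ≤ p j * (1 - W j) := mul_nonneg (hp j).1.le (by linarith [(hW j hj).2])
    have e4 : 0 ≤ lam * (Φ (j + 1) 1 1 - Φ j 1 1) := mul_nonneg hlam.le (by linarith)
    have e5 := mul_nonneg hτpos.le (add_nonneg e3 e4)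
    linarith
  have hSmem : ∀ U : ℤ → Icc (0 : ℝ) 1, ∀ j, S (fun k => U k) j ∈ Icc (0 : ℝ) 1 := fun U j =>
    ⟨(hS0 j).trans (hmono _ _ (fun _ => m0) (fun k => (U k).2) (fun k => (U k).2.1) j),
      (hmono _ _ (fun k => (U k).2) (fun _ => m1) (fun k => (U k).2.2) j).trans (hS1 j)⟩
  have : Fact ((0 : ℝ) ≤ 1) := ⟨zero_le_one⟩
  -- Sequences with values in `[0,1]` form a complete lattice, so the Knaster–Tarski theorem gives a
  -- fixed point from monotonicity alone.
  let Top : (ℤ → Icc (0 : ℝ) 1) →o (ℤ → Icc (0 : ℝ) 1) :=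
    { toFun := fun U j => ⟨S (fun k => U k) j, hSmem U j⟩
      monotone' := fun U V hUV j =>
        hmono _ _ (fun k => (U k).2) (fun k => (V k).2) (fun k => hUV k) j }
  have hfix := Top.map_lfp
  refine ⟨fun j => (OrderHom.lfp Top j : ℝ), fun j => (OrderHom.lfp Top j).2, fun j hj => ?_⟩
  have h := congrArg (fun U : ℤ → Icc (0 : ℝ) 1 => (U j : ℝ)) hfix
  have h' : S (fun k => (OrderHom.lfp Top k : ℝ)) j = OrderHom.lfp Top j := h
  simp only [hS, if_pos hj] at h'
  have h2 : τ * (p j * ((OrderHom.lfp Top j : ℝ) - W j) + lam *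
    (Φ (j + 1) (OrderHom.lfp Top j) (OrderHom.lfp Top (j + 1)) -
      Φ j (OrderHom.lfp Top (j - 1)) (OrderHom.lfp Top j))) = 0 := by linarith
  exact (mul_eq_zero.1 h2).resolve_left hτpos.ne'

namespace Problem

variable (P : Problem)

theorem G_zero (i : Fin 2) : P.G i 0 0 = 0 := by
  rw [P.G_diag i 0 ⟨le_rfl, zero_le_one⟩, P.f_zero]

theorem G_one (i : Fin 2) : P.G i 1 1 = P.q := by
  rw [P.G_diag i 1 ⟨zero_le_one, le_rfl⟩, P.f_one]

theorem connected_zero : P.Connected 0 0 :=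
  ⟨min (P.cap 0 0) (P.cap 1 0), Or.inl ⟨rfl, min_le_left _ _⟩, Or.inl ⟨rfl, min_le_right _ _⟩⟩

theorem connected_one : P.Connected 1 1 :=
  ⟨max (P.cap 0 1) (P.cap 1 1), Or.inr (Or.inr ⟨rfl, le_max_left _ _⟩),
    Or.inr (Or.inr ⟨rfl, le_max_right _ _⟩)⟩

/-- Solvability of the interface conditions. -/
theorem exists_interface {N : ℕ} {a b : ℝ} (ha : a ∈ Icc (0 : ℝ) 1) (hb : b ∈ Icc (0 : ℝ) 1) :
    ∃ c ∈ Icc (0 : ℝ) 1, ∃ d ∈ Icc (0 : ℝ) 1, P.Connected c d ∧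
      P.interfaceFluxL N a c = P.interfaceFluxR N d b := by
  have m0 : (0 : ℝ) ∈ Icc (0 : ℝ) 1 := ⟨le_rfl, zero_le_one⟩
  have m1 : (1 : ℝ) ∈ Icc (0 : ℝ) 1 := ⟨zero_le_one, le_rfl⟩
  -- The pairs `(r 0 p, r 1 p)` are connected through the common pressure `p`, so equality of the
  -- fluxes becomes one scalar equation in `p`, solved by the intermediate value theorem.
  choose r hrc hrm hrg hr0 hr1 using fun i =>
    exists_graph_inverse (P.cap_continuousOn i) (P.cap_strictMono i)
  have hcont : ∀ i, Continuous fun p => P.phi i (r i p) :=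
    fun i => (P.phi_continuousOn i).comp_continuous (hrc i) (hrm i)
  obtain ⟨K0, hK0⟩ := P.G_lipschitz 0
  obtain ⟨K1, hK1⟩ := P.G_lipschitz 1
  have hG0 : Continuous fun p => P.G 0 a (r 0 p) :=
    hK0.continuousOn.comp_continuous (f := fun p => (a, r 0 p)) (by have := hrc 0; fun_prop)
      fun p => ⟨ha, hrm 0 p⟩
  have hG1 : Continuous fun p => P.G 1 (r 1 p) b :=
    hK1.continuousOn.comp_continuous (f := fun p => (r 1 p, b)) (by have := hrc 1; fun_prop)
      fun p => ⟨hrm 1 p, hb⟩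
  set h : ℝ → ℝ := fun p => P.interfaceFluxL N a (r 0 p) - P.interfaceFluxR N (r 1 p) b with hh
  have hhc : Continuous h := by
    simp only [hh, interfaceFluxL_eq, interfaceFluxR_eq]
    have h0 := hcont 0
    have h1 := hcont 1
    fun_prop
  -- Below both entry pressures the interface values are `0`, and comparison with the constant state
  -- `0`, of zero flux, gives the sign.
  have hlo : 0 ≤ h (min (P.cap 0 0) (P.cap 1 0)) := by
    simp only [hh, hr0 0 _ (min_le_left _ _), hr0 1 _ (min_le_right _ _)]
    have e1 := P.interfaceFluxL_mono (N := N) m0 m0 ha m0 ha.1 le_rfl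
    have e2 := P.interfaceFluxR_mono (N := N) m0 hb m0 m0 le_rfl hb.1
    rw [interfaceFluxL_eq, G_zero] at e1
    rw [P.interfaceFluxR_eq N 0 0, G_zero] at e2
    linarith
  -- Above both maximal pressures the interface values are `1`, and the comparison state is `1`, of
  -- flux `q`.
  have hhi : h (max (P.cap 0 1) (P.cap 1 1)) ≤ 0 := by
    simp only [hh, hr1 0 _ (le_max_left _ _), hr1 1 _ (le_max_right _ _)]
    have e1 := P.interfaceFluxL_mono (N := N) ha m1 m1 m1 ha.2 le_rfl
    have e2 := P.interfaceFluxR_mono (N := N) m1 m1 m1 hb le_rfl hb.2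
    rw [P.interfaceFluxL_eq N 1 1, G_one] at e1
    rw [P.interfaceFluxR_eq N 1 1, G_one] at e2
    linarith
  obtain ⟨p, hp⟩ := mem_range_of_exists_le_of_exists_ge hhc ⟨_, hhi⟩ ⟨_, hlo⟩
  exact ⟨r 0 p, hrm 0 p, r 1 p, hrm 1 p, ⟨p, hrg 0 p, hrg 1 p⟩, sub_eq_zero.1 hp⟩

/-- One constant serves every face of the mesh. For the interface, `c` and `d` may be any selection
of solutions, with no continuity assumed: the order on connected pairs already forces monotonicity
and the one-sided Lipschitz bounds. -/
theorem exists_monotoneFlux_bound (N : ℕ) : ∃ K : ℝ, 0 ≤ K ∧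
    (∀ i, IsMonotoneFlux K (P.cellFlux N i)) ∧
    (∀ l ∈ Icc (0 : ℝ) 1, IsMonotoneFlux K fun _ b => P.G 0 l b) ∧
    (∀ r ∈ Icc (0 : ℝ) 1, IsMonotoneFlux K fun a _ => P.G 1 a r) ∧
    ∀ c d : ℝ → ℝ → ℝ, (∀ a ∈ Icc (0 : ℝ) 1, ∀ b ∈ Icc (0 : ℝ) 1, c a b ∈ Icc (0 : ℝ) 1 ∧
      d a b ∈ Icc (0 : ℝ) 1 ∧ P.Connected (c a b) (d a b) ∧
      P.interfaceFluxL N a (c a b) = P.interfaceFluxR N (d a b) b) →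
      IsMonotoneFlux K fun a b => P.interfaceFluxL N a (c a b) := by
  obtain ⟨K, hK0, hK⟩ := P.exists_G_lipschitz
  obtain ⟨L, hL0, hL⟩ := P.exists_phi_lipschitz
  have hGl : ∀ i, ∀ a ∈ Icc (0 : ℝ) 1, ∀ a' ∈ Icc (0 : ℝ) 1, ∀ b ∈ Icc (0 : ℝ) 1, a ≤ a' →
      P.G i a' b ≤ P.G i a b + K * (a' - a) := by
    intro i a ha a' ha' b hb haa
    have := hK i a' ha' b hb a ha b hb
    rw [sub_self, abs_zero, add_zero, abs_of_nonneg (sub_nonneg.2 haa)] at this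
    linarith [le_abs_self (P.G i a' b - P.G i a b)]
  have hGr : ∀ i, ∀ a ∈ Icc (0 : ℝ) 1, ∀ b ∈ Icc (0 : ℝ) 1, ∀ b' ∈ Icc (0 : ℝ) 1, b ≤ b' →
      P.G i a b ≤ P.G i a b' + K * (b' - b) := by
    intro i a ha b hb b' hb' hbb
    have := hK i a ha b hb a ha b' hb'
    rw [sub_self, abs_zero, zero_add, abs_sub_comm b, abs_of_nonneg (sub_nonneg.2 hbb)] at this
    linarith [le_abs_self (P.G i a b - P.G i a b')]
  have hφ : ∀ i, ∀ a ∈ Icc (0 : ℝ) 1, ∀ a' ∈ Icc (0 : ℝ) 1, a ≤ a' →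
      N * (P.phi i a' - P.phi i a) ≤ N * L * (a' - a) := by
    intro i a ha a' ha' haa
    have := hL i a' ha' a ha
    rw [abs_of_nonneg (sub_nonneg.2 haa)] at this
    rw [mul_assoc]
    exact mul_le_mul_of_nonneg_left ((le_abs_self _).trans this) (Nat.cast_nonneg N)
  have hφ' : ∀ i, ∀ a ∈ Icc (0 : ℝ) 1, ∀ a' ∈ Icc (0 : ℝ) 1, a ≤ a' →
      N * (P.phi i a' - P.phi i a) ≤ 2 * (N * L * (a' - a)) := by
    intro i a ha a' ha' haa
    have := hφ i a ha a' ha' haa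
    have h2 : 0 ≤ N * L * (a' - a) :=
      mul_nonneg (mul_nonneg (Nat.cast_nonneg N) hL0.le) (sub_nonneg.2 haa)
    linarith
  have hnn : ∀ x : ℝ, 0 ≤ x → 0 ≤ 2 * (N * L * x) := fun x hx =>
    mul_nonneg two_pos.le (mul_nonneg (mul_nonneg (Nat.cast_nonneg N) hL0.le) hx)
  have hFL : ∀ a ∈ Icc (0 : ℝ) 1, ∀ a' ∈ Icc (0 : ℝ) 1, ∀ c ∈ Icc (0 : ℝ) 1, a ≤ a' →
      P.interfaceFluxL N a' c ≤ P.interfaceFluxL N a c + (K + 2 * N * L) * (a' - a) := by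
    intro a ha a' ha' c hc haa
    rw [interfaceFluxL_eq, interfaceFluxL_eq]
    linarith [hGl 0 a ha a' ha' c hc haa, hφ 0 a ha a' ha' haa]
  have hFR : ∀ d ∈ Icc (0 : ℝ) 1, ∀ b ∈ Icc (0 : ℝ) 1, ∀ b' ∈ Icc (0 : ℝ) 1, b ≤ b' →
      P.interfaceFluxR N d b ≤ P.interfaceFluxR N d b' + (K + 2 * N * L) * (b' - b) := by
    intro d hd b hb b' hb' hbb
    rw [interfaceFluxR_eq, interfaceFluxR_eq]
    linarith [hGr 1 d hd b hb b' hb' hbb, hφ 1 b hb b' hb' hbb]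
  refine ⟨K + 2 * N * L, by positivity, fun i => ⟨fun a ha b hb a' ha' b' hb' => ?_, ?_, ?_⟩,
    fun l hl => ⟨?_, ?_, ?_⟩, fun r hr => ⟨?_, ?_, ?_⟩, fun c d hcd => ⟨?_, ?_, ?_⟩⟩
  · exact P.cellFlux_mono i ha hb ha' hb'
  · intro a ha a' ha' b hb haa
    rw [cellFlux_eq, cellFlux_eq]
    linarith [hGl i a ha a' ha' b hb haa, hφ' i a ha a' ha' haa]
  · intro a ha b hb b' hb' hbb
    rw [cellFlux_eq, cellFlux_eq]
    linarith [hGr i a ha b hb b' hb' hbb, hφ' i b hb b' hb' hbb]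
  · intro a _ b hb a' _ b' hb' _ hbb
    exact P.G_anti 0 l hl hb' hb hbb
  · intro a ha a' ha' b hb haa
    have := hnn (a' - a) (by linarith)
    have := mul_nonneg hK0.le (sub_nonneg.2 haa)
    linarith
  · intro a ha b hb b' hb' hbb
    linarith [hGr 0 l hl b hb b' hb' hbb, hnn (b' - b) (by linarith)]
  · intro a ha b _ a' ha' b' _ haa _
    exact P.G_mono 1 r hr ha ha' haa
  · intro a ha a' ha' b hb haa
    linarith [hGl 1 a ha a' ha' r hr haa, hnn (a' - a) (by linarith)]
  · intro a ha b hb b' hb' hbb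
    have := hnn (b' - b) (by linarith)
    have := mul_nonneg hK0.le (sub_nonneg.2 hbb)
    linarith
  · intro a ha b hb a' ha' b' hb' haa hbb
    obtain ⟨h1, h2, h3, h4⟩ := hcd a ha b hb
    obtain ⟨h1', h2', h3', h4'⟩ := hcd a' ha' b' hb'
    have := P.interfaceFlux_le_max ha hb h1 h2 ha' hb' h1' h2' haa hbb h3 h3' h4
    rwa [← h4', max_self] at this
  · intro a ha a' ha' b hb haa
    obtain ⟨h1, h2, h3, h4⟩ := hcd a ha b hb
    obtain ⟨h1', h2', h3', h4'⟩ := hcd a' ha' b hb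
    -- If the interface values rise with `a`, freezing the left one only increases the new flux. If
    -- they fall, the flux seen from the right does not increase at all.
    rcases h3.monotone h3' with ⟨h, -⟩ | ⟨-, h⟩
    · exact (P.interfaceFluxL_mono ha' h1' ha' h1 le_rfl h).trans (hFL a ha a' ha' _ h1 haa)
    · have := P.interfaceFluxR_mono (N := N) h2' hb h2 hb h le_rfl
      rw [← h4, ← h4'] at this
      have e1 := mul_nonneg hK0.le (sub_nonneg.2 haa)
      linarith [hnn (a' - a) (by linarith)]
  · intro a ha b hb b' hb' hbb
    obtain ⟨h1, h2, h3, h4⟩ := hcd a ha b hb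
    obtain ⟨h1', h2', h3', h4'⟩ := hcd a ha b' hb'
    rcases h3.monotone h3' with ⟨-, h⟩ | ⟨h, -⟩
    · simp only [h4, h4']
      exact (P.interfaceFluxR_mono h2 hb h2' hb h le_rfl).trans (hFR _ h2' b hb b' hb' hbb)
    · have := P.interfaceFluxL_mono (N := N) ha h1 ha h1' le_rfl h
      have e1 := mul_nonneg hK0.le (sub_nonneg.2 hbb)
      linarith [hnn (b' - b) (by linarith)]

theorem exists_isStep {N : ℕ} (hN : 0 < N) {δ l r : ℝ} (hδ : 0 < δ) (hl : l ∈ Icc (0 : ℝ) 1)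
    (hr : r ∈ Icc (0 : ℝ) 1) {W : ℤ → ℝ} (hW : ∀ j ∈ Ico (-N : ℤ) N, W j ∈ Icc (0 : ℝ) 1) :
    ∃ U c d, (∀ j, U j ∈ Icc (0 : ℝ) 1) ∧ P.IsStep N δ l r W U c d := by
  have m0 : (0 : ℝ) ∈ Icc (0 : ℝ) 1 := ⟨le_rfl, zero_le_one⟩
  have m1 : (1 : ℝ) ∈ Icc (0 : ℝ) 1 := ⟨zero_le_one, le_rfl⟩
  have hN' : (0 : ℝ) < N := by exact_mod_cast hN
  obtain ⟨K, hK0, hcell, hleft, hright, hint⟩ := P.exists_monotoneFlux_bound N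
  have hex : ∀ a b : ℝ, ∃ c d : ℝ, a ∈ Icc (0 : ℝ) 1 → b ∈ Icc (0 : ℝ) 1 →
      c ∈ Icc (0 : ℝ) 1 ∧ d ∈ Icc (0 : ℝ) 1 ∧ P.Connected c d ∧
      P.interfaceFluxL N a c = P.interfaceFluxR N d b := by
    intro a b
    by_cases h : a ∈ Icc (0 : ℝ) 1 ∧ b ∈ Icc (0 : ℝ) 1
    · obtain ⟨c, hc, d, hd, h1, h2⟩ := P.exists_interface (N := N) h.1 h.2
      exact ⟨c, d, fun _ _ => ⟨hc, hd, h1, h2⟩⟩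
    · exact ⟨0, 0, fun h1 h2 => absurd ⟨h1, h2⟩ h⟩
  choose c d hcd using hex
  -- The interface unknowns are eliminated as functions of the two adjacent cell values, so that
  -- boundary, interface and interior faces form one family of monotone fluxes.
  set Φ : ℤ → ℝ → ℝ → ℝ := fun j => if j = -N then fun _ b => P.G 0 l b else if j = N then
    fun a _ => P.G 1 a r else if j = 0 then fun a b => P.interfaceFluxL N a (c a b) else
    P.cellFlux N (cellLayer j) with hΦ
  have hflux : ∀ U : ℤ → ℝ, ∀ j, P.flux N l r U (c (U (-1)) (U 0)) j = Φ j (U (j - 1)) (U j) := by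
    intro U j
    simp only [flux, hΦ]
    split_ifs with h1 h2 h3
    · rw [h1]
    · rw [h2]
    · rw [h3]; rfl
    · rfl
  have hΦm : ∀ j ∈ Icc (-N : ℤ) N, IsMonotoneFlux K (Φ j) := by
    intro j _
    simp only [hΦ]
    split_ifs
    · exact hleft l hl
    · exact hright r hr
    · exact hint c d fun a ha b hb => hcd a b ha hb
    · exact hcell _
  have hI0 : P.interfaceFluxL N 0 (c 0 0) = 0 := by
    obtain ⟨h1, h2, h3, h4⟩ := hcd 0 0 m0 m0
    have e1 := P.interfaceFlux_le_max (N := N) m0 m0 h1 h2 m0 m0 m0 m0 le_rfl le_rfl h3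
      P.connected_zero h4
    have e2 := P.min_le_interfaceFlux (N := N) m0 m0 m0 m0 m0 m0 h1 h2 le_rfl le_rfl
      P.connected_zero h3 h4
    simp only [P.interfaceFluxL_eq N 0 0, P.interfaceFluxR_eq N 0 0, G_zero, sub_self, mul_zero,
      max_self, min_self] at e1 e2
    exact le_antisymm e1 e2
  have hI1 : P.interfaceFluxL N 1 (c 1 1) = P.q := by
    obtain ⟨h1, h2, h3, h4⟩ := hcd 1 1 m1 m1
    have e1 := P.interfaceFlux_le_max (N := N) m1 m1 h1 h2 m1 m1 m1 m1 le_rfl le_rfl h3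
      P.connected_one h4
    have e2 := P.min_le_interfaceFlux (N := N) m1 m1 m1 m1 m1 m1 h1 h2 le_rfl le_rfl
      P.connected_one h3 h4
    simp only [P.interfaceFluxL_eq N 1 1, P.interfaceFluxR_eq N 1 1, G_one, sub_self, mul_zero,
      sub_zero, max_self, min_self] at e1 e2
    exact le_antisymm e1 e2
  obtain ⟨U, hU, hUeq⟩ := exists_implicit_step (q := P.q) (lam := δ * N) hK0 (by positivity)
    (fun j => P.porosity_mem (cellLayer j)) hΦm
    (fun j hj => by
      have hjN : j ≠ N := hj.2.ne
      simp only [hΦ, if_neg hjN]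
      split_ifs
      · exact (P.G_zero 0).symm.trans_le (P.G_mono 0 0 m0 m0 hl hl.1)
      · exact hI0.ge
      · simp [cellFlux, G_zero])
    (fun j hj => by
      have hjN : j ≠ -N := hj.1.ne'
      simp only [hΦ, if_neg hjN]
      split_ifs
      · exact (P.G_anti 1 0 m0 m0 hr hr.1).trans_eq (P.G_zero 1)
      · exact hI0.le
      · simp [cellFlux, G_zero])
    (fun j hj => by
      have hjN : j ≠ N := hj.2.ne
      simp only [hΦ, if_neg hjN]
      split_ifs
      · rw [← P.G_one 0]; exact P.G_mono 0 1 m1 hl m1 hl.2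
      · exact hI1.le
      · simp [cellFlux, G_one])
    (fun j hj => by
      have hjN : j ≠ -N := hj.1.ne'
      simp only [hΦ, if_neg hjN]
      split_ifs
      · rw [← P.G_one 1]; exact P.G_anti 1 1 m1 hr m1 hr.2
      · exact hI1.ge
      · simp [cellFlux, G_one]) hW
  obtain ⟨h1, h2, h3, h4⟩ := hcd (U (-1)) (U 0) (hU _) (hU _)
  refine ⟨U, c (U (-1)) (U 0), d (U (-1)) (U 0), hU, h1, h2, h4, h3, fun j hj => ?_⟩
  have := hUeq j hj
  rw [hflux, hflux, add_sub_cancel_right]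
  have e : P.porosity (cellLayer j) * ((U j - W j) / δ) * (1 / N) + Φ (j + 1) (U j) (U (j + 1)) -
      Φ j (U (j - 1)) (U j) = (1 / (δ * N)) * (P.porosity (cellLayer j) * (U j - W j) + δ * N *
        (Φ (j + 1) (U j) (U (j + 1)) - Φ j (U (j - 1)) (U j))) := by
    field_simp
    ring
  rw [e, this, mul_zero]

variable {P}

/-- The implicit scheme has a discrete solution. -/
theorem IsRegularInitial.exists_isDiscreteSolution {u₀ : ℝ → ℝ} (h : P.IsRegularInitial u₀)
    {N M : ℕ} (hN : 0 < N) (hM : 0 < M) : ∃ v, P.IsDiscreteSolution u₀ N M v := by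
  have hN' : (0 : ℝ) < N := by exact_mod_cast hN
  have hM' : (0 : ℝ) < M := by exact_mod_cast hM
  have hδ : 0 < P.T / M := div_pos P.T_pos hM'
  set v0 : ℤ → ℝ := fun j => 1 / (1 / N) * ∫ x in ((j : ℝ) / N)..((j + 1) / N), u₀ x with hv0
  have hv01 : ∀ j ∈ Ico (-N : ℤ) N, v0 j ∈ Icc (0 : ℝ) 1 := by
    intro j hj
    have hsub := cell_subset_layer hN hj
    have hmem := ae_restrict_of_ae_restrict_of_subset hsub (h.mem_layer _)
    have hmeas := (h.aestronglyMeasurable_layer (cellLayer j)).mono_measure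
      (Measure.restrict_mono hsub le_rfl)
    have hlen : ((j : ℝ) + 1) / N - j / N = 1 / N := by field_simp; ring
    have hpos : (0 : ℝ) < 1 / N := by positivity
    have hle : (j : ℝ) / N ≤ (j + 1) / N := by linarith
    have hint : IntegrableOn u₀ (Ioo ((j : ℝ) / N) ((j + 1) / N)) := by
      refine IntegrableOn.of_bound (C := 1) (by simp) hmeas ?_
      filter_upwards [hmem] with t ht
      rw [Real.norm_eq_abs, abs_of_nonneg ht.1]
      exact ht.2
    have hi0 : 0 ≤ ∫ x in Ioo ((j : ℝ) / N) ((j + 1) / N), u₀ x :=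
      integral_nonneg_of_ae (hmem.mono fun t ht => ht.1)
    have hi1 : ∫ x in Ioo ((j : ℝ) / N) ((j + 1) / N), u₀ x ≤ 1 / N := by
      calc ∫ x in Ioo ((j : ℝ) / N) ((j + 1) / N), u₀ x
          ≤ ∫ x in Ioo ((j : ℝ) / N) ((j + 1) / N), (1 : ℝ) :=
            integral_mono_ae hint (by simp) (hmem.mono fun t ht => ht.2)
        _ = 1 / N := by simp [hlen]
    simp only [hv0]
    rw [intervalIntegral.integral_of_le hle, integral_Ioc_eq_integral_Ioo]
    refine ⟨by positivity, ?_⟩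
    rw [one_div_mul_eq_div]
    exact (div_le_one hpos).2 hi1
  have hstep : ∀ (n : ℕ) (W : ℤ → ℝ), ∃ U c d, n < M → (∀ j ∈ Ico (-N : ℤ) N, W j ∈ Icc (0 : ℝ) 1) →
      (∀ j, U j ∈ Icc (0 : ℝ) 1) ∧
      P.IsStep N (P.T / M) (P.timeMean M P.uL n) (P.timeMean M P.uR n) W U c d := by
    intro n W
    by_cases hh : n < M ∧ ∀ j ∈ Ico (-N : ℤ) N, W j ∈ Icc (0 : ℝ) 1
    · obtain ⟨U, c, d, h1, h2⟩ := P.exists_isStep hN hδ (P.timeMean_mem P.uL_meas P.uL_mem hh.1)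
        (P.timeMean_mem P.uR_meas P.uR_mem hh.1) hh.2
      exact ⟨U, c, d, fun _ _ => ⟨h1, h2⟩⟩
    -- Arbitrary default, so that the step is a total function and can be iterated.
    · exact ⟨0, 0, 0, fun h1 h2 => absurd ⟨h1, h2⟩ hh⟩
  choose U c d hUcd using hstep
  let v : ℕ → ℤ → ℝ := fun n => Nat.rec v0 (fun n W => U n W) n
  have hv : ∀ n ≤ M, ∀ j ∈ Ico (-N : ℤ) N, v n j ∈ Icc (0 : ℝ) 1 := by
    intro n
    induction n with
    | zero => exact fun _ => hv01
    | succ n ih =>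
      intro hn j _
      exact (hUcd n (v n) (by omega) (ih (by omega))).1 j
  -- The interface values of level `n + 1` are those produced by the step that starts from level
  -- `n`, hence the shift.
  refine ⟨v, fun j _ => rfl, hv, fun n => c (n - 1) (v (n - 1)), fun n => d (n - 1) (v (n - 1)),
    fun n hn => ?_⟩
  obtain ⟨h1, h2, h3, h4, h5⟩ := (hUcd n (v n) hn (hv n hn.le)).2
  exact ⟨h1, h2, h3, h4, h5⟩

end Problem

/-! ### Compactness of the discrete solutions. -/

/-- Asymptotically equicontinuous sequences have pointwise convergent subsequences. -/
theorem exists_subseq_tendsto_of_equicontinuous {X : Type*} [PseudoMetricSpace X]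
    [TopologicalSpace.SeparableSpace X] {U : ℕ → X → ℝ} (hU : ∀ k x, U k x ∈ Icc (0 : ℝ) 1)
    (heq : ∀ ε > 0, ∃ ρ > 0, ∀ᶠ k in atTop, ∀ x y, dist x y ≤ ρ → |U k x - U k y| ≤ ε) :
    ∃ κ : ℕ → ℕ, StrictMono κ ∧ ∀ x, ∃ l, Tendsto (fun k => U (κ k) x) atTop (𝓝 l) := by
  rcases isEmpty_or_nonempty X with hX | hX
  · exact ⟨id, strictMono_id, fun x => (hX.false x).elim⟩
  have := isCompact_iff_compactSpace.1 (isCompact_Icc (a := (0 : ℝ)) (b := 1))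
  -- Sequential compactness of a countable product of copies of `[0,1]` replaces the diagonal
  -- extraction along a dense sequence.
  obtain ⟨a, κ, hκ, hlim⟩ := CompactSpace.tendsto_subseq
    (fun k (n : ℕ) => (⟨U k (TopologicalSpace.denseSeq X n), hU _ _⟩ : Icc (0 : ℝ) 1))
  refine ⟨κ, hκ, fun x => cauchySeq_tendsto_of_complete ?_⟩
  have hlim' : ∀ n, CauchySeq fun k => U (κ k) (TopologicalSpace.denseSeq X n) := fun n =>
    ((continuous_subtype_val.tendsto _).comp (tendsto_pi_nhds.1 hlim n)).cauchySeq
  rw [Metric.cauchySeq_iff]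
  intro ε hε
  obtain ⟨ρ, hρ, hev⟩ := heq (ε / 4) (by positivity)
  obtain ⟨n, hn⟩ := (TopologicalSpace.denseRange_denseSeq X).exists_dist_lt x hρ
  obtain ⟨K, hK⟩ := eventually_atTop.1 (hκ.tendsto_atTop.eventually hev)
  obtain ⟨K', hK'⟩ := Metric.cauchySeq_iff.1 (hlim' n) (ε / 4) (by positivity)
  refine ⟨max K K', fun p hp q hq => ?_⟩
  have e1 := hK p ((le_max_left _ _).trans hp) _ _ hn.le
  have e2 := hK q ((le_max_left _ _).trans hq) _ _ hn.le
  have e3 := hK' p ((le_max_right _ _).trans hp) q ((le_max_right _ _).trans hq)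
  rw [Real.dist_eq] at e3 ⊢
  rw [abs_lt] at e3 ⊢
  rw [abs_le] at e1 e2
  constructor <;> linarith [e1.1, e1.2, e2.1, e2.2, e3.1, e3.2]

theorem abs_floor_sub_floor_le (x y : ℝ) : |((⌊x⌋ : ℤ) : ℝ) - ⌊y⌋| ≤ |x - y| + 1 := by
  have h1 := Int.floor_le x
  have h2 := Int.lt_floor_add_one x
  have h3 := Int.floor_le y
  have h4 := Int.lt_floor_add_one y
  have h5 := abs_le.1 (le_refl |x - y|)
  rw [abs_le]
  constructor <;> linarith [h5.1, h5.2]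

theorem abs_natCeil_sub_natCeil_le {x y : ℝ} (hx : 0 ≤ x) (hy : 0 ≤ y) :
    |((⌈x⌉₊ : ℕ) : ℝ) - ⌈y⌉₊| ≤ |x - y| + 1 := by
  have h1 := Nat.le_ceil x
  have h2 := Nat.ceil_lt_add_one hx
  have h3 := Nat.le_ceil y
  have h4 := Nat.ceil_lt_add_one hy
  have h5 := abs_le.1 (le_refl |x - y|)
  rw [abs_le]
  constructor <;> linarith [h5.1, h5.2]

namespace Problem

/-- The cell containing a point of the `i`-th layer. -/
theorem floor_mem_of_mem_layer {N : ℕ} (hN : 0 < N) {i : Fin 2} {x : ℝ} (hx : x ∈ layer i) :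
    ⌊x / (1 / (N : ℝ))⌋ ∈ Ico (-N : ℤ) N ∧ cellLayer ⌊x / (1 / (N : ℝ))⌋ = i := by
  have hN' : (0 : ℝ) < N := by exact_mod_cast hN
  have hx1 := layer_subset i hx
  rw [div_div_eq_mul_div, div_one]
  refine ⟨⟨?_, ?_⟩, ?_⟩
  · rw [Int.le_floor]; push_cast; nlinarith [hx1.1]
  · rw [Int.floor_lt]; push_cast; nlinarith [hx1.2]
  · unfold cellLayer
    fin_cases i
    · simp only [layer, Fin.zero_eta, if_true] at hx
      have : ⌊x * (N : ℝ)⌋ < 0 := by rw [Int.floor_lt]; push_cast; nlinarith [hx.2]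
      simp [this]
    · simp only [layer, Fin.mk_one, one_ne_zero, if_false] at hx
      have : ¬ ⌊x * (N : ℝ)⌋ < 0 := by
        rw [not_lt, Int.le_floor]; push_cast; nlinarith [hx.1]
      simp [this]

theorem ceil_mem_of_mem_Ioo {T : ℝ} {M : ℕ} (hM : 0 < M) {t : ℝ} (ht : t ∈ Ioo 0 T) :
    1 ≤ ⌈t / (T / M)⌉₊ ∧ ⌈t / (T / M)⌉₊ ≤ M := by
  have hM' : (0 : ℝ) < M := by exact_mod_cast hM
  have hT : 0 < T := ht.1.trans ht.2
  refine ⟨Nat.one_le_ceil_iff.2 (div_pos ht.1 (div_pos hT hM')), Nat.ceil_le.2 ?_⟩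
  rw [div_le_iff₀ (div_pos hT hM')]
  calc t ≤ T := ht.2.le
    _ = M * (T / M) := by field_simp

theorem cellLayer_mono {j k : ℤ} (hjk : cellLayer j = cellLayer k) {l : ℤ}
    (h1 : j ≤ l) (h2 : l ≤ k) : cellLayer l = cellLayer j := by
  unfold cellLayer at *
  split_ifs at * <;> first | rfl | omega

variable {P : Problem} {u₀ : ℝ → ℝ} {C : ℝ} {N M : ℕ} {v : ℕ → ℤ → ℝ} {c d : ℕ → ℝ}

/-- The flux and its convective part are both at most `C`, so `N` times the jump of `φ_i` between
neighbours is at most `2C`; the jumps are summed within the layer. Levels start at `1` because the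
recorded flux bounds belong to the implicit steps. -/
theorem IsBoundedScheme.abs_phi_sub_le (h : IsBoundedScheme P u₀ C N M v c d)
    (hC : ∀ i, ∀ a ∈ Icc (0 : ℝ) 1, ∀ b ∈ Icc (0 : ℝ) 1, |P.G i a b| ≤ C) {n : ℕ} (hn : 1 ≤ n)
    (hnM : n ≤ M) {i : Fin 2} {j k : ℤ} (hj : j ∈ Ico (-N : ℤ) N) (hk : k ∈ Ico (-N : ℤ) N)
    (hji : cellLayer j = i) (hki : cellLayer k = i) :
    |P.phi i (v n j) - P.phi i (v n k)| ≤ 2 * C / N * |(j : ℝ) - k| := by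
  have hN' : (0 : ℝ) < N := by exact_mod_cast h.pos_N
  obtain ⟨n, rfl⟩ := Nat.exists_eq_add_of_le' hn
  have key : ∀ m : ℕ, ∀ j k : ℤ, k = j + m → j ∈ Ico (-N : ℤ) N → k ∈ Ico (-N : ℤ) N →
      cellLayer j = i → cellLayer k = i →
      |P.phi i (v (n + 1) j) - P.phi i (v (n + 1) k)| ≤ 2 * C / N * m := by
    intro m
    induction m with
    | zero => rintro j k hk - - - -; simp [hk]
    | succ m ih =>
      intro j k hkj hj hk hji hki
      push_cast at hkj
      have hk' : k - 1 ∈ Ico (-N : ℤ) N := ⟨by have := hj.1; omega, by have := hk.2; omega⟩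
      have hki' : cellLayer (k - 1) = i := by
        rw [cellLayer_mono (j := j) (k := k) (hji.trans hki.symm) (by omega) (by omega),
          hji]
      have h1 := ih j (k - 1) (by omega) hj hk' hji hki'
      -- The face `0` is the interface, where the flux has another form; it cannot separate two
      -- cells of the same layer.
      have hk0 : k ≠ 0 := by
        rintro rfl
        rw [← hki] at hki'
        simp [cellLayer] at hki'
      have h2 := h.flux_le n (by omega) k ⟨hk.1, hk.2.le⟩
      have hkN : -(N : ℤ) < k := by have := hk'.1; omega
      rw [P.flux_interior _ _ _ _ hkN hk.2 hk0, hki, cellFlux_eq] at h2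
      have h3 := hC i _ (h.mem (n + 1) hnM _ hk') _ (h.mem (n + 1) hnM _ hk)
      have h4 : |N * (P.phi i (v (n + 1) (k - 1)) - P.phi i (v (n + 1) k))| ≤ 2 * C := by
        rw [abs_le] at h2 h3 ⊢
        constructor <;> linarith [h2.1, h2.2, h3.1, h3.2]
      rw [abs_mul, abs_of_pos hN'] at h4
      have h5 : |P.phi i (v (n + 1) (k - 1)) - P.phi i (v (n + 1) k)| ≤ 2 * C / N := by
        rw [le_div_iff₀ hN']; linarith
      calc |P.phi i (v (n + 1) j) - P.phi i (v (n + 1) k)|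
          ≤ |P.phi i (v (n + 1) j) - P.phi i (v (n + 1) (k - 1))| +
            |P.phi i (v (n + 1) (k - 1)) - P.phi i (v (n + 1) k)| := abs_sub_le _ _ _
        _ ≤ 2 * C / N * m + 2 * C / N := add_le_add h1 h5
        _ = 2 * C / N * (m + 1 : ℕ) := by push_cast; ring
  have key' : ∀ j k : ℤ, j ≤ k → (k - j).toNat = (k : ℝ) - j := by
    intro j k hjk
    rw [← Int.cast_natCast, Int.toNat_of_nonneg (by omega)]
    push_cast; ring
  rcases le_total j k with hjk | hjk
  · have := key (k - j).toNat j k (by omega) hj hk hji hki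
    rwa [key' j k hjk, ← abs_of_nonneg (sub_nonneg.2 (Int.cast_le (R := ℝ).2 hjk)),
      abs_sub_comm (k : ℝ)] at this
  · have := key (j - k).toNat k j (by omega) hk hj hki hji
    rwa [key' k j hjk, ← abs_of_nonneg (sub_nonneg.2 (Int.cast_le (R := ℝ).2 hjk)),
      abs_sub_comm (P.phi i _)] at this

/-- Summed over a block of consecutive cells, the fluxes telescope. In each time step only the two
at the ends of the block remain, each at most `C`. -/
theorem IsBoundedScheme.abs_sum_sub_le (h : IsBoundedScheme P u₀ C N M v c d) {l : ℤ} {K : ℕ}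
    (hl : -(N : ℤ) ≤ l) (hlK : l + K ≤ N) {n m : ℕ} (hnm : n ≤ m) (hmM : m ≤ M) :
    |∑ r ∈ Finset.range K, P.porosity (cellLayer (l + r)) * (v m (l + r) - v n (l + r))| ≤
      2 * C * N * (P.T / M) * ((m : ℝ) - n) := by
  have hN' : (0 : ℝ) < N := by exact_mod_cast h.pos_N
  have hM' : (0 : ℝ) < M := by exact_mod_cast h.pos_M
  have hδ : 0 < P.T / M := div_pos P.T_pos hM'
  induction m, hnm using Nat.le_induction with
  | base => simp
  | succ m hnm ih =>
    have ih := ih (by omega)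
    set F : ℤ → ℝ := fun j => P.flux N (P.timeMean M P.uL m) (P.timeMean M P.uR m) (v (m + 1))
      (c (m + 1)) j with hF
    have hstep : ∀ r ∈ Finset.range K,
        P.porosity (cellLayer (l + r)) * (v (m + 1) (l + r) - v m (l + r)) =
        -(P.T / M) * N * (F (l + (r + 1 : ℕ)) - F (l + r)) := by
      intro r hr
      have hr' := Finset.mem_range.1 hr
      have hb := (h.step m (by omega)).balance (l + r) ⟨by omega, by omega⟩
      have e : l + ((r + 1 : ℕ) : ℤ) = l + r + 1 := by push_cast; ring
      rw [e]
      have hb' : F (l + r + 1) - F (l + r) = -(P.porosity (cellLayer (l + r)) *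
        ((v (m + 1) (l + r) - v m (l + r)) / (P.T / M)) * (1 / N)) := by
        simp only [hF]; linarith
      rw [hb']
      have hT := P.T_pos
      field_simp
    have hsum : ∑ r ∈ Finset.range K, P.porosity (cellLayer (l + r)) *
        (v (m + 1) (l + r) - v m (l + r)) = -(P.T / M) * N * (F (l + K) - F l) := by
      rw [Finset.sum_congr rfl hstep, ← Finset.mul_sum,
        Finset.sum_range_sub (fun r : ℕ => F (l + r))]
      simp
    have h1 := h.flux_le m (by omega) (l + K) ⟨by omega, hlK⟩
    have h2 := h.flux_le m (by omega) l ⟨hl, by omega⟩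
    have h3 : |-(P.T / M) * N * (F (l + K) - F l)| ≤ 2 * C * N * (P.T / M) := by
      rw [abs_mul, abs_mul, abs_neg, abs_of_pos hδ, abs_of_pos hN']
      have : |F (l + K) - F l| ≤ 2 * C := by
        refine (abs_sub _ _).trans ?_
        simp only [hF]; linarith
      calc P.T / M * N * |F (l + K) - F l| ≤ P.T / M * N * (2 * C) :=
            mul_le_mul_of_nonneg_left this (by positivity)
        _ = 2 * C * N * (P.T / M) := by ring
    have hsplit : ∑ r ∈ Finset.range K, P.porosity (cellLayer (l + r)) *
        (v (m + 1) (l + r) - v n (l + r)) =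
        ∑ r ∈ Finset.range K, P.porosity (cellLayer (l + r)) * (v (m + 1) (l + r) - v m (l + r)) +
        ∑ r ∈ Finset.range K, P.porosity (cellLayer (l + r)) * (v m (l + r) - v n (l + r)) := by
      rw [← Finset.sum_add_distrib]
      refine Finset.sum_congr rfl fun r _ => ?_
      ring
    rw [hsplit, hsum]
    refine (abs_add_le _ _).trans ((add_le_add h3 ih).trans (le_of_eq ?_))
    push_cast
    ring

/-- Time regularity of the discrete solutions, from the space regularity and the balance. -/
theorem IsBoundedScheme.abs_sub_le_of_window (h : IsBoundedScheme P u₀ C N M v c d)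
    (hC0 : 0 ≤ C) (hC : ∀ i, ∀ a ∈ Icc (0 : ℝ) 1, ∀ b ∈ Icc (0 : ℝ) 1, |P.G i a b| ≤ C) {ε η : ℝ}
    (hη : ∀ i, ∀ s ∈ Icc (0 : ℝ) 1, ∀ t ∈ Icc (0 : ℝ) 1,
      |P.phi i s - P.phi i t| ≤ η → |s - t| ≤ ε)
    {K : ℕ} (hK : 0 < K) (hKN : K ≤ N) (hKη : 2 * C / N * K ≤ η) {n m : ℕ} (hn : 1 ≤ n)
    (hnm : n ≤ m) (hmM : m ≤ M) {j : ℤ} (hj : j ∈ Ico (-N : ℤ) N) :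
    |v m j - v n j| ≤ 2 * ε +
      2 * C * N * (P.T / M) * ((m : ℝ) - n) / (P.porosity (cellLayer j) * K) := by
  have hK' : (0 : ℝ) < K := by exact_mod_cast hK
  have hp := (P.porosity_mem (cellLayer j)).1
  have hN' : (0 : ℝ) < N := by exact_mod_cast h.pos_N
  -- A block of `K` cells that stays in the layer of `j`; close to an end of the layer it is shifted
  -- inwards.
  obtain ⟨l, hl1, hl2, hlj, hlay⟩ : ∃ l : ℤ, -(N : ℤ) ≤ l ∧ l + K ≤ N ∧
      (∀ r : ℕ, r < K → |((l + r : ℤ) : ℝ) - j| ≤ K) ∧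
      ∀ r : ℕ, r < K → cellLayer (l + r) = cellLayer j := by
    have habs : ∀ l : ℤ, l ≤ j → j < l + K → ∀ r : ℕ, r < K → |((l + r : ℤ) : ℝ) - j| ≤ K := by
      intro l h1 h2 r hr
      rw [← Int.cast_sub, ← Int.cast_abs, ← Int.cast_natCast (R := ℝ) K, Int.cast_le, abs_le]
      omega
    have hj1 := hj.1
    have hj2 := hj.2
    rcases lt_or_ge j 0 with hj0 | hj0
    · refine ⟨min j (-K), by omega, by omega, habs _ (by omega) (by omega), fun r hr => ?_⟩
      have : min j (-(K : ℤ)) + r < 0 := by omega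
      simp [cellLayer, this, hj0]
    · refine ⟨min j (N - K), by omega, by omega, habs _ (by omega) (by omega), fun r hr => ?_⟩
      have h1 : ¬ min j ((N : ℤ) - K) + r < 0 := by omega
      have h2 : ¬ j < 0 := by omega
      simp [cellLayer, h1, h2]
  have hclose : ∀ q, 1 ≤ q → q ≤ M → ∀ r ∈ Finset.range K, |v q (l + r) - v q j| ≤ ε := by
    intro q hq hqM r hr
    have hr' := Finset.mem_range.1 hr
    have hmem : l + (r : ℤ) ∈ Ico (-N : ℤ) N := ⟨by omega, by omega⟩
    refine hη (cellLayer j) _ (h.mem q hqM _ hmem) _ (h.mem q hqM _ hj) ?_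
    refine (h.abs_phi_sub_le hC hq hqM hmem hj (hlay r hr') rfl).trans (le_trans ?_ hKη)
    exact mul_le_mul_of_nonneg_left (hlj r hr') (by positivity)
  have hsum := h.abs_sum_sub_le hl1 hl2 hnm hmM
  have e1 : ∑ r ∈ Finset.range K, P.porosity (cellLayer (l + r)) * (v m (l + r) - v n (l + r)) =
      P.porosity (cellLayer j) * ∑ r ∈ Finset.range K, (v m (l + r) - v n (l + r)) := by
    rw [Finset.mul_sum]
    exact Finset.sum_congr rfl fun r hr => by rw [hlay r (Finset.mem_range.1 hr)]
  rw [e1, abs_mul, abs_of_pos hp] at hsum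
  -- At both times the cells of the block are within `ε` of cell `j`, which costs `2ε` each; the
  -- change of the block sum is governed by the mass balance.
  have e2 : (K : ℝ) * (v m j - v n j) = ∑ r ∈ Finset.range K, (v m (l + r) - v n (l + r)) -
      ∑ r ∈ Finset.range K, ((v m (l + r) - v m j) - (v n (l + r) - v n j)) := by
    rw [← Finset.sum_sub_distrib]
    have : ∀ r ∈ Finset.range K, v m (l + r) - v n (l + r) - ((v m (l + r) - v m j) -
        (v n (l + r) - v n j)) = v m j - v n j := fun r _ => by ring
    rw [Finset.sum_congr rfl this]
    simp [mul_sub]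
  have e3 : |∑ r ∈ Finset.range K, ((v m (l + r) - v m j) - (v n (l + r) - v n j))| ≤
      K * (2 * ε) := by
    refine (Finset.abs_sum_le_sum_abs _ _).trans ?_
    refine (Finset.sum_le_card_nsmul _ _ (2 * ε) fun r hr => ?_).trans (by simp)
    refine (abs_sub _ _).trans ?_
    linarith [hclose m (hn.trans hnm) hmM r hr, hclose n hn (hnm.trans hmM) r hr]
  have e4 : |∑ r ∈ Finset.range K, (v m (l + r) - v n (l + r))| ≤
      2 * C * N * (P.T / M) * ((m : ℝ) - n) / P.porosity (cellLayer j) := by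
    rw [le_div_iff₀ hp]; linarith
  have e5 : (K : ℝ) * |v m j - v n j| ≤
      2 * C * N * (P.T / M) * ((m : ℝ) - n) / P.porosity (cellLayer j) + K * (2 * ε) := by
    rw [← abs_of_pos hK', ← abs_mul, abs_of_pos hK', e2]
    exact (abs_sub _ _).trans (add_le_add e4 e3)
  have e6 : |v m j - v n j| ≤ (2 * C * N * (P.T / M) * ((m : ℝ) - n) /
      P.porosity (cellLayer j) + K * (2 * ε)) / K := by
    rw [le_div_iff₀ hK']; linarith
  refine e6.trans (le_of_eq ?_)
  field_simp
  ring

variable (P) in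
/-- Discrete solutions are asymptotically equicontinuous in each layer. -/
theorem exists_equicontinuity (u₀ : ℝ → ℝ) (hC0 : 0 < C)
    (hC : ∀ i, ∀ a ∈ Icc (0 : ℝ) 1, ∀ b ∈ Icc (0 : ℝ) 1, |P.G i a b| ≤ C) {ε : ℝ} (hε : 0 < ε) :
    ∃ ρ > 0, ∃ n₀ : ℕ, ∀ N M v c d, n₀ ≤ N → n₀ ≤ M → IsBoundedScheme P u₀ C N M v c d →
      ∀ i, ∀ x ∈ layer i, ∀ y ∈ layer i, ∀ s ∈ Ioo 0 P.T, ∀ t ∈ Ioo 0 P.T, |x - y| ≤ ρ →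
        |s - t| ≤ ρ → |P.discreteFun N M v (x, s) - P.discreteFun N M v (y, t)| ≤ ε := by
  obtain ⟨η, hη0, hη⟩ := P.toRock.exists_phi_modulus (ε := ε / 8) (by positivity)
  have hT := P.T_pos
  set p := min (P.porosity 0) (P.porosity 1) with hp
  have hp0 : 0 < p := lt_min (P.porosity_mem 0).1 (P.porosity_mem 1).1
  have hpi : ∀ i, p ≤ P.porosity i := fun i => by
    fin_cases i
    · exact min_le_left _ _
    · exact min_le_right _ _
  -- Width of the averaging block: at most a whole layer, and so small that `φ_i` varies by at most
  -- `η` across it.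
  set h := min 1 (η / (2 * C)) with hh
  have hh0 : 0 < h := lt_min one_pos (by positivity)
  -- The first entry controls the variation in space. The second makes the mass-balance error at
  -- most `ε / 2` for time differences up to `2ρ` and blocks of `K ≥ N * h / 2` cells.
  set ρ := min (η / (4 * C)) (ε * h * p / (16 * C)) with hρ
  have hρ0 : 0 < ρ := lt_min (by positivity) (by positivity)
  -- The three thresholds ensure that the block contains a cell, that one mesh width adds at most `η
  -- / 2`, and that a time step is at most `ρ`.
  obtain ⟨n₀, hn₀⟩ := exists_nat_ge (max (1 / h) (max (4 * C / η) (P.T / ρ)))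
  refine ⟨ρ, hρ0, n₀, fun N M v c d hN hM hv i x hx y hy s hs t ht hxy hst => ?_⟩
  have hN' : (0 : ℝ) < N := by exact_mod_cast hv.pos_N
  have hM' : (0 : ℝ) < M := by exact_mod_cast hv.pos_M
  have hδ : 0 < P.T / M := div_pos hT hM'
  have hNn : (n₀ : ℝ) ≤ N := by exact_mod_cast hN
  have hMn : (n₀ : ℝ) ≤ M := by exact_mod_cast hM
  have hN1 : 1 ≤ N * h := by
    rw [← div_le_iff₀ hh0]; exact ((le_max_left _ _).trans hn₀).trans hNn
  have hN2 : 4 * C ≤ N * η := by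
    rw [← div_le_iff₀ hη0]
    exact (((le_max_left _ _).trans (le_max_right _ _)).trans hn₀).trans hNn
  have hM2 : P.T / M ≤ ρ := by
    rw [div_le_iff₀ hM', ← div_le_iff₀' hρ0]
    exact (((le_max_right _ _).trans (le_max_right _ _)).trans hn₀).trans hMn
  obtain ⟨hjx, hlx⟩ := floor_mem_of_mem_layer hv.pos_N hx
  obtain ⟨hjy, hly⟩ := floor_mem_of_mem_layer hv.pos_N hy
  obtain ⟨hns1, hnsM⟩ := ceil_mem_of_mem_Ioo hv.pos_M hs
  obtain ⟨hnt1, hntM⟩ := ceil_mem_of_mem_Ioo hv.pos_M ht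
  have hspace : |P.discreteFun N M v (x, s) - P.discreteFun N M v (y, s)| ≤ ε / 8 := by
    refine hη i _ (hv.mem _ hnsM _ hjx) _ (hv.mem _ hnsM _ hjy) ?_
    refine (hv.abs_phi_sub_le hC hns1 hnsM hjx hjy hlx hly).trans ?_
    have e1 := abs_floor_sub_floor_le (x / (1 / (N : ℝ))) (y / (1 / (N : ℝ)))
    rw [← sub_div, abs_div, abs_of_pos (by positivity : (0 : ℝ) < 1 / N),
      div_div_eq_mul_div |x - y|, div_one (|x - y| * N)] at e1
    have e2 : |x - y| ≤ η / (4 * C) := hxy.trans (min_le_left _ _)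
    calc 2 * C / N * |((⌊x / (1 / (N : ℝ))⌋ : ℤ) : ℝ) - ⌊y / (1 / (N : ℝ))⌋|
        ≤ 2 * C / N * (η / (4 * C) * N + 1) := by
          refine mul_le_mul_of_nonneg_left (e1.trans ?_) (by positivity)
          exact add_le_add_left (mul_le_mul_of_nonneg_right e2 hN'.le) 1
      _ = η / 2 + 2 * C / N := by field_simp; ring
      _ ≤ η := by
          have : 2 * C / N ≤ η / 2 := by rw [div_le_iff₀ hN']; linarith
          linarith
  have htime : ∀ m n : ℕ, 1 ≤ n → n ≤ m → m ≤ M → P.T / M * ((m : ℝ) - n) ≤ 2 * ρ →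
      |v m ⌊y / (1 / (N : ℝ))⌋ - v n ⌊y / (1 / (N : ℝ))⌋| ≤ ε / 4 + ε / 2 := by
    intro m n hn hnm hmM hmn
    set K := ⌊N * h⌋₊ with hK
    have hKpos : 0 < K := Nat.floor_pos.2 hN1
    have hK' : (0 : ℝ) < K := by exact_mod_cast hKpos
    have hKle : (K : ℝ) ≤ N * h := Nat.floor_le (by positivity)
    have hKge : N * h ≤ 2 * K := by
      have h1 := Nat.lt_floor_add_one ((N : ℝ) * h)
      have h2 : (1 : ℝ) ≤ K := by exact_mod_cast hKpos
      rw [← hK] at h1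
      linarith
    have hKN : K ≤ N := by
      have : (K : ℝ) ≤ N := hKle.trans (mul_le_of_le_one_right hN'.le (min_le_left _ _))
      exact_mod_cast this
    have hKη : 2 * C / N * K ≤ η := by
      have e1 : h ≤ η / (2 * C) := min_le_right _ _
      calc 2 * C / N * K ≤ 2 * C / N * (N * h) := mul_le_mul_of_nonneg_left hKle (by positivity)
        _ = 2 * C * h := by field_simp
        _ ≤ 2 * C * (η / (2 * C)) := mul_le_mul_of_nonneg_left e1 (by positivity)
        _ = η := by field_simp
    refine (hv.abs_sub_le_of_window hC0.le hC hη hKpos hKN hKη hn hnm hmM hjy).trans ?_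
    have e2 : 2 * C * N * (P.T / M) * ((m : ℝ) - n) / (P.porosity (cellLayer
        ⌊y / (1 / (N : ℝ))⌋) * K) ≤ ε / 2 := by
      rw [div_le_iff₀ (mul_pos (P.porosity_mem _).1 hK')]
      have e3 : ρ ≤ ε * h * p / (16 * C) := min_le_right _ _
      calc 2 * C * N * (P.T / M) * ((m : ℝ) - n) = 2 * C * N * (P.T / M * ((m : ℝ) - n)) := by ring
        _ ≤ 2 * C * N * (2 * (ε * h * p / (16 * C))) :=
            mul_le_mul_of_nonneg_left (by linarith) (by positivity)
        _ = ε / 4 * (p * (N * h)) := by field_simp; ring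
        _ ≤ ε / 4 * (p * (2 * K)) := by gcongr
        _ ≤ ε / 4 * (P.porosity (cellLayer ⌊y / (1 / (N : ℝ))⌋) * (2 * K)) := by
            gcongr; exact hpi _
        _ = ε / 2 * (P.porosity (cellLayer ⌊y / (1 / (N : ℝ))⌋) * K) := by ring
    linarith
  have hdist : P.T / M * |((⌈s / (P.T / M)⌉₊ : ℕ) : ℝ) - ⌈t / (P.T / M)⌉₊| ≤ 2 * ρ := by
    have e1 := abs_natCeil_sub_natCeil_le (div_nonneg hs.1.le hδ.le) (div_nonneg ht.1.le hδ.le)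
    rw [← sub_div, abs_div, abs_of_pos hδ] at e1
    calc P.T / M * |((⌈s / (P.T / M)⌉₊ : ℕ) : ℝ) - ⌈t / (P.T / M)⌉₊|
        ≤ P.T / M * (|s - t| / (P.T / M) + 1) := mul_le_mul_of_nonneg_left e1 hδ.le
      _ = |s - t| + P.T / M := by field_simp
      _ ≤ 2 * ρ := by linarith
  have htime' : |P.discreteFun N M v (y, s) - P.discreteFun N M v (y, t)| ≤ ε / 4 + ε / 2 := by
    rcases le_total ⌈t / (P.T / M)⌉₊ ⌈s / (P.T / M)⌉₊ with hle | hle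
    · refine htime _ _ hnt1 hle hnsM ?_
      rwa [abs_of_nonneg (sub_nonneg.2 (Nat.cast_le.2 hle))] at hdist
    · rw [abs_sub_comm]
      refine htime _ _ hns1 hle hntM ?_
      rwa [abs_sub_comm, abs_of_nonneg (sub_nonneg.2 (Nat.cast_le.2 hle))] at hdist
  have := abs_sub_le (P.discreteFun N M v (x, s)) (P.discreteFun N M v (y, s))
    (P.discreteFun N M v (y, t))
  linarith

theorem IsBoundedScheme.discreteFun_mem (h : IsBoundedScheme P u₀ C N M v c d) {i : Fin 2}
    {x t : ℝ} (hx : x ∈ layer i) (ht : t ∈ Ioo 0 P.T) :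
    P.discreteFun N M v (x, t) ∈ Icc (0 : ℝ) 1 :=
  h.mem _ (ceil_mem_of_mem_Ioo h.pos_M ht).2 _ (floor_mem_of_mem_layer h.pos_N hx).1

/-- Sequences of discrete solutions have subsequences converging at every point of both layers. -/
theorem exists_subseq_tendsto (hC0 : 0 < C)
    (hC : ∀ i, ∀ a ∈ Icc (0 : ℝ) 1, ∀ b ∈ Icc (0 : ℝ) 1, |P.G i a b| ≤ C) {N M : ℕ → ℕ}
    {v : ℕ → ℕ → ℤ → ℝ} {c d : ℕ → ℕ → ℝ} (hN : Tendsto N atTop atTop)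
    (hM : Tendsto M atTop atTop)
    (h : ∀ k, IsBoundedScheme P u₀ C (N k) (M k) (v k) (c k) (d k)) :
    ∃ κ : ℕ → ℕ, StrictMono κ ∧ ∀ i, ∀ p ∈ P.cyl i, ∃ l,
      Tendsto (fun k => P.discreteFun (N (κ k)) (M (κ k)) (v (κ k)) p) atTop (𝓝 l) := by
  have key : ∀ (i : Fin 2) (κ : ℕ → ℕ), StrictMono κ → ∃ κ' : ℕ → ℕ, StrictMono κ' ∧
      ∀ p ∈ P.cyl i, ∃ l, Tendsto (fun k => P.discreteFun (N (κ (κ' k))) (M (κ (κ' k)))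
        (v (κ (κ' k))) p) atTop (𝓝 l) := by
    intro i κ hκ
    obtain ⟨κ', hκ', hl⟩ := exists_subseq_tendsto_of_equicontinuous (X := P.cyl i)
      (U := fun k p => P.discreteFun (N (κ k)) (M (κ k)) (v (κ k)) p)
      (fun k p => (h (κ k)).discreteFun_mem p.2.1 p.2.2) (fun ε hε => by
        obtain ⟨ρ, hρ, n₀, hn₀⟩ := P.exists_equicontinuity u₀ hC0 hC hε
        refine ⟨ρ, hρ, ?_⟩
        filter_upwards [(hN.comp hκ.tendsto_atTop).eventually_ge_atTop n₀,
          (hM.comp hκ.tendsto_atTop).eventually_ge_atTop n₀] with k hk1 hk2 x y hxy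
        rw [Subtype.dist_eq, Prod.dist_eq, Real.dist_eq, Real.dist_eq] at hxy
        exact hn₀ _ _ _ _ _ hk1 hk2 (h (κ k)) i _ x.2.1 _ y.2.1 _ x.2.2 _ y.2.2
          ((le_max_left _ _).trans hxy) ((le_max_right _ _).trans hxy))
    exact ⟨κ', hκ', fun p hp => hl ⟨p, hp⟩⟩
  obtain ⟨κ₀, h₀, hl₀⟩ := key 0 id strictMono_id
  obtain ⟨κ₁, h₁, hl₁⟩ := key 1 κ₀ h₀
  refine ⟨fun k => κ₀ (κ₁ k), h₀.comp h₁, fun i p hp => ?_⟩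
  fin_cases i
  · obtain ⟨l, hl⟩ := hl₀ p hp
    exact ⟨l, hl.comp h₁.tendsto_atTop⟩
  · exact hl₁ p hp

end Problem

/-! ### Limits in one layer at a fixed time. -/

/-- Continuous convergence of asymptotically Lipschitz functions. -/
theorem tendsto_of_asymptotically_lipschitz {a b C : ℝ}
    {δ : ℕ → ℝ} (hδ : Tendsto δ atTop (𝓝 0)) {e : ℕ → ℝ → ℝ} {g : ℝ → ℝ} (hg : Continuous g)
    (hlip : ∀ k, ∀ x ∈ Ioo a b, ∀ y ∈ Ioo a b, |e k x - e k y| ≤ C * (|x - y| + δ k))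
    (hlim : ∀ᵐ x ∂volume.restrict (Ioo a b), Tendsto (fun k => e k x) atTop (𝓝 (g x)))
    {x : ℕ → ℝ} {z : ℝ} (hx : ∀ k, x k ∈ Ioo a b) (hxz : Tendsto x atTop (𝓝 z)) :
    Tendsto (fun k => e k (x k)) atTop (𝓝 (g z)) := by
  have hz : z ∈ closure (Ioo a b) := mem_closure_of_tendsto hxz (Eventually.of_forall hx)
  have := neBot_nhdsWithin_inf_ae isOpen_Ioo hz
  rw [Metric.tendsto_atTop']
  intro ε hε
  have h1 : ∀ᶠ y in 𝓝[Ioo a b] z ⊓ ae volume, y ∈ Ioo a b := mem_inf_of_left self_mem_nhdsWithin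
  have h2 : ∀ᶠ y in 𝓝[Ioo a b] z ⊓ ae volume, y ∈ Ioo a b →
      Tendsto (fun k => e k y) atTop (𝓝 (g y)) :=
    mem_inf_of_right ((ae_restrict_iff' measurableSet_Ioo).1 hlim)
  have h3 : ∀ᶠ y in 𝓝[Ioo a b] z ⊓ ae volume, |g y - g z| < ε / 4 :=
    mem_inf_of_left (nhdsWithin_le_nhds
      ((Metric.tendsto_nhds.1 (hg.tendsto z)) (ε / 4) (by positivity)))
  have h4 : ∀ᶠ y in 𝓝[Ioo a b] z ⊓ ae volume, C * |z - y| < ε / 4 := by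
    have hc : Tendsto (fun y => C * |z - y|) (𝓝 z) (𝓝 (C * |z - z|)) := by
      apply Continuous.tendsto; fun_prop
    rw [sub_self, abs_zero, mul_zero] at hc
    exact mem_inf_of_left (nhdsWithin_le_nhds (hc.eventually_lt_const (by positivity)))
  -- The limit point `z` may be an end point or an exceptional point, so convergence is borrowed
  -- from a nearby good point `y`.
  obtain ⟨y, hy1, hy2, hy3, hy4⟩ := (h1.and (h2.and (h3.and h4))).exists
  have h5 : Tendsto (fun k => C * (|x k - y| + δ k)) atTop (𝓝 (C * (|z - y| + 0))) :=
    (((hxz.sub_const y).abs).add hδ).const_mul C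
  rw [add_zero] at h5
  have h6 := (Metric.tendsto_nhds.1 (hy2 hy1)) (ε / 4) (by positivity)
  obtain ⟨n, hn⟩ := eventually_atTop.1 ((h5.eventually_lt_const hy4).and h6)
  refine ⟨n, fun k hk => ?_⟩
  obtain ⟨h7, h8⟩ := hn k hk.le
  have h9 := hlip k _ (hx k) y hy1
  rw [Real.dist_eq] at h8 ⊢
  rw [abs_lt] at h8 hy3 ⊢
  rw [abs_le] at h9
  constructor <;> linarith [h8.1, h8.2, hy3.1, hy3.2, h9.1, h9.2]

theorem aestronglyMeasurable_comp_uncurry {α : Type*} [MeasurableSpace α] {μ : Measure α}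
    {G : ℝ → ℝ → ℝ} (hG : ContinuousOn (fun p : ℝ × ℝ => G p.1 p.2) (Icc 0 1 ×ˢ Icc 0 1))
    {u v : α → ℝ} (hu : AEStronglyMeasurable u μ) (hv : AEStronglyMeasurable v μ)
    (hum : ∀ᵐ x ∂μ, u x ∈ Icc (0 : ℝ) 1) (hvm : ∀ᵐ x ∂μ, v x ∈ Icc (0 : ℝ) 1) :
    AEStronglyMeasurable (fun x => G (u x) (v x)) μ := by
  set κ : ℝ → ℝ := fun s => (projIcc (0 : ℝ) 1 zero_le_one s : ℝ) with hκ
  have hκc : Continuous κ := continuous_subtype_val.comp continuous_projIcc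
  have hκm : ∀ s, κ s ∈ Icc (0 : ℝ) 1 := fun s => (projIcc (0 : ℝ) 1 zero_le_one s).2
  have hκid : ∀ s ∈ Icc (0 : ℝ) 1, κ s = s := fun s hs => by simp [hκ, projIcc_of_mem _ hs]
  have hc : Continuous fun p : ℝ × ℝ => G (κ p.1) (κ p.2) :=
    hG.comp_continuous (f := fun p : ℝ × ℝ => (κ p.1, κ p.2)) (by fun_prop)
      fun p => ⟨hκm _, hκm _⟩
  refine (hc.comp_aestronglyMeasurable (hu.prodMk hv)).congr ?_
  filter_upwards [hum, hvm] with x hx hx'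
  simp only [hκid _ hx, hκid _ hx']

/-- Limits of means over short intervals. -/
theorem tendsto_integral_shrinking {a b z : ℝ} {h : ℕ → ℝ → ℝ} {l B : ℝ} {δ p : ℕ → ℝ}
    (hδ0 : ∀ k, 0 < δ k) (hδ : Tendsto δ atTop (𝓝 0)) (hp : Tendsto p atTop (𝓝 z))
    (hsub : ∀ k, Ioo (p k) (p k + δ k) ⊆ Ioo a b)
    (hm : ∀ k, AEStronglyMeasurable (h k) (volume.restrict (Ioo a b)))
    (hB : ∀ k, ∀ x ∈ Ioo a b, |h k x| ≤ B)
    (hlim : ∀ x : ℕ → ℝ, (∀ k, x k ∈ Ioo a b) → Tendsto x atTop (𝓝 z) →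
      Tendsto (fun k => h k (x k)) atTop (𝓝 l)) :
    Tendsto (fun k => (δ k)⁻¹ * ∫ x in (p k)..(p k + δ k), h k x) atTop (𝓝 l) := by
  rw [Metric.tendsto_atTop]
  have hunif : ∀ ε > 0, ∃ n, ∀ k ≥ n, ∀ x ∈ Ioo (p k) (p k + δ k), |h k x - l| ≤ ε := by
    intro ε hε
    by_contra! hcon
    have hne : ∀ k, (Ioo (p k) (p k + δ k)).Nonempty := fun k =>
      nonempty_Ioo.2 (by linarith [hδ0 k])
    -- A point violating the bound is chosen whenever one exists and any point otherwise, so that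
    -- the hypothesis on moving points applies to a full sequence.
    have hsel : ∀ k, ∃ x ∈ Ioo (p k) (p k + δ k),
        (∃ y ∈ Ioo (p k) (p k + δ k), ε < |h k y - l|) → ε < |h k x - l| := by
      intro k
      by_cases hy : ∃ y ∈ Ioo (p k) (p k + δ k), ε < |h k y - l|
      · obtain ⟨y, hy1, hy2⟩ := hy
        exact ⟨y, hy1, fun _ => hy2⟩
      · obtain ⟨y, hy1⟩ := hne k
        exact ⟨y, hy1, fun h' => absurd h' hy⟩
    choose x hx hxε using hsel
    have hxz : Tendsto x atTop (𝓝 z) := by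
      refine tendsto_of_tendsto_of_tendsto_of_le_of_le hp (h := fun k => p k + δ k) ?_
        (fun k => (hx k).1.le) (fun k => (hx k).2.le)
      simpa using hp.add hδ
    have := hlim x (fun k => hsub k (hx k)) hxz
    obtain ⟨n, hn⟩ := eventually_atTop.1 ((Metric.tendsto_nhds.1 this) ε hε)
    obtain ⟨k, hk, y, hy1, hy2⟩ := hcon n
    have h1 := hxε k ⟨y, hy1, hy2⟩
    have h2 := hn k hk
    rw [Real.dist_eq] at h2
    linarith
  intro ε hε
  obtain ⟨n, hn⟩ := hunif (ε / 2) (by positivity)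
  refine ⟨n, fun k hk => ?_⟩
  have hle : p k ≤ p k + δ k := by linarith [hδ0 k]
  have hint : IntervalIntegrable (h k) volume (p k) (p k + δ k) := by
    rw [intervalIntegrable_iff_integrableOn_Ioo_of_le hle]
    refine IntegrableOn.of_bound (C := B) (by simp) ((hm k).mono_measure
      (Measure.restrict_mono (hsub k) le_rfl)) ?_
    exact (ae_restrict_iff' measurableSet_Ioo).2 (ae_of_all _ fun x hx => hB k x (hsub k hx))
  have e1 : (δ k)⁻¹ * ∫ x in (p k)..(p k + δ k), h k x = l +
      (δ k)⁻¹ * ∫ x in (p k)..(p k + δ k), (h k x - l) := by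
    rw [intervalIntegral.integral_sub hint (by simp), intervalIntegral.integral_const]
    have := (hδ0 k).ne'
    field_simp
    simp
  rw [e1, Real.dist_eq, add_sub_cancel_left, abs_mul, abs_of_pos (inv_pos.2 (hδ0 k))]
  have e2 : |∫ x in (p k)..(p k + δ k), (h k x - l)| ≤ ε / 2 * |p k + δ k - p k| := by
    rw [← Real.norm_eq_abs]
    refine intervalIntegral.norm_integral_le_of_norm_le_const_ae ?_
    filter_upwards [Measure.ae_ne volume (p k + δ k)] with x hx1 hx
    rw [uIoc_of_le hle] at hx
    exact hn k hk x ⟨hx.1, lt_of_le_of_ne hx.2 hx1⟩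
  rw [add_sub_cancel_left, abs_of_pos (hδ0 k)] at e2
  calc (δ k)⁻¹ * |∫ x in (p k)..(p k + δ k), (h k x - l)|
      ≤ (δ k)⁻¹ * (ε / 2 * δ k) := mul_le_mul_of_nonneg_left e2 (inv_pos.2 (hδ0 k)).le
    _ = ε / 2 := by have := (hδ0 k).ne'; field_simp
    _ < ε := by linarith

/-- Weak convergence of difference quotients. -/
theorem tendsto_integral_difference_quotient {a C B E L : ℝ} {δ : ℕ → ℝ}
    (hδ0 : ∀ k, 0 < δ k) (hδ1 : ∀ k, δ k ≤ 1) (hδ : Tendsto δ atTop (𝓝 0)) {e : ℕ → ℝ → ℝ}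
    {g : ℝ → ℝ} {Kg : NNReal} (hg : LipschitzWith Kg g)
    (hm : ∀ k, AEStronglyMeasurable (e k) (volume.restrict (Ioo a (a + 1))))
    (hE : ∀ k, ∀ x ∈ Ioo a (a + 1), |e k x| ≤ E)
    (hlip : ∀ k, ∀ x ∈ Ioo a (a + 1), ∀ y ∈ Ioo a (a + 1), |e k x - e k y| ≤ C * (|x - y| + δ k))
    (hlim : ∀ᵐ x ∂volume.restrict (Ioo a (a + 1)), Tendsto (fun k => e k x) atTop (𝓝 (g x)))
    {η : ℝ → ℝ} (hη : ContDiff ℝ 1 η) (hB : ∀ x, |η x| ≤ B) (hL : ∀ x y, |η x - η y| ≤ L * |x - y|) :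
    Tendsto (fun k => ∫ x in (a + δ k)..(a + 1), (e k x - e k (x - δ k)) / δ k * η x) atTop
      (𝓝 (∫ x in a..(a + 1), deriv g x * η x)) := by
  have hηc := hη.continuous
  have hE0 : 0 ≤ E := (abs_nonneg _).trans (hE 0 (a + 1 / 2) ⟨by linarith, by linarith⟩)
  have hB0 : 0 ≤ B := (abs_nonneg _).trans (hB 0)
  have hI : ∀ k (ξ : ℝ → ℝ) (B' : ℝ), Continuous ξ → (∀ x, |ξ x| ≤ B') →
      IntegrableOn (fun x => e k x * ξ x) (Ioo a (a + 1)) := by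
    intro k ξ B' hξ hξB
    refine IntegrableOn.of_bound (C := E * B') (by simp) ((hm k).mul hξ.aestronglyMeasurable) ?_
    refine (ae_restrict_iff' measurableSet_Ioo).2 (ae_of_all _ fun x hx => ?_)
    rw [norm_mul]
    exact mul_le_mul (hE k x hx) (hξB x) (norm_nonneg _) hE0
  have hII : ∀ k (ξ : ℝ → ℝ) (B' : ℝ), Continuous ξ → (∀ x, |ξ x| ≤ B') → ∀ p ∈ Icc a (a + 1),
      ∀ q ∈ Icc a (a + 1), IntervalIntegrable (fun x => e k x * ξ x) volume p q := by
    intro k ξ B' hξ hξB p hp q hq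
    have h := hI k ξ B' hξ hξB
    rw [← intervalIntegrable_iff_integrableOn_Ioo_of_le (by linarith)] at h
    exact h.mono_set (by rw [uIcc_of_le (by linarith : a ≤ a + 1)]; exact uIcc_subset_Icc hp hq)
  have hmem0 : a ∈ Icc a (a + 1) := ⟨le_rfl, by linarith⟩
  have hmem1 : a + 1 ∈ Icc a (a + 1) := ⟨by linarith, le_rfl⟩
  -- A shift by `δ k` moves the difference quotient onto `η`. What is left over are means over
  -- strips of width `δ k` at the two ends, which become the boundary terms.
  have hsplit : ∀ k, ∫ x in (a + δ k)..(a + 1), (e k x - e k (x - δ k)) / δ k * η x =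
      -(∫ x in Ioo a (a + 1), e k x * ((η (x + δ k) - η x) / δ k)) -
      (δ k)⁻¹ * (∫ x in a..(a + δ k), e k x * η x) +
      (δ k)⁻¹ * ∫ x in (a + 1 - δ k)..(a + 1 - δ k + δ k), e k x * η (x + δ k) := by
    intro k
    have hk0 := hδ0 k
    have hk1 := hδ1 k
    have hmd : a + δ k ∈ Icc a (a + 1) := ⟨by linarith, by linarith⟩
    have hmd' : a + 1 - δ k ∈ Icc a (a + 1) := ⟨by linarith, by linarith⟩
    have hηs : Continuous fun x => η (x + δ k) := by fun_prop
    have hηsB : ∀ x, |η (x + δ k)| ≤ B := fun x => hB _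
    have i1 := hII k η B hηc hB
    have i2 := hII k (fun x => η (x + δ k)) B hηs hηsB
    have e1 : ∫ x in (a + δ k)..(a + 1), e k (x - δ k) * η x =
        ∫ x in a..(a + 1 - δ k), e k x * η (x + δ k) := by
      have := intervalIntegral.integral_comp_sub_right (a := a + δ k) (b := a + 1)
        (fun x => e k x * η (x + δ k)) (δ k)
      simp only [sub_add_cancel, add_sub_cancel_right] at this
      exact this
    have i3 : IntervalIntegrable (fun x => e k (x - δ k) * η x) volume (a + δ k) (a + 1) := by
      have := (i2 a hmem0 (a + 1 - δ k) hmd').comp_sub_right (δ k)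
      simpa using this
    have e2 : ∫ x in (a + δ k)..(a + 1), (e k x - e k (x - δ k)) / δ k * η x =
        (δ k)⁻¹ * ((∫ x in (a + δ k)..(a + 1), e k x * η x) -
          ∫ x in (a + δ k)..(a + 1), e k (x - δ k) * η x) := by
      rw [← intervalIntegral.integral_sub (i1 _ hmd _ hmem1) i3,
        ← intervalIntegral.integral_const_mul]
      refine intervalIntegral.integral_congr fun x _ => ?_
      ring
    have e3 : ∫ x in Ioo a (a + 1), e k x * ((η (x + δ k) - η x) / δ k) =
        (δ k)⁻¹ * ((∫ x in a..(a + 1), e k x * η (x + δ k)) - ∫ x in a..(a + 1), e k x * η x) := by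
      rw [← intervalIntegral.integral_sub (i2 _ hmem0 _ hmem1) (i1 _ hmem0 _ hmem1),
        ← intervalIntegral.integral_const_mul, intervalIntegral.integral_of_le (by linarith),
        integral_Ioc_eq_integral_Ioo]
      refine integral_congr_ae (ae_of_all _ fun x => ?_)
      ring
    have e4 := intervalIntegral.integral_add_adjacent_intervals (i1 a hmem0 _ hmd)
      (i1 _ hmd _ hmem1)
    have e5 := intervalIntegral.integral_add_adjacent_intervals (i2 a hmem0 _ hmd')
      (i2 _ hmd' _ hmem1)
    rw [e2, e1, e3, sub_add_cancel, ← e4, ← e5]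
    ring
  have hcont : ∀ x : ℕ → ℝ, (∀ k, x k ∈ Ioo a (a + 1)) → ∀ z, Tendsto x atTop (𝓝 z) →
      Tendsto (fun k => e k (x k)) atTop (𝓝 (g z)) := fun x hx z hxz =>
    tendsto_of_asymptotically_lipschitz hδ hg.continuous hlip hlim hx hxz
  have t1 : Tendsto (fun k => ∫ x in Ioo a (a + 1), e k x * ((η (x + δ k) - η x) / δ k)) atTop
      (𝓝 (∫ x in Ioo a (a + 1), g x * deriv η x)) := by
    refine tendsto_integral_of_dominated_convergence (fun _ => E * L) (fun k => ?_)
      (integrable_const _) (fun k => ?_) ?_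
    · refine (hm k).mul (Continuous.aestronglyMeasurable ?_)
      fun_prop
    · refine (ae_restrict_iff' measurableSet_Ioo).2 (ae_of_all _ fun x hx => ?_)
      rw [norm_mul, norm_div]
      refine mul_le_mul (hE k x hx) ?_ (by positivity) hE0
      rw [Real.norm_eq_abs, Real.norm_eq_abs, abs_of_pos (hδ0 k), div_le_iff₀ (hδ0 k)]
      have := hL (x + δ k) x
      rwa [add_sub_cancel_left, abs_of_pos (hδ0 k)] at this
    · filter_upwards [hlim] with x hx
      refine hx.mul ?_
      have hd := (hη.differentiable one_ne_zero x).hasDerivAt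
      have hslope := hasDerivAt_iff_tendsto_slope_zero.1 hd
      have hδ' : Tendsto δ atTop (𝓝[≠] 0) :=
        tendsto_nhdsWithin_iff.2 ⟨hδ, Eventually.of_forall fun k => (hδ0 k).ne'⟩
      refine (hslope.comp hδ').congr fun k => ?_
      simp only [Function.comp, smul_eq_mul]
      ring
  have t2 : Tendsto (fun k => (δ k)⁻¹ * ∫ x in a..(a + δ k), e k x * η x) atTop
      (𝓝 (g a * η a)) := by
    refine tendsto_integral_shrinking (a := a) (b := a + 1) (z := a) (B := E * B) hδ0 hδ
      tendsto_const_nhds (fun k => Ioo_subset_Ioo le_rfl (by linarith [hδ1 k]))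
      (fun k => (hm k).mul hηc.aestronglyMeasurable) (fun k x hx => ?_) fun x hx hxz => ?_
    · rw [abs_mul]
      exact mul_le_mul (hE k x hx) (hB x) (abs_nonneg _) hE0
    · exact (hcont x hx a hxz).mul ((hηc.tendsto a).comp hxz)
  have t3 : Tendsto (fun k => (δ k)⁻¹ * ∫ x in (a + 1 - δ k)..(a + 1 - δ k + δ k),
      e k x * η (x + δ k)) atTop (𝓝 (g (a + 1) * η (a + 1))) := by
    refine tendsto_integral_shrinking (a := a) (b := a + 1) (z := a + 1) (B := E * B) hδ0 hδ
      (by simpa using hδ.const_sub (a + 1))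
      (fun k => Ioo_subset_Ioo (by linarith [hδ1 k]) (by linarith))
      (fun k => (hm k).mul (Continuous.aestronglyMeasurable (by fun_prop)))
      (fun k x hx => ?_) fun x hx hxz => ?_
    · rw [abs_mul]
      exact mul_le_mul (hE k x hx) (hB _) (abs_nonneg _) hE0
    · refine (hcont x hx _ hxz).mul ((hηc.tendsto (a + 1)).comp ?_)
      simpa using hxz.add hδ
  have hfin := (t1.neg.sub t2).add t3
  refine (hfin.congr fun k => (hsplit k).symm).trans (le_of_eq ?_)
  congr 1
  -- The boundary terms of the limit are precisely those of the integration by parts for the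
  -- absolutely continuous `g`.
  have hgac : AbsolutelyContinuousOnInterval g a (a + 1) :=
    (hg.lipschitzOnWith).absolutelyContinuousOnInterval
  have hηac : AbsolutelyContinuousOnInterval η a (a + 1) := by
    refine (LipschitzWith.of_dist_le_mul (K := L.toNNReal) fun x y => ?_).lipschitzOnWith
      |>.absolutelyContinuousOnInterval
    rw [Real.dist_eq, Real.dist_eq]
    exact (hL x y).trans (mul_le_mul_of_nonneg_right (Real.le_coe_toNNReal L) (abs_nonneg _))
  have hibp := hgac.integral_mul_deriv_eq_deriv_mul hηac
  rw [← integral_Ioc_eq_integral_Ioo, ← intervalIntegral.integral_of_le (by linarith), hibp]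
  ring

namespace Problem

/-- Convergence, at a fixed time, of discrete solutions on the layer `(a, a + 1)`. -/
structure LayerConvergence (P : Problem) (i : Fin 2) (a C : ℝ) (N : ℕ → ℕ) (S : ℕ → ℝ → ℝ)
    (s : ℝ → ℝ) : Prop where
  C_nonneg : 0 ≤ C
  pos : ∀ k, 0 < N k
  tendsto_N : Tendsto N atTop atTop
  meas : ∀ k, Measurable (S k)
  mem : ∀ k, ∀ x ∈ Ioo a (a + 1), S k x ∈ Icc (0 : ℝ) 1
  lip : ∀ k, ∀ x ∈ Ioo a (a + 1), ∀ y ∈ Ioo a (a + 1),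
    |P.phi i (S k x) - P.phi i (S k y)| ≤ C * (|x - y| + 1 / N k)
  conv : ∀ᵐ x ∂volume.restrict (Ioo a (a + 1)), Tendsto (fun k => S k x) atTop (𝓝 (s x))

/-- `g` is the Lipschitz continuous representative of `φ_i ∘ s` on `(a, a + 1)`. -/
structure IsLipschitzRep (P : Problem) (i : Fin 2) (a C : ℝ) (s g : ℝ → ℝ) : Prop where
  lip : LipschitzWith C.toNNReal g
  mem : ∀ᵐ x ∂volume.restrict (Ioo a (a + 1)), s x ∈ Icc (0 : ℝ) 1
  eq : ∀ᵐ x ∂volume.restrict (Ioo a (a + 1)), P.phi i (s x) = g x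

variable {P : Problem} {i : Fin 2} {a C : ℝ} {N : ℕ → ℕ} {S : ℕ → ℝ → ℝ} {s g : ℝ → ℝ}

theorem LayerConvergence.tendsto_mesh (h : LayerConvergence P i a C N S s) :
    Tendsto (fun k => 1 / (N k : ℝ)) atTop (𝓝 0) := by
  have := tendsto_one_div_atTop_nhds_zero_nat (𝕜 := ℝ)
  exact this.comp h.tendsto_N

theorem LayerConvergence.mesh_pos (h : LayerConvergence P i a C N S s) (k : ℕ) :
    0 < 1 / (N k : ℝ) := one_div_pos.2 (by exact_mod_cast h.pos k)

theorem LayerConvergence.mesh_le_one (h : LayerConvergence P i a C N S s) (k : ℕ) :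
    1 / (N k : ℝ) ≤ 1 := by
  rw [div_le_one (by exact_mod_cast h.pos k)]
  exact_mod_cast h.pos k

theorem LayerConvergence.conv_phi (h : LayerConvergence P i a C N S s) :
    ∀ᵐ x ∂volume.restrict (Ioo a (a + 1)), s x ∈ Icc (0 : ℝ) 1 ∧
      Tendsto (fun k => P.phi i (S k x)) atTop (𝓝 (P.phi i (s x))) := by
  filter_upwards [h.conv, ae_restrict_mem measurableSet_Ioo] with x hx hxI
  have hmem : s x ∈ Icc (0 : ℝ) 1 :=
    isClosed_Icc.mem_of_tendsto hx (Eventually.of_forall fun k => h.mem k x hxI)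
  exact ⟨hmem, (P.phi_continuousOn i _ hmem).tendsto.comp
    (tendsto_nhdsWithin_iff.2 ⟨hx, Eventually.of_forall fun k => h.mem k x hxI⟩)⟩

/-- The mesh error in the discrete Lipschitz bound disappears in the limit, so `φ_i ∘ s` is
Lipschitz on the convergence set and extends from there to the whole line. -/
theorem LayerConvergence.exists_rep (h : LayerConvergence P i a C N S s) :
    ∃ g, IsLipschitzRep P i a C s g := by
  set A : Set ℝ := {x | x ∈ Ioo a (a + 1) ∧
    Tendsto (fun k => P.phi i (S k x)) atTop (𝓝 (P.phi i (s x)))} with hA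
  have hlip : LipschitzOnWith C.toNNReal (fun x => P.phi i (s x)) A := by
    refine LipschitzOnWith.of_dist_le_mul fun x hx y hy => ?_
    rw [Real.coe_toNNReal _ h.C_nonneg, Real.dist_eq, Real.dist_eq]
    have h1 : Tendsto (fun k => C * (|x - y| + 1 / N k)) atTop (𝓝 (C * (|x - y| + 0))) :=
      (h.tendsto_mesh.const_add _).const_mul C
    rw [add_zero] at h1
    exact le_of_tendsto_of_tendsto (hx.2.sub hy.2).abs h1
      (Eventually.of_forall fun k => h.lip k x hx.1 y hy.1)
  obtain ⟨g, hg, hgA⟩ := hlip.extend_real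
  refine ⟨g, hg, h.conv_phi.mono fun x hx => hx.1, ?_⟩
  filter_upwards [h.conv_phi, ae_restrict_mem measurableSet_Ioo] with x hx hxI
  exact hgA ⟨hxI, hx.2⟩

/-- The uniformly continuous inverse of `φ_i` in the form used for limits. -/
theorem tendsto_of_phi_tendsto {α : Type*} {l : Filter α} {u : α → ℝ} {σ : ℝ}
    (hu : ∀ᶠ x in l, u x ∈ Icc (0 : ℝ) 1) (hσ : σ ∈ Icc (0 : ℝ) 1)
    (h : Tendsto (fun x => P.phi i (u x)) l (𝓝 (P.phi i σ))) : Tendsto u l (𝓝 σ) := by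
  rw [Metric.tendsto_nhds]
  intro ε hε
  obtain ⟨η, hη0, hη⟩ := P.toRock.exists_phi_modulus (ε := ε / 2) (by positivity)
  filter_upwards [hu, (Metric.tendsto_nhds.1 h) η hη0] with x hx hx'
  rw [Real.dist_eq] at hx' ⊢
  linarith [hη i _ hx _ hσ hx'.le]

/-- Traces of the limit. -/
theorem IsLipschitzRep.exists_trace (hg : IsLipschitzRep P i a C s g) {z : ℝ}
    (hz : z ∈ Icc a (a + 1)) : ∃ σ ∈ Icc (0 : ℝ) 1, P.phi i σ = g z ∧
      HasTrace (Ioo a (a + 1)) z s σ := by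
  have hcl : z ∈ closure (Ioo a (a + 1)) := by rwa [closure_Ioo (by linarith)]
  have := neBot_nhdsWithin_inf_ae isOpen_Ioo hcl
  have hev : ∀ᶠ y in 𝓝[Ioo a (a + 1)] z ⊓ ae volume, s y ∈ Icc (0 : ℝ) 1 ∧
      P.phi i (s y) = g y := by
    have h1 : ∀ᶠ y in 𝓝[Ioo a (a + 1)] z ⊓ ae volume, y ∈ Ioo a (a + 1) :=
      mem_inf_of_left self_mem_nhdsWithin
    have h2 : ∀ᶠ y in 𝓝[Ioo a (a + 1)] z ⊓ ae volume, y ∈ Ioo a (a + 1) →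
        s y ∈ Icc (0 : ℝ) 1 :=
      mem_inf_of_right ((ae_restrict_iff' measurableSet_Ioo).1 hg.mem)
    have h3 : ∀ᶠ y in 𝓝[Ioo a (a + 1)] z ⊓ ae volume, y ∈ Ioo a (a + 1) → P.phi i (s y) = g y :=
      mem_inf_of_right ((ae_restrict_iff' measurableSet_Ioo).1 hg.eq)
    filter_upwards [h1, h2, h3] with y e1 e2 e3 using ⟨e2 e1, e3 e1⟩
  have hgz : Tendsto (fun y => P.phi i (s y)) (𝓝[Ioo a (a + 1)] z ⊓ ae volume) (𝓝 (g z)) := by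
    refine ((hg.lip.continuous.tendsto z).mono_left
      (inf_le_left.trans nhdsWithin_le_nhds)).congr' ?_
    filter_upwards [hev] with y hy using hy.2.symm
  -- The range of `φ_i` is closed, so the boundary value of the Lipschitz representative is `φ_i` of
  -- a saturation.
  have hcompact : IsClosed (P.phi i '' Icc 0 1) :=
    (isCompact_Icc.image_of_continuousOn (P.phi_continuousOn i)).isClosed
  obtain ⟨σ, hσ, hσz⟩ := hcompact.mem_of_tendsto hgz
    (hev.mono fun y hy => mem_image_of_mem _ hy.1)
  refine ⟨σ, hσ, hσz, tendsto_of_phi_tendsto (P := P) (i := i) (hev.mono fun y hy => hy.1) hσ ?_⟩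
  rwa [hσz]

/-- The spatial bounds, uniform in `k`, upgrade almost everywhere convergence to convergence at
points that move towards `z`, even when `z` is an end point. An error of one mesh width in `φ_i` is
harmless. -/
theorem LayerConvergence.tendsto_trace (h : LayerConvergence P i a C N S s)
    (hg : IsLipschitzRep P i a C s g) {z σ : ℝ} (hσ : σ ∈ Icc (0 : ℝ) 1) (hσz : P.phi i σ = g z)
    {x : ℕ → ℝ} (hx : ∀ k, x k ∈ Ioo a (a + 1)) (hxz : Tendsto x atTop (𝓝 z)) {u : ℕ → ℝ}
    (hu : ∀ k, u k ∈ Icc (0 : ℝ) 1)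
    (hclose : ∀ k, |P.phi i (u k) - P.phi i (S k (x k))| ≤ C * (1 / N k)) :
    Tendsto u atTop (𝓝 σ) := by
  have h1 : Tendsto (fun k => P.phi i (S k (x k))) atTop (𝓝 (g z)) := by
    refine tendsto_of_asymptotically_lipschitz (e := fun k x => P.phi i (S k x)) h.tendsto_mesh
      hg.lip.continuous h.lip ?_ hx hxz
    filter_upwards [h.conv_phi, hg.eq] with y hy hy'
    rw [← hy']; exact hy.2
  refine tendsto_of_phi_tendsto (P := P) (i := i) (Eventually.of_forall hu) hσ ?_
  rw [hσz]
  have h2 : Tendsto (fun k => P.phi i (u k) - P.phi i (S k (x k))) atTop (𝓝 0) := by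
    refine squeeze_zero_norm hclose ?_
    simpa using h.tendsto_mesh.const_mul C
  simpa using h2.add h1

/-- The convective part converges pointwise, whereas the difference quotients of `φ_i` are bounded
and converge only weakly. Replacing the difference quotient of `ψ` by `ψ'` in front of them costs
`O(1/N)`. -/
theorem LayerConvergence.tendsto_flux (h : LayerConvergence P i a C N S s)
    (hg : IsLipschitzRep P i a C s g) {ψ : ℝ → ℝ} (hψ : ContDiff ℝ 2 ψ) {B L : ℝ}
    (hB : ∀ x, |deriv ψ x| ≤ B) (hL : ∀ x y, |deriv ψ x - deriv ψ y| ≤ L * |x - y|) :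
    Tendsto (fun k => ∫ x in (a + 1 / N k)..(a + 1), P.cellFlux (N k) i (S k (x - 1 / N k)) (S k x)
      * ((ψ x - ψ (x - 1 / N k)) / (1 / N k))) atTop
      (𝓝 (∫ x in Ioo a (a + 1), (P.f i (s x) - deriv g x) * deriv ψ x)) := by
  set δ : ℕ → ℝ := fun k => 1 / (N k : ℝ) with hδdef
  have hδ0 : ∀ k, 0 < δ k := h.mesh_pos
  have hδ1 : ∀ k, δ k ≤ 1 := h.mesh_le_one
  have hδ : Tendsto δ atTop (𝓝 0) := h.tendsto_mesh
  have hC := h.C_nonneg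
  have hB0 : 0 ≤ B := (abs_nonneg _).trans (hB 0)
  have hL0 : 0 ≤ L := by
    have := hL 1 0
    rw [sub_zero, abs_one, mul_one] at this
    exact (abs_nonneg _).trans this
  have hψd : Differentiable ℝ ψ := hψ.differentiable two_ne_zero
  have hψ1 : ContDiff ℝ 1 (deriv ψ) := by
    have : ContDiff ℝ (1 + 1) ψ := by rw [one_add_one_eq_two]; exact hψ
    exact (contDiff_succ_iff_deriv.1 this).2.2
  have hψc := hψ.continuous
  have hψ1c := hψ1.continuous
  obtain ⟨BG, hBG0, hBG⟩ := P.exists_G_bound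
  obtain ⟨Bφ, hBφ⟩ := isCompact_Icc.exists_bound_of_continuousOn (P.phi_continuousOn i)
  obtain ⟨KG, hKG⟩ := P.G_lipschitz i
  set ζ : ℕ → ℝ → ℝ := fun k x => (ψ x - ψ (x - δ k)) / δ k with hζ
  have hζc : ∀ k, Continuous (ζ k) := fun k => by simp only [hζ]; fun_prop
  have hζd : ∀ k x, ∃ ξ, |ξ - x| ≤ δ k ∧ ζ k x = deriv ψ ξ := by
    intro k x
    obtain ⟨ξ, hξ, hξ'⟩ := exists_deriv_eq_slope ψ (a := x - δ k) (b := x) (by linarith [hδ0 k])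
      hψc.continuousOn hψd.differentiableOn
    refine ⟨ξ, ?_, ?_⟩
    · rw [abs_le]; constructor <;> linarith [hξ.1, hξ.2, hδ0 k]
    · rw [hξ', sub_sub_cancel]
  have hζB : ∀ k x, |ζ k x| ≤ B := fun k x => by
    obtain ⟨ξ, -, h2⟩ := hζd k x
    rw [h2]; exact hB ξ
  have hζL : ∀ k x, |ζ k x - deriv ψ x| ≤ L * δ k := fun k x => by
    obtain ⟨ξ, h1, h2⟩ := hζd k x
    rw [h2]
    exact (hL ξ x).trans (mul_le_mul_of_nonneg_left h1 hL0)
  have hmem' : ∀ k, ∀ x ∈ Ioo (a + δ k) (a + 1), x ∈ Ioo a (a + 1) ∧ x - δ k ∈ Ioo a (a + 1) :=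
    fun k x hx => ⟨⟨by linarith [hx.1, hδ0 k], hx.2⟩, ⟨by linarith [hx.1], by linarith [hx.2, hδ0 k]⟩⟩
  set Q : ℕ → ℝ → ℝ := fun k x => (P.phi i (S k x) - P.phi i (S k (x - δ k))) / δ k with hQ
  have hQB : ∀ k, ∀ x ∈ Ioo (a + δ k) (a + 1), |Q k x| ≤ 2 * C := by
    intro k x hx
    obtain ⟨h1, h2⟩ := hmem' k x hx
    have := h.lip k x h1 _ h2
    rw [sub_sub_cancel, abs_of_pos (hδ0 k)] at this
    simp only [hQ]
    rw [abs_div, abs_of_pos (hδ0 k), div_le_iff₀ (hδ0 k)]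
    refine this.trans (le_of_eq ?_)
    simp only [hδdef]
    ring
  have hφm : ∀ k, AEStronglyMeasurable (fun x => P.phi i (S k x))
      (volume.restrict (Ioo a (a + 1))) := fun k =>
    P.aestronglyMeasurable_phi_comp i (h.meas k).aestronglyMeasurable
      ((ae_restrict_iff' measurableSet_Ioo).2 (ae_of_all _ (h.mem k)))
  have hSm' : ∀ k, Measurable fun x => S k (x - δ k) := fun k =>
    (h.meas k).comp (measurable_id.sub_const _)
  have hIm : ∀ k, ∀ᵐ x ∂volume.restrict (Ioo (a + δ k) (a + 1)), S k x ∈ Icc (0 : ℝ) 1 := fun k =>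
    (ae_restrict_iff' measurableSet_Ioo).2 (ae_of_all _ fun x hx => h.mem k x (hmem' k x hx).1)
  have hIm' : ∀ k, ∀ᵐ x ∂volume.restrict (Ioo (a + δ k) (a + 1)),
      S k (x - δ k) ∈ Icc (0 : ℝ) 1 := fun k =>
    (ae_restrict_iff' measurableSet_Ioo).2 (ae_of_all _ fun x hx => h.mem k _ (hmem' k x hx).2)
  have hQm : ∀ k, AEStronglyMeasurable (Q k) (volume.restrict (Ioo (a + δ k) (a + 1))) := fun k =>
    ((P.aestronglyMeasurable_phi_comp i (h.meas k).aestronglyMeasurable (hIm k)).sub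
      (P.aestronglyMeasurable_phi_comp i (hSm' k).aestronglyMeasurable (hIm' k))).aemeasurable.div_const
        _ |>.aestronglyMeasurable
  have hGm : ∀ k, AEStronglyMeasurable (fun x => P.G i (S k (x - δ k)) (S k x))
      (volume.restrict (Ioo (a + δ k) (a + 1))) := fun k =>
    aestronglyMeasurable_comp_uncurry hKG.continuousOn (hSm' k).aestronglyMeasurable
      (h.meas k).aestronglyMeasurable (hIm' k) (hIm k)
  -- The part handled by dominated convergence: the convective flux, and the error made in
  -- exchanging the two derivatives of `ψ`.
  set R : ℕ → ℝ → ℝ := fun k x => P.G i (S k (x - δ k)) (S k x) * ζ k x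
    - Q k x * (ζ k x - deriv ψ x) with hR
  have hRm : ∀ k, AEStronglyMeasurable (R k) (volume.restrict (Ioo (a + δ k) (a + 1))) := fun k =>
    ((hGm k).mul (hζc k).aestronglyMeasurable).sub
      ((hQm k).mul ((hζc k).sub hψ1c).aestronglyMeasurable)
  have hRB : ∀ k, ∀ x ∈ Ioo (a + δ k) (a + 1), |R k x| ≤ BG * B + 2 * C * L := by
    intro k x hx
    obtain ⟨h1, h2⟩ := hmem' k x hx
    refine (abs_sub _ _).trans (add_le_add ?_ ?_)
    · rw [abs_mul]
      exact mul_le_mul (hBG _ _ (h.mem k _ h2) _ (h.mem k _ h1)) (hζB k x) (abs_nonneg _) hBG0.le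
    · rw [abs_mul]
      refine mul_le_mul (hQB k x hx) ((hζL k x).trans ?_) (abs_nonneg _) (by positivity)
      exact mul_le_of_le_one_right hL0 (hδ1 k)
  have hle : ∀ k, a + δ k ≤ a + 1 := fun k => by linarith [hδ1 k]
  have hRi : ∀ k, IntervalIntegrable (R k) volume (a + δ k) (a + 1) := fun k => by
    rw [intervalIntegrable_iff_integrableOn_Ioo_of_le (hle k)]
    exact IntegrableOn.of_bound (C := BG * B + 2 * C * L) (by simp) (hRm k)
      ((ae_restrict_iff' measurableSet_Ioo).2 (ae_of_all _ (hRB k)))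
  have hQi : ∀ k, IntervalIntegrable (fun x => Q k x * deriv ψ x) volume (a + δ k) (a + 1) :=
    fun k => by
    rw [intervalIntegrable_iff_integrableOn_Ioo_of_le (hle k)]
    refine IntegrableOn.of_bound (C := 2 * C * B) (by simp)
      ((hQm k).mul hψ1c.aestronglyMeasurable)
      ((ae_restrict_iff' measurableSet_Ioo).2 (ae_of_all _ fun x hx => ?_))
    rw [norm_mul]
    exact mul_le_mul (hQB k x hx) (hB x) (norm_nonneg _) (by positivity)
  have hsplit : ∀ k, ∫ x in (a + 1 / N k)..(a + 1), P.cellFlux (N k) i (S k (x - 1 / N k)) (S k x)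
      * ((ψ x - ψ (x - 1 / N k)) / (1 / N k)) =
      (∫ x in Ioo a (a + 1), (Ioo (a + δ k) (a + 1)).indicator (R k) x) -
        ∫ x in (a + δ k)..(a + 1), Q k x * deriv ψ x := by
    intro k
    have e1 : ∫ x in Ioo a (a + 1), (Ioo (a + δ k) (a + 1)).indicator (R k) x =
        ∫ x in (a + δ k)..(a + 1), R k x := by
      rw [intervalIntegral.integral_of_le (hle k), integral_Ioc_eq_integral_Ioo,
        setIntegral_indicator measurableSet_Ioo, inter_eq_self_of_subset_right]
      exact fun x hx => (hmem' k x hx).1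
    rw [e1, ← intervalIntegral.integral_sub (hRi k) (hQi k)]
    refine intervalIntegral.integral_congr fun x _ => ?_
    simp only [hR, hQ, hζ, cellFlux]
    ring
  have t1 : Tendsto (fun k => ∫ x in Ioo a (a + 1), (Ioo (a + δ k) (a + 1)).indicator (R k) x)
      atTop (𝓝 (∫ x in Ioo a (a + 1), P.f i (s x) * deriv ψ x)) := by
    refine tendsto_integral_of_dominated_convergence (fun _ => BG * B + 2 * C * L) (fun k => ?_)
      (integrable_const _) (fun k => ae_of_all _ fun x => ?_) ?_
    · exact ((aestronglyMeasurable_indicator_iff measurableSet_Ioo).2 (hRm k)).restrict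
    · by_cases hx : x ∈ Ioo (a + δ k) (a + 1)
      · rw [indicator_of_mem hx]; exact hRB k x hx
      · rw [indicator_of_notMem hx, norm_zero]; positivity
    · filter_upwards [h.conv, h.conv_phi, ae_restrict_mem measurableSet_Ioo] with x hx1 hx2 hxI
      have hev : ∀ᶠ k in atTop, x ∈ Ioo (a + δ k) (a + 1) := by
        filter_upwards [hδ.eventually_lt_const (u := x - a) (by linarith [hxI.1])] with k hk
        exact ⟨by linarith, hxI.2⟩
      have hsm := hx2.1
      -- The evaluation point moves with `k`; the bound on `φ_i` shows that a shift by one cell does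
      -- not change the limit.
      have hS' : Tendsto (fun k => S k (x - δ k)) atTop (𝓝 (s x)) := by
        refine tendsto_of_phi_tendsto (P := P) (i := i) ?_ hsm ?_
        · filter_upwards [hev] with k hk using h.mem k _ (hmem' k x hk).2
        · have h0 : Tendsto (fun k => P.phi i (S k (x - δ k)) - P.phi i (S k x)) atTop (𝓝 0) := by
            have hz : Tendsto (fun k => 2 * C * δ k) atTop (𝓝 0) := by
              simpa using hδ.const_mul (2 * C)
            refine squeeze_zero_norm' ?_ hz
            filter_upwards [hev] with k hk
            obtain ⟨h1, h2⟩ := hmem' k x hk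
            have := h.lip k _ h2 x h1
            rw [sub_sub_cancel_left, abs_neg, abs_of_pos (hδ0 k)] at this
            refine this.trans (le_of_eq ?_)
            simp only [hδdef]
            ring
          simpa using h0.add hx2.2
      have hGt : Tendsto (fun k => P.G i (S k (x - δ k)) (S k x)) atTop (𝓝 (P.f i (s x))) := by
        rw [← P.G_diag i _ hsm]
        have hc := hKG.continuousOn (s x, s x) ⟨hsm, hsm⟩
        refine hc.tendsto.comp (tendsto_nhdsWithin_iff.2 ⟨hS'.prodMk_nhds hx1, ?_⟩)
        filter_upwards [hev] with k hk
        exact ⟨h.mem k _ (hmem' k x hk).2, h.mem k _ (hmem' k x hk).1⟩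
      have hζ0 : Tendsto (fun k => ζ k x - deriv ψ x) atTop (𝓝 0) := by
        have hz : Tendsto (fun k => L * δ k) atTop (𝓝 0) := by simpa using hδ.const_mul L
        exact squeeze_zero_norm (fun k => hζL k x) hz
      have hζt : Tendsto (fun k => ζ k x) atTop (𝓝 (deriv ψ x)) := by
        simpa using hζ0.add_const (deriv ψ x)
      have hQ0 : Tendsto (fun k => Q k x * (ζ k x - deriv ψ x)) atTop (𝓝 0) := by
        have hz : Tendsto (fun k => 2 * C * (L * δ k)) atTop (𝓝 0) := by
          simpa using (hδ.const_mul L).const_mul (2 * C)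
        refine squeeze_zero_norm' ?_ hz
        filter_upwards [hev] with k hk
        rw [norm_mul]
        exact mul_le_mul (hQB k x hk) (hζL k x) (norm_nonneg _) (by positivity)
      have hfin := (hGt.mul hζt).sub hQ0
      rw [sub_zero] at hfin
      refine hfin.congr' ?_
      filter_upwards [hev] with k hk
      rw [indicator_of_mem hk]
  have t2 : Tendsto (fun k => ∫ x in (a + δ k)..(a + 1), Q k x * deriv ψ x) atTop
      (𝓝 (∫ x in a..(a + 1), deriv g x * deriv ψ x)) := by
    refine tendsto_integral_difference_quotient (e := fun k x => P.phi i (S k x)) hδ0 hδ1 hδ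
      hg.lip hφm (fun k x hx => hBφ _ (h.mem k x hx)) h.lip ?_ hψ1 hB hL
    filter_upwards [h.conv_phi, hg.eq] with y hy hy'
    rw [← hy']; exact hy.2
  refine ((t1.sub t2).congr fun k => (hsplit k).symm).trans (le_of_eq ?_)
  congr 1
  rw [intervalIntegral.integral_of_le (by linarith), integral_Ioc_eq_integral_Ioo, ← integral_sub]
  · refine integral_congr_ae (ae_of_all _ fun x => ?_)
    simp only
    ring
  · obtain ⟨Bf, hBf⟩ := isCompact_Icc.exists_bound_of_continuousOn (P.f_continuousOn i)
    have hsm : AEStronglyMeasurable s (volume.restrict (Ioo a (a + 1))) :=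
      aestronglyMeasurable_of_tendsto_ae atTop (fun k => (h.meas k).aestronglyMeasurable) h.conv
    have hfm : AEStronglyMeasurable (fun x => P.f i (s x)) (volume.restrict (Ioo a (a + 1))) := by
      refine (aestronglyMeasurable_comp_uncurry hKG.continuousOn hsm hsm hg.mem hg.mem).congr ?_
      filter_upwards [hg.mem] with x hx using P.G_diag i _ hx
    refine IntegrableOn.of_bound (C := |Bf| * B) (by simp)
      (hfm.mul hψ1c.aestronglyMeasurable) ?_
    filter_upwards [hg.mem] with x hx
    rw [norm_mul]
    exact mul_le_mul ((hBf _ hx).trans (le_abs_self _)) (hB x) (norm_nonneg _) (abs_nonneg _)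
  · refine IntegrableOn.of_bound (C := C.toNNReal * B) (by simp)
      ((measurable_deriv g).aestronglyMeasurable.mul hψ1c.aestronglyMeasurable)
      (ae_of_all _ fun x => ?_)
    rw [norm_mul]
    exact mul_le_mul (norm_deriv_le_of_lipschitz hg.lip) (hB x) (norm_nonneg _) (NNReal.coe_nonneg _)

end Problem

/-! ### Summation by parts in space and in time. -/

theorem integral_congr_Ioo {p q : ℝ} (hpq : p ≤ q) {f g : ℝ → ℝ} (h : EqOn f g (Ioo p q)) :
    ∫ x in p..q, f x = ∫ x in p..q, g x := by
  rw [intervalIntegral.integral_of_le hpq, intervalIntegral.integral_of_le hpq,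
    integral_Ioc_eq_integral_Ioo, integral_Ioc_eq_integral_Ioo]
  exact setIntegral_congr_fun measurableSet_Ioo h

theorem intervalIntegrable_congr_Ioo {p q : ℝ} (hpq : p ≤ q) {f g : ℝ → ℝ}
    (h : EqOn f g (Ioo p q)) (hg : IntervalIntegrable g volume p q) :
    IntervalIntegrable f volume p q := by
  rw [intervalIntegrable_iff_integrableOn_Ioo_of_le hpq] at hg ⊢
  exact hg.congr_fun (fun x hx => (h hx).symm) measurableSet_Ioo

/-- Abel summation, which transfers the differences of the fluxes to the cell means of the test
function. The truncated `r - 1` occurs only for `r ≥ 1`. -/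
theorem sum_range_diff_mul {n : ℕ} (hn : 1 ≤ n) (f Ψ : ℕ → ℝ) :
    ∑ r ∈ Finset.range n, (f (r + 1) - f r) * Ψ r =
      f n * Ψ (n - 1) - f 0 * Ψ 0 - ∑ r ∈ Finset.Ico 1 n, f r * (Ψ r - Ψ (r - 1)) := by
  induction n, hn using Nat.le_induction with
  | base => simp; ring
  | succ n hn ih =>
    rw [Finset.sum_range_succ, ih, Finset.sum_Ico_succ_top hn, Nat.add_sub_cancel]
    ring

namespace Problem

variable {P : Problem} {u₀ : ℝ → ℝ} {C : ℝ} {N M : ℕ} {v : ℕ → ℤ → ℝ} {c d : ℕ → ℝ}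

theorem measurable_discreteFun (N M : ℕ) (v : ℕ → ℤ → ℝ) : Measurable (P.discreteFun N M v) := by
  have h : Measurable fun q : ℕ × ℤ => v q.1 q.2 := measurable_from_prod_countable_right fun _ => measurable_from_top
  exact h.comp ((Nat.measurable_ceil.comp (measurable_snd.div_const _)).prodMk
    (Int.measurable_floor.comp (measurable_fst.div_const _)))

theorem IsBoundedScheme.discreteFun_mem_of_le (h : IsBoundedScheme P u₀ C N M v c d) {i : Fin 2}
    {x t : ℝ} (hx : x ∈ layer i) (ht : t ≤ P.T) : P.discreteFun N M v (x, t) ∈ Icc (0 : ℝ) 1 := by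
  refine h.mem _ (Nat.ceil_le.2 ?_) _ (floor_mem_of_mem_layer h.pos_N hx).1
  have hM' : (0 : ℝ) < M := by exact_mod_cast h.pos_M
  have hT := P.T_pos
  rw [div_le_iff₀ (div_pos hT hM')]
  calc t ≤ P.T := ht
    _ = M * (P.T / M) := by field_simp

theorem floor_eq_of_mem_cell {N : ℕ} (hN : 0 < N) {a : ℝ} {j₀ : ℤ} (ha : (j₀ : ℝ) = a * N) {r : ℤ}
    {x : ℝ} (hx : x ∈ Ioo (a + r / N) (a + (r + 1) / N)) : ⌊x / (1 / (N : ℝ))⌋ = j₀ + r := by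
  have hN' : (0 : ℝ) < N := by exact_mod_cast hN
  rw [div_div_eq_mul_div, div_one, Int.floor_eq_iff]
  push_cast
  rw [ha]
  have h1 := mul_lt_mul_of_pos_right hx.1 hN'
  have h2 := mul_lt_mul_of_pos_right hx.2 hN'
  have e1 : (a + r / N) * (N : ℝ) = a * N + r := by field_simp
  have e2 : (a + (r + 1) / N) * (N : ℝ) = a * N + r + 1 := by field_simp; ring
  rw [e1] at h1
  rw [e2] at h2
  exact ⟨h1.le, h2⟩

/-- Going back one time step lowers the level by one, also from level `1` to the initial level,
since the natural ceiling of a non-positive number is `0`. -/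
theorem natCeil_sub_one {y : ℝ} {n : ℕ} (h : ⌈y⌉₊ = n + 1) : ⌈y - 1⌉₊ = n := by
  have h1 := Nat.le_ceil y
  rw [h] at h1
  push_cast at h1
  apply le_antisymm
  · rw [Nat.ceil_le]; linarith
  · rcases n with _ | n
    · exact Nat.zero_le _
    · have : n + 1 < ⌈y⌉₊ := by omega
      rw [Nat.lt_ceil] at this
      push_cast at this
      rw [Nat.add_one_le_iff, Nat.lt_ceil]
      linarith

/-- The discrete balance in one layer at a fixed time, tested with `χ`. -/
theorem IsBoundedScheme.layer_balance (h : IsBoundedScheme P u₀ C N M v c d) {i : Fin 2} {a : ℝ}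
    {j₀ : ℤ} (ha : (j₀ : ℝ) = a * N)
    (hcell : ∀ r : ℕ, r < N → j₀ + r ∈ Ico (-N : ℤ) N ∧ cellLayer (j₀ + r) = i) {t : ℝ} {n : ℕ}
    (hn : ⌈t / (P.T / M)⌉₊ = n + 1) (hnM : n < M) {χ : ℝ → ℝ} (hχ : Continuous χ) {F : ℤ → ℝ}
    (hF : F = P.flux N (P.timeMean M P.uL n) (P.timeMean M P.uR n) (v (n + 1)) (c (n + 1)))
    {Ψ : ℕ → ℝ} (hΨ : ∀ r : ℕ, Ψ r = N * ∫ x in (a + r / N)..(a + (r + 1 : ℕ) / N), χ x) :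
    ∫ x in Ioo a (a + 1), P.porosity i * ((P.discreteFun N M v (x, t) -
      P.discreteFun N M v (x, t - P.T / M)) / (P.T / M)) * χ x =
    F j₀ * Ψ 0 - F (j₀ + N) * Ψ (N - 1) + ∫ x in (a + 1 / N)..(a + 1),
      P.cellFlux N i (P.discreteFun N M v (x - 1 / N, t)) (P.discreteFun N M v (x, t)) *
        ((χ x - χ (x - 1 / N)) / (1 / N)) := by
  have hN := h.pos_N
  have hN' : (0 : ℝ) < N := by exact_mod_cast hN
  have hM' : (0 : ℝ) < M := by exact_mod_cast h.pos_M
  have hT := P.T_pos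
  have hδ : 0 < P.T / M := div_pos hT hM'
  have hn' : ⌈(t - P.T / M) / (P.T / M)⌉₊ = n := by
    rw [sub_div, div_self hδ.ne']
    exact natCeil_sub_one hn
  set p : ℕ → ℝ := fun r => a + r / N with hp
  have hp0 : p 0 = a := by simp [hp]
  have hp1 : p 1 = a + 1 / N := by simp [hp]
  have hpN : p N = a + 1 := by simp only [hp]; rw [div_self hN'.ne']
  have hple : ∀ r, p r ≤ p (r + 1) := fun r => by
    simp only [hp]
    push_cast
    gcongr
    linarith
  have hpI : ∀ r : ℕ, ∀ x, x ∈ Ioo (p r) (p (r + 1)) →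
      x ∈ Ioo (a + ((r : ℤ) : ℝ) / N) (a + (((r : ℤ) : ℝ) + 1) / N) := by
    intro r x hx
    simpa [hp] using hx
  have hpI' : ∀ r : ℕ, ∀ x, x ∈ Ioo (p r) (p (r + 1)) →
      x - 1 / N ∈ Ioo (a + (((r : ℤ) - 1 : ℤ) : ℝ) / N) (a + ((((r : ℤ) - 1 : ℤ) : ℝ) + 1) / N) := by
    intro r x hx
    have := hpI r x hx
    push_cast at this ⊢
    rw [sub_div, sub_add_cancel]
    rw [add_div] at this
    constructor <;> linarith [this.1, this.2]
  -- On the interior of each cell the balance makes the difference quotient in time a constant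
  -- multiple of a flux difference.
  have hcellint : ∀ r < N, EqOn (fun x => P.porosity i * ((P.discreteFun N M v (x, t) -
      P.discreteFun N M v (x, t - P.T / M)) / (P.T / M)) * χ x)
      (fun x => -(N * (F (j₀ + (r + 1 : ℕ)) - F (j₀ + r))) * χ x) (Ioo (p r) (p (r + 1))) := by
    intro r hr x hx
    have hfl := floor_eq_of_mem_cell hN ha (hpI r x hx)
    simp only [discreteFun, hfl, hn, hn']
    have hb := (h.step n hnM).balance (j₀ + r) (hcell r hr).1
    rw [(hcell r hr).2, ← hF] at hb
    have e : j₀ + ((r + 1 : ℕ) : ℤ) = j₀ + r + 1 := by push_cast; ring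
    have hb' : P.porosity i * ((v (n + 1) (j₀ + r) - v n (j₀ + r)) / (P.T / M)) =
        -(N * (F (j₀ + r + 1) - F (j₀ + r))) := by
      have : N * (P.porosity i * ((v (n + 1) (j₀ + r) - v n (j₀ + r)) / (P.T / M)) * (1 / N) +
        F (j₀ + r + 1) - F (j₀ + r)) = 0 := by rw [hb, mul_zero]
      have e2 : N * (P.porosity i * ((v (n + 1) (j₀ + r) - v n (j₀ + r)) / (P.T / M)) * (1 / N)) =
        P.porosity i * ((v (n + 1) (j₀ + r) - v n (j₀ + r)) / (P.T / M)) := by field_simp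
      linarith
    rw [e, hb']
  have hχi : ∀ p q : ℝ, IntervalIntegrable χ volume p q := fun p q => hχ.intervalIntegrable p q
  have e1 : ∫ x in Ioo a (a + 1), P.porosity i * ((P.discreteFun N M v (x, t) -
      P.discreteFun N M v (x, t - P.T / M)) / (P.T / M)) * χ x =
      -∑ r ∈ Finset.range N, (F (j₀ + (r + 1 : ℕ)) - F (j₀ + r)) * Ψ r := by
    rw [← integral_Ioc_eq_integral_Ioo, ← intervalIntegral.integral_of_le (by linarith)]
    nth_rewrite 1 [← hp0]
    rw [← hpN, ← intervalIntegral.sum_integral_adjacent_intervals fun r hr =>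
      intervalIntegrable_congr_Ioo (hple r) (hcellint r hr) ((hχi _ _).const_mul _),
      ← Finset.sum_neg_distrib]
    refine Finset.sum_congr rfl fun r hr => ?_
    rw [integral_congr_Ioo (hple r) (hcellint r (Finset.mem_range.1 hr)),
      intervalIntegral.integral_const_mul, hΨ]
    simp only [hp]
    ring
  -- For `r ≥ 1` the cell and its left neighbour lie in the same layer, so the face between them
  -- carries an ordinary cell flux.
  have hfl2 : ∀ r ∈ Ico 1 N, EqOn (fun x => P.cellFlux N i (P.discreteFun N M v (x - 1 / N, t))
      (P.discreteFun N M v (x, t)) * ((χ x - χ (x - 1 / N)) / (1 / N)))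
      (fun x => F (j₀ + r) * (N * (χ x - χ (x - 1 / N)))) (Ioo (p r) (p (r + 1))) := by
    intro r hr x hx
    have hfl := floor_eq_of_mem_cell hN ha (hpI r x hx)
    have hfl' := floor_eq_of_mem_cell hN ha (hpI' r x hx)
    simp only [discreteFun, hfl, hfl', hn]
    obtain ⟨h1, h2⟩ := hcell r hr.2
    obtain ⟨h3, h4⟩ := hcell (r - 1) (by have := hr.2; omega)
    have e : j₀ + ((r - 1 : ℕ) : ℤ) = j₀ + r - 1 := by have := hr.1; omega
    rw [e] at h3 h4
    have h0 : j₀ + (r : ℤ) ≠ 0 := by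
      intro h0
      rw [h0] at h2 h4
      rw [← h2] at h4
      simp [cellLayer] at h4
    have hlt : -(N : ℤ) < j₀ + r := by have := h3.1; omega
    rw [hF, P.flux_interior _ _ _ _ hlt h1.2 h0, h2, div_div_eq_mul_div, div_one,
      ← add_sub_assoc]
    ring
  have hχs : Continuous fun x => χ (x - 1 / N) := by fun_prop
  have e2 : ∫ x in (a + 1 / N)..(a + 1), P.cellFlux N i (P.discreteFun N M v (x - 1 / N, t))
      (P.discreteFun N M v (x, t)) * ((χ x - χ (x - 1 / N)) / (1 / N)) =
      ∑ r ∈ Finset.Ico 1 N, F (j₀ + r) * (Ψ r - Ψ (r - 1)) := by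
    rw [← hp1, ← hpN, ← intervalIntegral.sum_integral_adjacent_intervals_Ico (show 1 ≤ N from hN)
      fun r hr => intervalIntegrable_congr_Ioo (hple r) (hfl2 r hr)
        (((hχ.sub hχs).intervalIntegrable _ _).const_mul _ |>.const_mul _)]
    refine Finset.sum_congr rfl fun r hr => ?_
    have hr' := Finset.mem_Ico.1 hr
    rw [integral_congr_Ioo (hple r) (hfl2 r hr'), intervalIntegral.integral_const_mul,
      intervalIntegral.integral_const_mul, intervalIntegral.integral_sub (hχi _ _)
      (hχs.intervalIntegrable _ _), intervalIntegral.integral_comp_sub_right (fun x => χ x), hΨ, hΨ,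
      Nat.sub_add_cancel hr'.1]
    have e3 : p r - 1 / N = a + ((r - 1 : ℕ) : ℝ) / N := by
      simp only [hp]; push_cast [Nat.cast_sub hr'.1]; ring
    have e4 : p (r + 1) - 1 / N = a + (r : ℝ) / N := by
      simp only [hp]; push_cast; ring
    rw [e3, e4]
    simp only [hp]
    ring
  rw [e1, e2]
  have := sum_range_diff_mul (show 1 ≤ N from hN) (fun r : ℕ => F (j₀ + r)) Ψ
  rw [this]
  push_cast
  rw [add_zero]
  ring

/-- Discrete integration by parts in time. -/
theorem integral_time_shift {T δ : ℝ} (hT : 0 < T) (hδ : 0 < δ) (hδT : δ ≤ T) {U ψ : ℝ → ℝ}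
    {U₀ : ℝ} (hU0 : ∀ t ≤ 0, U t = U₀)
    (hU : ∀ p q, p ≤ q → q ≤ T → IntervalIntegrable U volume p q) (hψ : Continuous ψ)
    (hψT : ∀ t, T ≤ t → ψ t = 0) :
    ∫ t in Ioo 0 T, (U t - U (t - δ)) / δ * ψ t =
      -(∫ t in Ioo 0 T, U t * ((ψ (t + δ) - ψ t) / δ)) - U₀ * (δ⁻¹ * ∫ t in (0 : ℝ)..(0 + δ), ψ t) := by
  have hψs : Continuous fun t => ψ (t + δ) := by fun_prop
  have i1 : ∀ p q, p ≤ q → q ≤ T → IntervalIntegrable (fun t => U t * ψ t) volume p q :=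
    fun p q hpq hq => (hU p q hpq hq).mul_continuousOn hψ.continuousOn
  have i2 : ∀ p q, p ≤ q → q ≤ T → IntervalIntegrable (fun t => U t * ψ (t + δ)) volume p q :=
    fun p q hpq hq => (hU p q hpq hq).mul_continuousOn hψs.continuousOn
  have i3 : IntervalIntegrable (fun t => U (t - δ) * ψ t) volume 0 T := by
    have := (i2 (-δ) (T - δ) (by linarith) (by linarith)).comp_sub_right δ
    simpa using this
  have e1 : ∫ t in (0 : ℝ)..T, U (t - δ) * ψ t = ∫ t in (-δ)..(T - δ), U t * ψ (t + δ) := by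
    have := intervalIntegral.integral_comp_sub_right (a := 0) (b := T)
      (fun t => U t * ψ (t + δ)) δ
    simp only [sub_add_cancel, zero_sub] at this
    exact this
  have e2 := intervalIntegral.integral_add_adjacent_intervals (i2 (-δ) 0 (by linarith) hT.le)
    (i2 0 (T - δ) (by linarith) (by linarith))
  have e3 := intervalIntegral.integral_add_adjacent_intervals
    (i2 0 (T - δ) (by linarith) (by linarith)) (i2 (T - δ) T (by linarith) le_rfl)
  -- The shifted test function vanishes on the last strip. On the strip before time `0`, treated
  -- next, `U` equals its initial value and yields the initial term.
  have e4 : ∫ t in (T - δ)..T, U t * ψ (t + δ) = 0 := by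
    have : EqOn (fun t => U t * ψ (t + δ)) (fun _ => (0 : ℝ)) (Ioo (T - δ) T) := fun t ht => by
      simp only [hψT (t + δ) (by linarith [ht.1]), mul_zero]
    rw [integral_congr_Ioo (by linarith) this]
    simp
  have e5 : ∫ t in (-δ)..0, U t * ψ (t + δ) = U₀ * ∫ t in (0 : ℝ)..(0 + δ), ψ t := by
    have : EqOn (fun t => U t * ψ (t + δ)) (fun t => U₀ * ψ (t + δ)) (Ioo (-δ) 0) := fun t ht => by
      simp only [hU0 t ht.2.le]
    rw [integral_congr_Ioo (by linarith) this, intervalIntegral.integral_const_mul,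
      intervalIntegral.integral_comp_add_right (fun t => ψ t), neg_add_cancel]
  have e6 : ∫ t in Ioo 0 T, (U t - U (t - δ)) / δ * ψ t =
      δ⁻¹ * ((∫ t in (0 : ℝ)..T, U t * ψ t) - ∫ t in (0 : ℝ)..T, U (t - δ) * ψ t) := by
    rw [← intervalIntegral.integral_sub (i1 0 T hT.le le_rfl) i3,
      ← intervalIntegral.integral_const_mul, intervalIntegral.integral_of_le hT.le,
      integral_Ioc_eq_integral_Ioo]
    refine integral_congr_ae (ae_of_all _ fun t => ?_)
    ring
  have e7 : ∫ t in Ioo 0 T, U t * ((ψ (t + δ) - ψ t) / δ) =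
      δ⁻¹ * ((∫ t in (0 : ℝ)..T, U t * ψ (t + δ)) - ∫ t in (0 : ℝ)..T, U t * ψ t) := by
    rw [← intervalIntegral.integral_sub (i2 0 T hT.le le_rfl) (i1 0 T hT.le le_rfl),
      ← intervalIntegral.integral_const_mul, intervalIntegral.integral_of_le hT.le,
      integral_Ioc_eq_integral_Ioo]
    refine integral_congr_ae (ae_of_all _ fun t => ?_)
    ring
  rw [e6, e7, e1, ← e2, ← e3, e4, e5]
  ring

end Problem

/-! ### Fubini on the cylinders and time averages of the boundary data. -/

namespace Problem

variable {P : Problem}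

theorem volume_restrict_cyl (i : Fin 2) : (volume : Measure (ℝ × ℝ)).restrict (P.cyl i) =
    (volume.restrict (layer i)).prod (volume.restrict (Ioo 0 P.T)) := by
  rw [cyl, Measure.prod_restrict, Measure.volume_eq_prod]

theorem ae_ae_of_ae_cyl {i : Fin 2} {q : ℝ × ℝ → Prop}
    (h : ∀ᵐ p ∂volume.restrict (P.cyl i), q p) :
    ∀ᵐ t ∂volume.restrict (Ioo 0 P.T), ∀ᵐ x ∂volume.restrict (layer i), q (x, t) := by
  rw [volume_restrict_cyl] at h
  have h2 := Measure.measurePreserving_swap (μ := volume.restrict (Ioo 0 P.T))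
    (ν := volume.restrict (layer i)) |>.quasiMeasurePreserving.ae h
  exact Measure.ae_ae_of_ae_prod h2

theorem ae_cyl_of_ae_ae {i : Fin 2} {q : ℝ × ℝ → Prop} (hq : MeasurableSet {p | q p})
    (h : ∀ᵐ t ∂volume.restrict (Ioo 0 P.T), ∀ᵐ x ∂volume.restrict (layer i), q (x, t)) :
    ∀ᵐ p ∂volume.restrict (P.cyl i), q p := by
  rw [volume_restrict_cyl]
  have h1 : ∀ᵐ p ∂(volume.restrict (Ioo 0 P.T)).prod (volume.restrict (layer i)), q p.swap :=
    (Measure.ae_prod_iff_ae_ae (p := fun p => q p.swap) (measurable_swap hq)).2 h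
  have h2 := Measure.measurePreserving_swap (μ := volume.restrict (layer i))
    (ν := volume.restrict (Ioo 0 P.T)) |>.quasiMeasurePreserving.ae h1
  filter_upwards [h2] with p hp using by simpa using hp

theorem ae_ae_of_ae_cyl' {i : Fin 2} {q : ℝ × ℝ → Prop}
    (h : ∀ᵐ p ∂volume.restrict (P.cyl i), q p) :
    ∀ᵐ x ∂volume.restrict (layer i), ∀ᵐ t ∂volume.restrict (Ioo 0 P.T), q (x, t) := by
  rw [volume_restrict_cyl] at h
  exact Measure.ae_ae_of_ae_prod h

theorem integral_cyl {i : Fin 2} {F : ℝ × ℝ → ℝ} (hF : IntegrableOn F (P.cyl i)) :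
    ∫ p in P.cyl i, F p = ∫ t in Ioo 0 P.T, ∫ x in layer i, F (x, t) := by
  rw [IntegrableOn, volume_restrict_cyl] at hF
  rw [volume_restrict_cyl, integral_prod_symm _ hF]

theorem integral_cyl' {i : Fin 2} {F : ℝ × ℝ → ℝ} (hF : IntegrableOn F (P.cyl i)) :
    ∫ p in P.cyl i, F p = ∫ x in layer i, ∫ t in Ioo 0 P.T, F (x, t) := by
  rw [IntegrableOn, volume_restrict_cyl] at hF
  rw [volume_restrict_cyl, integral_prod _ hF]

theorem integrable_integral_layer {i : Fin 2} {F : ℝ × ℝ → ℝ} (hF : IntegrableOn F (P.cyl i)) :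
    IntegrableOn (fun t => ∫ x in layer i, F (x, t)) (Ioo 0 P.T) := by
  rw [IntegrableOn, volume_restrict_cyl] at hF
  exact hF.integral_prod_right

theorem measurableSet_cyl (i : Fin 2) : MeasurableSet (P.cyl i) :=
  (measurableSet_layer i).prod measurableSet_Ioo

theorem cyl_subset_domain (i : Fin 2) : P.cyl i ⊆ P.domain := prod_mono (layer_subset i) le_rfl

theorem volume_cyl_lt_top (i : Fin 2) : volume (P.cyl i) < ⊤ := by
  obtain ⟨a, h, -⟩ := exists_layer_eq i
  rw [cyl, h, Measure.volume_eq_prod, Measure.prod_prod, Real.volume_Ioo, Real.volume_Ioo]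
  exact ENNReal.mul_lt_top ENNReal.ofReal_lt_top ENNReal.ofReal_lt_top

theorem integrableOn_cyl_of_bound {i : Fin 2} {F : ℝ × ℝ → ℝ} {B : ℝ}
    (hm : AEStronglyMeasurable F (volume.restrict (P.cyl i)))
    (hB : ∀ᵐ p ∂volume.restrict (P.cyl i), |F p| ≤ B) : IntegrableOn F (P.cyl i) :=
  IntegrableOn.of_bound (volume_cyl_lt_top i) hm B hB

/-- Almost everywhere convergence of the time averages. -/
theorem ae_tendsto_timeMean {g : ℝ → ℝ} (hg : IntegrableOn g (Ioo 0 P.T)) {M : ℕ → ℕ}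
    (hM0 : ∀ k, 0 < M k) (hM : Tendsto M atTop atTop) :
    ∀ᵐ t ∂volume.restrict (Ioo 0 P.T), Tendsto
      (fun k => P.timeMean (M k) g (⌈t / (P.T / M k)⌉₊ - 1)) atTop (𝓝 (g t)) := by
  set G : ℝ → ℝ := (Ioo 0 P.T).indicator g
  have hG : Integrable G := (integrable_indicator_iff measurableSet_Ioo).2 hg
  have hT := P.T_pos
  -- The time slab contains `t` but is not centred at it, so differentiation of integrals is needed
  -- along balls that merely contain the point.
  filter_upwards [ae_restrict_of_ae (IsUnifLocDoublingMeasure.ae_tendsto_average (μ := volume)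
    hG.locallyIntegrable 1), ae_restrict_mem measurableSet_Ioo] with t ht htI
  set n : ℕ → ℕ := fun k => ⌈t / (P.T / M k)⌉₊ - 1 with hn
  set δ : ℕ → ℝ := fun k => P.T / M k / 2 with hδ
  have hMR : ∀ k, (0 : ℝ) < M k := fun k => by exact_mod_cast hM0 k
  have hδ0 : ∀ k, 0 < δ k := fun k => by have := hMR k; positivity
  have hδl : Tendsto δ atTop (𝓝[>] 0) := by
    refine tendsto_nhdsWithin_iff.2 ⟨?_, Eventually.of_forall hδ0⟩
    have := ((tendsto_const_div_atTop_nhds_zero_nat P.T).comp hM).div_const 2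
    simpa [hδ] using this
  have hmem : ∀ k, n k * (P.T / M k) < t ∧ t ≤ (n k + 1) * (P.T / M k) := by
    intro k
    have hd : 0 < P.T / M k := div_pos hT (hMR k)
    obtain ⟨h1, h2⟩ := ceil_mem_of_mem_Ioo (hM0 k) htI
    have e : ((n k : ℕ) : ℝ) + 1 = ⌈t / (P.T / M k)⌉₊ := by
      rw [hn]; push_cast [Nat.cast_sub h1]; ring
    constructor
    · rw [← lt_div_iff₀ hd]
      have := Nat.ceil_lt_add_one (a := t / (P.T / M k)) (div_pos htI.1 hd).le
      linarith
    · rw [← div_le_iff₀ hd, e]; exact Nat.le_ceil _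
  have hle : ∀ k, ((n k : ℝ) + 1) * (P.T / M k) ≤ P.T := by
    intro k
    obtain ⟨h1, h2⟩ := ceil_mem_of_mem_Ioo (hM0 k) htI
    have e : ((n k : ℕ) : ℝ) + 1 = ⌈t / (P.T / M k)⌉₊ := by
      rw [hn]; push_cast [Nat.cast_sub h1]; ring
    have h3 : ((n k : ℕ) : ℝ) + 1 ≤ M k := by rw [e]; exact_mod_cast h2
    calc ((n k : ℝ) + 1) * (P.T / M k) ≤ M k * (P.T / M k) := by
          gcongr
      _ = P.T := by field_simp [(hMR k).ne']
  -- Up to end points, the slab is the ball around its midpoint whose radius is half a time step.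
  have key := ht (ι := ℕ) (l := atTop) (fun k => (n k + 1 / 2) * (P.T / M k)) δ hδl
    (Eventually.of_forall fun k => by
      rw [Metric.mem_closedBall, Real.dist_eq, abs_le, one_mul]
      have := hmem k
      constructor <;> simp only [hδ] <;> nlinarith)
  have hGt : G t = g t := indicator_of_mem htI _
  rw [hGt] at key
  refine key.congr fun k => ?_
  have hd : 0 < P.T / M k := div_pos hT (hMR k)
  have e1 : (n k + 1 / 2) * (P.T / M k) - δ k = n k * (P.T / M k) := by simp only [hδ]; ring
  have e2 : (n k + 1 / 2) * (P.T / M k) + δ k = (n k + 1) * (P.T / M k) := by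
    simp only [hδ]; ring
  have hnk : n k * (P.T / M k) ≤ (n k + 1) * (P.T / M k) := by nlinarith
  rw [Real.closedBall_eq_Icc, e1, e2, setAverage_eq, integral_Icc_eq_integral_Ioo, timeMean,
    intervalIntegral.integral_of_le hnk, integral_Ioc_eq_integral_Ioo, smul_eq_mul, Real.volume_real_Icc,
    max_eq_left (by linarith)]
  congr 1
  · rw [one_div]; congr 1; ring
  · refine setIntegral_congr_fun measurableSet_Ioo fun s hs => indicator_of_mem ?_ _
    exact ⟨lt_of_le_of_lt (by positivity) hs.1, hs.2.trans_le (hle k)⟩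

end Problem

end TwoPhase

namespace TwoPhase

open Problem

/-! ### Limits of schemes and the weak derivative in space. -/

/-- The left end point of a layer. -/
noncomputable def layerStart (i : Fin 2) : ℝ := if i = 0 then -1 else 0

theorem layer_eq (i : Fin 2) : layer i = Ioo (layerStart i) (layerStart i + 1) := by
  fin_cases i <;> simp [layer, layerStart]

/-- The index of the first cell of a layer. -/
def startIndex (N : ℕ) (i : Fin 2) : ℤ := if i = 0 then -N else 0

theorem startIndex_eq (N : ℕ) (i : Fin 2) : (startIndex N i : ℝ) = layerStart i * N := by
  fin_cases i <;> simp [startIndex, layerStart]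

theorem startIndex_add_mem {N : ℕ} (i : Fin 2) {r : ℕ} (hr : r < N) :
    startIndex N i + r ∈ Ico (-N : ℤ) N ∧ cellLayer (startIndex N i + r) = i := by
  fin_cases i
  · have : -(N : ℤ) + r < 0 := by omega
    simp only [startIndex, cellLayer, mem_Ico, Fin.zero_eta, if_true, this]
    exact ⟨⟨by omega, by omega⟩, trivial⟩
  · simp only [startIndex, cellLayer, mem_Ico, Fin.mk_one, one_ne_zero, if_false, zero_add]
    exact ⟨⟨by omega, by omega⟩, by simp⟩

/-- Discrete solutions with uniformly bounded fluxes, on meshes whose size tends to zero, that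
converge almost everywhere to `u`. -/
structure SchemeLimit (P : Problem) (u₀ : ℝ → ℝ) (C : ℝ) (N M : ℕ → ℕ) (v : ℕ → ℕ → ℤ → ℝ)
    (c d : ℕ → ℕ → ℝ) (u : ℝ × ℝ → ℝ) : Prop where
  C_pos : 0 < C
  G_le : ∀ i, ∀ a ∈ Icc (0 : ℝ) 1, ∀ b ∈ Icc (0 : ℝ) 1, |P.G i a b| ≤ C
  tendsto_N : Tendsto N atTop atTop
  tendsto_M : Tendsto M atTop atTop
  scheme : ∀ k, IsBoundedScheme P u₀ C (N k) (M k) (v k) (c k) (d k)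
  conv : ∀ i, ∀ᵐ p ∂volume.restrict (P.cyl i),
    Tendsto (fun k => P.discreteFun (N k) (M k) (v k) p) atTop (𝓝 (u p))

variable {P : Problem} {u₀ : ℝ → ℝ} {C : ℝ} {N M : ℕ → ℕ} {v : ℕ → ℕ → ℤ → ℝ}
  {c d : ℕ → ℕ → ℝ} {u : ℝ × ℝ → ℝ}

theorem SchemeLimit.layerConvergence (h : SchemeLimit P u₀ C N M v c d u) (i : Fin 2) :
    ∀ᵐ t ∂volume.restrict (Ioo 0 P.T), LayerConvergence P i (layerStart i) (2 * C) N
      (fun k x => P.discreteFun (N k) (M k) (v k) (x, t)) (fun x => u (x, t)) := by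
  filter_upwards [ae_ae_of_ae_cyl (h.conv i), ae_restrict_mem measurableSet_Ioo] with t ht htI
  have hC := h.C_pos
  refine ⟨by linarith, fun k => (h.scheme k).pos_N, h.tendsto_N, fun k => ?_, fun k x hx => ?_,
    fun k x hx y hy => ?_, ?_⟩
  · exact (measurable_discreteFun _ _ _).comp (measurable_id.prodMk measurable_const)
  · rw [← layer_eq] at hx
    exact (h.scheme k).discreteFun_mem hx htI
  · rw [← layer_eq] at hx hy
    have hN := (h.scheme k).pos_N
    have hNR : (0 : ℝ) < N k := by exact_mod_cast hN
    obtain ⟨h1, h2⟩ := ceil_mem_of_mem_Ioo (h.scheme k).pos_M htI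
    obtain ⟨h3, h4⟩ := floor_mem_of_mem_layer hN hx
    obtain ⟨h5, h6⟩ := floor_mem_of_mem_layer hN hy
    refine ((h.scheme k).abs_phi_sub_le h.G_le h1 h2 h3 h5 h4 h6).trans ?_
    have h7 := abs_floor_sub_floor_le (x / (1 / (N k : ℝ))) (y / (1 / (N k : ℝ)))
    have h8 : x / (1 / (N k : ℝ)) - y / (1 / (N k : ℝ)) = N k * (x - y) := by
      field_simp
    rw [h8, abs_mul, abs_of_pos hNR] at h7
    calc _ ≤ 2 * C / N k * (N k * |x - y| + 1) := by gcongr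
      _ = _ := by field_simp
  · rw [← layer_eq]; exact ht

theorem tendsto_mul_sub_of_hasDerivAt {g : ℝ → ℝ} {g' x : ℝ} (h : HasDerivAt g g' x) :
    Tendsto (fun n : ℕ => ((n : ℝ) + 1) * (g (x + 1 / ((n : ℝ) + 1)) - g x)) atTop (𝓝 g') := by
  have h1 : Tendsto (fun n : ℕ => 1 / ((n : ℝ) + 1)) atTop (𝓝[≠] 0) :=
    tendsto_nhdsWithin_iff.2 ⟨tendsto_one_div_add_atTop_nhds_zero_nat,
      Eventually.of_forall fun n => (Nat.one_div_pos_of_nat (α := ℝ)).ne'⟩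
  refine ((hasDerivAt_iff_tendsto_slope_zero.1 h).comp h1).congr fun n => ?_
  simp

/-- Upper limit of the forward difference quotients in space. -/
noncomputable def spaceDeriv (e : ℝ × ℝ → ℝ) (p : ℝ × ℝ) : ℝ :=
  limsup (fun n : ℕ => ((n : ℝ) + 1) * (e (p.1 + 1 / ((n : ℝ) + 1), p.2) - e p)) atTop

theorem measurable_spaceDeriv {e : ℝ × ℝ → ℝ} (he : Measurable e) : Measurable (spaceDeriv e) :=
  Measurable.limsup fun n => ((he.comp (by fun_prop)).sub he).const_mul _

theorem spaceDeriv_eq {e : ℝ × ℝ → ℝ} {g : ℝ → ℝ} {t p q : ℝ}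
    (h : ∀ x ∈ Ioo p q, e (x, t) = g x) {x g' : ℝ} (hx : x ∈ Ioo p q) (hg : HasDerivAt g g' x) :
    spaceDeriv e (x, t) = g' := by
  have hx1 : Tendsto (fun n : ℕ => x + 1 / ((n : ℝ) + 1)) atTop (𝓝 x) := by
    simpa using (tendsto_one_div_add_atTop_nhds_zero_nat (𝕜 := ℝ)).const_add x
  refine ((tendsto_mul_sub_of_hasDerivAt hg).congr' ?_).limsup_eq
  filter_upwards [hx1.eventually (isOpen_Ioo.mem_nhds hx)] with n hn
  rw [h _ hn, h _ hx]

/-- A measurable function that is, for almost every time, the derivative of the Lipschitz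
continuous representative of `φ_i(u)`. -/
theorem SchemeLimit.exists_deriv (h : SchemeLimit P u₀ C N M v c d u) (i : Fin 2) :
    ∃ w : ℝ × ℝ → ℝ, Measurable w ∧ ∀ᵐ t ∂volume.restrict (Ioo 0 P.T),
      ∃ g, IsLipschitzRep P i (layerStart i) (2 * C) (fun x => u (x, t)) g ∧
        ∀ᵐ x ∂volume.restrict (layer i), w (x, t) = deriv g x := by
  set Φ : ℝ → ℝ := fun s => IccExtend (zero_le_one' ℝ) ((Icc 0 1).domRestrict (P.phi i)) s with hΦ
  have hΦc : Continuous Φ :=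
    (continuousOn_iff_continuous_domRestrict.1 (P.phi_continuousOn i)).Icc_extend'
  have hΦe : ∀ s ∈ Icc (0 : ℝ) 1, Φ s = P.phi i s := fun s hs => by
    rw [hΦ]; simp only []; rw [IccExtend_of_mem _ _ hs]; rfl
  -- The representative `g` is obtained separately for each `t`, with no measurability in `t`. The
  -- upper limit is jointly measurable and agrees with `g` at almost every time, so its difference
  -- quotients give a jointly measurable derivative.
  set e : ℝ × ℝ → ℝ := fun p =>
    limsup (fun k => Φ (P.discreteFun (N k) (M k) (v k) p)) atTop with he
  have hem : Measurable e :=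
    Measurable.limsup fun k => hΦc.measurable.comp (measurable_discreteFun _ _ _)
  refine ⟨spaceDeriv e, measurable_spaceDeriv hem, ?_⟩
  filter_upwards [h.layerConvergence i] with t ht
  obtain ⟨g, hg⟩ := ht.exists_rep
  refine ⟨g, hg, ?_⟩
  have heg : ∀ x ∈ Ioo (layerStart i) (layerStart i + 1), e (x, t) = g x := by
    intro x hx
    have h1 : Tendsto (fun k => P.phi i (P.discreteFun (N k) (M k) (v k) (x, t))) atTop
        (𝓝 (g x)) := by
      refine tendsto_of_asymptotically_lipschitz
        (e := fun k x => P.phi i (P.discreteFun (N k) (M k) (v k) (x, t))) ht.tendsto_mesh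
        hg.lip.continuous ht.lip ?_ (fun _ => hx) tendsto_const_nhds
      filter_upwards [ht.conv_phi, hg.eq] with y hy hy'
      rw [← hy']; exact hy.2
    refine (h1.congr fun k => ?_).limsup_eq
    rw [hΦe _ (ht.mem k x hx)]
  rw [layer_eq]
  filter_upwards [ae_restrict_of_ae hg.lip.ae_differentiableAt_real,
    ae_restrict_mem measurableSet_Ioo] with x hx hxI
  exact spaceDeriv_eq heg hxI hx.hasDerivAt

theorem SchemeLimit.aestronglyMeasurable (h : SchemeLimit P u₀ C N M v c d u) (i : Fin 2) :
    AEStronglyMeasurable u (volume.restrict (P.cyl i)) :=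
  aestronglyMeasurable_of_tendsto_ae atTop
    (fun k => (measurable_discreteFun (N k) (M k) (v k)).aestronglyMeasurable) (h.conv i)

theorem SchemeLimit.mem_cyl (h : SchemeLimit P u₀ C N M v c d u) (i : Fin 2) :
    ∀ᵐ p ∂volume.restrict (P.cyl i), u p ∈ Icc (0 : ℝ) 1 := by
  filter_upwards [h.conv i, ae_restrict_mem (measurableSet_cyl i)] with p hp hpi
  exact isClosed_Icc.mem_of_tendsto hp
    (Eventually.of_forall fun k => (h.scheme k).discreteFun_mem hpi.1 hpi.2)

/-- The two cylinders miss only the interface `x = 0`, a null set. -/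
theorem restrict_domain_ae_eq : ∀ᵐ p ∂volume.restrict P.domain, p ∈ P.cyl 0 ∪ P.cyl 1 := by
  have h0 : ∀ᵐ x : ℝ, x ≠ 0 := by simp [ae_iff]
  have h1 : ∀ᵐ p : ℝ × ℝ, p.1 ≠ 0 := by
    rw [Measure.volume_eq_prod]
    exact (Measure.quasiMeasurePreserving_fst (μ := volume) (ν := volume)).ae h0
  filter_upwards [ae_restrict_of_ae h1,
    ae_restrict_mem (measurableSet_Ioo.prod measurableSet_Ioo)] with p hp hpd
  rcases lt_or_gt_of_ne hp with h | h
  · exact Or.inl ⟨by simp only [layer, if_true]; exact ⟨hpd.1.1, h⟩, hpd.2⟩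
  · exact Or.inr ⟨by simp only [layer, one_ne_zero, if_false]; exact ⟨h, hpd.1.2⟩, hpd.2⟩

theorem restrict_domain_le : volume.restrict P.domain ≤ volume.restrict (P.cyl 0 ∪ P.cyl 1) := by
  refine Measure.restrict_mono_ae ?_
  exact (ae_restrict_iff' (measurableSet_Ioo.prod measurableSet_Ioo)).1 restrict_domain_ae_eq

theorem abs_deriv_le {L : ℝ} (hL : 0 ≤ L) {g : ℝ → ℝ} (hg : LipschitzWith L.toNNReal g) (x : ℝ) :
    |deriv g x| ≤ L := by
  have := norm_deriv_le_of_lipschitz (x₀ := x) hg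
  rwa [Real.norm_eq_abs, Real.coe_toNNReal _ hL] at this

theorem integral_lipschitz_mul_deriv {a b : ℝ} (hab : a ≤ b) {g : ℝ → ℝ} {K : NNReal}
    (hg : LipschitzWith K g) {η : ℝ → ℝ} (hη : ContDiff ℝ 1 η) (ha : η a = 0) (hb : η b = 0) :
    ∫ x in Ioo a b, g x * deriv η x = -∫ x in Ioo a b, deriv g x * η x := by
  have hη' : AbsolutelyContinuousOnInterval η a b :=
    (hη.contDiffOn).absolutelyContinuousOnInterval
  have hg' : AbsolutelyContinuousOnInterval g a b :=
    (hg.lipschitzOnWith (s := uIcc a b)).absolutelyContinuousOnInterval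
  have := hg'.integral_mul_deriv_eq_deriv_mul hη'
  rw [ha, hb, mul_zero, mul_zero, sub_zero, zero_sub, intervalIntegral.integral_of_le hab,
    intervalIntegral.integral_of_le hab, integral_Ioc_eq_integral_Ioo,
    integral_Ioc_eq_integral_Ioo] at this
  exact this

end TwoPhase

namespace TwoPhase

open Problem

variable {P : Problem} {u₀ : ℝ → ℝ} {C : ℝ} {N M : ℕ → ℕ} {v : ℕ → ℕ → ℤ → ℝ}
  {c d : ℕ → ℕ → ℝ} {u : ℝ × ℝ → ℝ}

/-- `w` is measurable and, for almost every time, equal to the derivative of the Lipschitz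
continuous representative of `φ_i(u)`. -/
def IsSpaceDeriv (P : Problem) (i : Fin 2) (L : ℝ) (u w : ℝ × ℝ → ℝ) : Prop :=
  Measurable w ∧ ∀ᵐ t ∂volume.restrict (Ioo 0 P.T),
    ∃ g, IsLipschitzRep P i (layerStart i) L (fun x => u (x, t)) g ∧
      ∀ᵐ x ∂volume.restrict (layer i), w (x, t) = deriv g x

variable {i : Fin 2} {L : ℝ} {w : ℝ × ℝ → ℝ}

theorem IsSpaceDeriv.ae_abs_le (h : IsSpaceDeriv P i L u w) (hL : 0 ≤ L) :
    ∀ᵐ p ∂volume.restrict (P.cyl i), |w p| ≤ L := by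
  refine ae_cyl_of_ae_ae (measurableSet_le h.1.abs measurable_const) ?_
  filter_upwards [h.2] with t ⟨g, hg, hw⟩
  filter_upwards [hw] with x hx
  rw [hx]; exact abs_deriv_le hL hg.lip x

theorem IsSpaceDeriv.memLp (h : IsSpaceDeriv P i L u w) (hL : 0 ≤ L) (r : ENNReal) :
    MemLp w r (volume.restrict (P.cyl i)) := by
  have : IsFiniteMeasure (volume.restrict (P.cyl i)) :=
    isFiniteMeasure_restrict.2 (volume_cyl_lt_top i).ne
  exact MemLp.of_bound h.1.aestronglyMeasurable L (h.ae_abs_le hL)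

theorem exists_phi_bound (P : Problem) (i : Fin 2) :
    ∃ B, 0 ≤ B ∧ ∀ s ∈ Icc (0 : ℝ) 1, |P.phi i s| ≤ B := by
  obtain ⟨B, hB⟩ := isCompact_Icc.exists_bound_of_continuousOn (P.phi_continuousOn i)
  exact ⟨B, (abs_nonneg _).trans (hB 0 (by simp)), hB⟩

theorem exists_f_bound (P : Problem) (i : Fin 2) :
    ∃ B, 0 ≤ B ∧ ∀ s ∈ Icc (0 : ℝ) 1, |P.f i s| ≤ B := by
  obtain ⟨B, hB⟩ := isCompact_Icc.exists_bound_of_continuousOn (P.f_continuousOn i)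
  exact ⟨B, (abs_nonneg _).trans (hB 0 (by simp)), hB⟩

theorem memLp_phi (hu : AEStronglyMeasurable u (volume.restrict (P.cyl i)))
    (hm : ∀ᵐ p ∂volume.restrict (P.cyl i), u p ∈ Icc (0 : ℝ) 1) (r : ENNReal) :
    MemLp (fun p => P.phi i (u p)) r (volume.restrict (P.cyl i)) := by
  have : IsFiniteMeasure (volume.restrict (P.cyl i)) :=
    isFiniteMeasure_restrict.2 (volume_cyl_lt_top i).ne
  obtain ⟨B, -, hB⟩ := exists_phi_bound P i
  refine MemLp.of_bound (P.aestronglyMeasurable_phi_comp i hu hm) B ?_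
  filter_upwards [hm] with p hp using hB _ hp

theorem contDiff_slice_fst {η : ℝ × ℝ → ℝ} (hη : ContDiff ℝ (⊤ : ℕ∞) η) (t : ℝ) :
    ContDiff ℝ (⊤ : ℕ∞) (fun x => η (x, t)) := hη.comp (by fun_prop)

theorem contDiff_slice_snd {η : ℝ × ℝ → ℝ} (hη : ContDiff ℝ (⊤ : ℕ∞) η) (x : ℝ) :
    ContDiff ℝ (⊤ : ℕ∞) (fun t => η (x, t)) := hη.comp (by fun_prop)

theorem deriv_slice_fst {η : ℝ × ℝ → ℝ} (hη : ContDiff ℝ (⊤ : ℕ∞) η) (p : ℝ × ℝ) :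
    deriv (fun y => η (y, p.2)) p.1 = fderiv ℝ η p (1, 0) := by
  have h1 : HasFDerivAt η (fderiv ℝ η p) (p.1, p.2) :=
    (hη.differentiable (by simp) p).hasFDerivAt
  have h2 : HasDerivAt (fun y : ℝ => (y, p.2)) ((1 : ℝ), (0 : ℝ)) p.1 :=
    (hasDerivAt_id _).prodMk (hasDerivAt_const _ _)
  exact (h1.comp_hasDerivAt p.1 h2).deriv

theorem deriv_slice_snd {η : ℝ × ℝ → ℝ} (hη : ContDiff ℝ (⊤ : ℕ∞) η) (p : ℝ × ℝ) :
    deriv (fun s => η (p.1, s)) p.2 = fderiv ℝ η p (0, 1) := by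
  have h1 : HasFDerivAt η (fderiv ℝ η p) (p.1, p.2) :=
    (hη.differentiable (by simp) p).hasFDerivAt
  have h2 : HasDerivAt (fun y : ℝ => (p.1, y)) ((0 : ℝ), (1 : ℝ)) p.2 :=
    (hasDerivAt_const _ _).prodMk (hasDerivAt_id _)
  exact (h1.comp_hasDerivAt p.2 h2).deriv

theorem contDiff_fderiv_apply {η : ℝ × ℝ → ℝ} (hη : ContDiff ℝ (⊤ : ℕ∞) η) (e : ℝ × ℝ) :
    ContDiff ℝ (⊤ : ℕ∞) (fun p => fderiv ℝ η p e) :=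
  (hη.fderiv_right (m := (⊤ : ℕ∞)) (by simp)).clm_apply contDiff_const

/-- A smooth compactly supported function is bounded and Lipschitz continuous. -/
theorem exists_bound_lipschitz {η : ℝ × ℝ → ℝ} (hη : ContDiff ℝ (⊤ : ℕ∞) η)
    (hc : HasCompactSupport η) :
    ∃ B, 0 ≤ B ∧ (∀ p, |η p| ≤ B) ∧ ∀ p q, |η p - η q| ≤ B * dist p q := by
  obtain ⟨B, hB⟩ := hc.exists_bound_of_continuous hη.continuous
  obtain ⟨K, hK⟩ := ContDiff.lipschitzWith_of_hasCompactSupport hc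
    (hη.of_le (m := 1) (by exact_mod_cast le_top)) (by simp)
  have hB0 : 0 ≤ B := (norm_nonneg _).trans (hB 0)
  refine ⟨max B K, le_max_of_le_left hB0, fun p => (hB p).trans (le_max_left _ _),
    fun p q => ?_⟩
  have := hK.dist_le_mul p q
  rw [Real.dist_eq] at this
  exact this.trans (mul_le_mul_of_nonneg_right (le_max_right _ _) dist_nonneg)

/-- On almost every time slice this is integration by parts for the Lipschitz representative. The
slices of the test function vanish at both ends because its support lies in the open cylinder. -/
theorem IsSpaceDeriv.hasWeakDerivX (h : IsSpaceDeriv P i L u w) (hL : 0 ≤ L)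
    (hu : AEStronglyMeasurable u (volume.restrict (P.cyl i)))
    (hm : ∀ᵐ p ∂volume.restrict (P.cyl i), u p ∈ Icc (0 : ℝ) 1) :
    HasWeakDerivX (P.cyl i) (fun p => P.phi i (u p)) w := by
  have hfin : IsFiniteMeasure (volume.restrict (P.cyl i)) :=
    isFiniteMeasure_restrict.2 (volume_cyl_lt_top i).ne
  have hv : IntegrableOn (fun p => P.phi i (u p)) (P.cyl i) :=
    (memLp_phi hu hm 1).integrable le_rfl
  have hw : IntegrableOn w (P.cyl i) := (h.memLp hL 1).integrable le_rfl
  refine ⟨hv.locallyIntegrableOn, hw.locallyIntegrableOn, fun η hη hc hs => ?_⟩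
  obtain ⟨B, hB0, hB, -⟩ := exists_bound_lipschitz hη hc
  have hη' := contDiff_fderiv_apply hη (1, 0)
  obtain ⟨B', hB0', hB', -⟩ := exists_bound_lipschitz hη'
    ((hc.fderiv (𝕜 := ℝ)).comp_left (g := fun A : ℝ × ℝ →L[ℝ] ℝ => A (1, 0)) (by simp))
  have i1 : IntegrableOn (fun p => P.phi i (u p) * deriv (fun y => η (y, p.2)) p.1) (P.cyl i) := by
    simp_rw [deriv_slice_fst hη]
    exact hv.mul_bdd hη'.continuous.aestronglyMeasurable (Eventually.of_forall hB')
  have i2 : IntegrableOn (fun p => w p * η p) (P.cyl i) :=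
    hw.mul_bdd hη.continuous.aestronglyMeasurable (Eventually.of_forall hB)
  rw [integral_cyl i1, integral_cyl i2, ← integral_neg]
  refine integral_congr_ae ?_
  filter_upwards [h.2] with t ⟨g, hg, hwg⟩
  have hz : ∀ x, x ∉ layer i → η (x, t) = 0 := fun x hx =>
    image_eq_zero_of_notMem_tsupport fun hxt => hx (hs hxt).1
  have key := integral_lipschitz_mul_deriv (a := layerStart i) (b := layerStart i + 1)
    (by linarith) hg.lip ((contDiff_slice_fst hη t).of_le (by exact_mod_cast le_top))
    (hz _ (by rw [layer_eq]; simp)) (hz _ (by rw [layer_eq]; simp))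
  rw [← layer_eq] at key
  calc ∫ x in layer i, P.phi i (u (x, t)) * deriv (fun y => η (y, t)) x
      = ∫ x in layer i, g x * deriv (fun y => η (y, t)) x := by
        refine integral_congr_ae ?_
        have := hg.eq
        rw [← layer_eq] at this
        filter_upwards [this] with x hx
        rw [hx]
    _ = -∫ x in layer i, deriv g x * η (x, t) := key
    _ = -∫ x in layer i, w (x, t) * η (x, t) := by
        congr 1
        refine integral_congr_ae ?_
        filter_upwards [hwg] with x hx
        rw [hx]

end TwoPhase

namespace TwoPhase

open Problem

variable {P : Problem} {u₀ : ℝ → ℝ} {C : ℝ} {N M : ℕ → ℕ} {v : ℕ → ℕ → ℤ → ℝ}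
  {c d : ℕ → ℕ → ℝ} {u : ℝ × ℝ → ℝ}

/-! ### Traces and the interface condition. -/

/-- Defining the trace as an upper limit of discrete values makes it measurable in `t`, as the
boundary integrals require, and identifies it with the limit of the cell values next to the face. -/
theorem SchemeLimit.exists_trace (h : SchemeLimit P u₀ C N M v c d u) (i : Fin 2) {x : ℕ → ℝ}
    {z : ℝ} (hx : ∀ k, x k ∈ layer i) (hxz : Tendsto x atTop (𝓝 z)) :
    ∃ γ : ℝ → ℝ, Measurable γ ∧ ∀ᵐ t ∂volume.restrict (Ioo 0 P.T), γ t ∈ Icc (0 : ℝ) 1 ∧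
      HasTrace (layer i) z (fun x => u (x, t)) (γ t) ∧
      Tendsto (fun k => P.discreteFun (N k) (M k) (v k) (x k, t)) atTop (𝓝 (γ t)) := by
  refine ⟨fun t => limsup (fun k => P.discreteFun (N k) (M k) (v k) (x k, t)) atTop,
    Measurable.limsup fun k => (measurable_discreteFun _ _ _).comp
      (measurable_const.prodMk measurable_id), ?_⟩
  rw [layer_eq] at hx ⊢
  have hz : z ∈ Icc (layerStart i) (layerStart i + 1) :=
    isClosed_Icc.mem_of_tendsto hxz (Eventually.of_forall fun k => Ioo_subset_Icc_self (hx k))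
  filter_upwards [h.layerConvergence i] with t ht
  obtain ⟨g, hg⟩ := ht.exists_rep
  obtain ⟨σ, hσ, hσz, htr⟩ := hg.exists_trace hz
  have hlim : Tendsto (fun k => P.discreteFun (N k) (M k) (v k) (x k, t)) atTop (𝓝 σ) := by
    refine ht.tendsto_trace hg hσ hσz hx hxz (fun k => ht.mem k _ (hx k)) fun k => ?_
    rw [sub_self, abs_zero]
    exact mul_nonneg ht.C_nonneg (ht.mesh_pos k).le
  simp only [hlim.limsup_eq]
  exact ⟨hσ, htr, hlim⟩

/-- The centre of the first cell of a layer. -/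
noncomputable def firstCentre (i : Fin 2) (N : ℕ) : ℝ := layerStart i + 1 / (2 * N)

/-- The centre of the last cell of a layer. -/
noncomputable def lastCentre (i : Fin 2) (N : ℕ) : ℝ := layerStart i + 1 - 1 / (2 * N)

theorem one_div_two_mul_mem {N : ℕ} (hN : 0 < N) :
    0 < 1 / (2 * (N : ℝ)) ∧ 1 / (2 * (N : ℝ)) < 1 := by
  have : (1 : ℝ) ≤ N := by exact_mod_cast hN
  exact ⟨by positivity, by rw [div_lt_one (by positivity)]; linarith⟩

theorem firstCentre_mem {N : ℕ} (hN : 0 < N) (i : Fin 2) : firstCentre i N ∈ layer i := by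
  obtain ⟨h1, h2⟩ := one_div_two_mul_mem hN
  rw [layer_eq]
  exact ⟨by unfold firstCentre; linarith, by unfold firstCentre; linarith⟩

theorem lastCentre_mem {N : ℕ} (hN : 0 < N) (i : Fin 2) : lastCentre i N ∈ layer i := by
  obtain ⟨h1, h2⟩ := one_div_two_mul_mem hN
  rw [layer_eq]
  exact ⟨by unfold lastCentre; linarith, by unfold lastCentre; linarith⟩

theorem tendsto_one_div_two_mul {N : ℕ → ℕ} (hN : Tendsto N atTop atTop) :
    Tendsto (fun k => 1 / (2 * (N k : ℝ))) atTop (𝓝 0) := by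
  have h2 := (tendsto_one_div_atTop_nhds_zero_nat (𝕜 := ℝ)).comp hN |>.const_mul (1 / 2)
  rw [mul_zero] at h2
  refine h2.congr fun k => ?_
  simp only [Function.comp]
  rw [← one_div_mul_one_div]

theorem tendsto_firstCentre {N : ℕ → ℕ} (hN : Tendsto N atTop atTop) (i : Fin 2) :
    Tendsto (fun k => firstCentre i (N k)) atTop (𝓝 (layerStart i)) := by
  have := (tendsto_one_div_two_mul hN).const_add (layerStart i)
  rwa [add_zero] at this

theorem tendsto_lastCentre {N : ℕ → ℕ} (hN : Tendsto N atTop atTop) (i : Fin 2) :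
    Tendsto (fun k => lastCentre i (N k)) atTop (𝓝 (layerStart i + 1)) := by
  have := (tendsto_one_div_two_mul hN).const_sub (layerStart i + 1)
  rwa [sub_zero] at this

theorem discreteFun_firstCentre {N M : ℕ} (hN : 0 < N) (i : Fin 2) (v : ℕ → ℤ → ℝ) (t : ℝ) :
    P.discreteFun N M v (firstCentre i N, t) = v ⌈t / (P.T / M)⌉₊ (startIndex N i) := by
  have hNR : (0 : ℝ) < N := by exact_mod_cast hN
  have := floor_eq_of_mem_cell hN (startIndex_eq N i) (r := 0) (x := firstCentre i N)
    ⟨by simp [firstCentre, hN], by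
      simp only [firstCentre, Int.cast_zero, zero_add, add_lt_add_iff_left]
      exact one_div_lt_one_div_of_lt hNR (by linarith)⟩
  simp only [discreteFun, this, add_zero]

theorem discreteFun_lastCentre {N M : ℕ} (hN : 0 < N) (i : Fin 2) (v : ℕ → ℤ → ℝ) (t : ℝ) :
    P.discreteFun N M v (lastCentre i N, t) = v ⌈t / (P.T / M)⌉₊ (startIndex N i + N - 1) := by
  have hNR : (0 : ℝ) < N := by exact_mod_cast hN
  have h1 : 1 / (2 * (N : ℝ)) < 1 / N := one_div_lt_one_div_of_lt hNR (by linarith)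
  have h2 : ((N : ℝ) - 1) / N = 1 - 1 / N := by field_simp
  have h3 : ((N : ℝ) - 1 + 1) / N = 1 := by field_simp; ring
  have h4 := (one_div_two_mul_mem hN).1
  have := floor_eq_of_mem_cell hN (startIndex_eq N i) (r := N - 1) (x := lastCentre i N)
    ⟨by push_cast; rw [h2, lastCentre]; linarith, by push_cast; rw [h3, lastCentre]; linarith⟩
  simp only [discreteFun, this]
  congr 1; ring

/-- Connected traces at the interface. -/
theorem SchemeLimit.connected (h : SchemeLimit P u₀ C N M v c d u) {t γ₀ γ₁ : ℝ}
    (ht : t ∈ Ioo 0 P.T) (h0 : γ₀ ∈ Icc (0 : ℝ) 1) (h1 : γ₁ ∈ Icc (0 : ℝ) 1)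
    (hl : Tendsto (fun k => P.discreteFun (N k) (M k) (v k) (lastCentre 0 (N k), t)) atTop (𝓝 γ₀))
    (hr : Tendsto (fun k => P.discreteFun (N k) (M k) (v k) (firstCentre 1 (N k), t)) atTop
      (𝓝 γ₁)) : P.Connected γ₀ γ₁ := by
  set n : ℕ → ℕ := fun k => ⌈t / (P.T / M k)⌉₊ - 1 with hn
  have hn1 : ∀ k, ⌈t / (P.T / M k)⌉₊ = n k + 1 ∧ n k < M k := fun k => by
    obtain ⟨e1, e2⟩ := ceil_mem_of_mem_Ioo (h.scheme k).pos_M ht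
    simp only [hn]; omega
  have hN0 : ∀ k, (0 : ℝ) < N k := fun k => by exact_mod_cast (h.scheme k).pos_N
  set a : ℕ → ℝ := fun k => v k (n k + 1) (-1) with ha
  set b : ℕ → ℝ := fun k => v k (n k + 1) 0 with hb
  have hs0 : ∀ k, startIndex (N k) 0 + N k - 1 = -1 := fun k => by simp [startIndex]
  have hs1 : ∀ k, startIndex (N k) 1 = 0 := fun k => by simp [startIndex]
  have hl' : Tendsto a atTop (𝓝 γ₀) := by
    refine hl.congr fun k => ?_
    rw [discreteFun_lastCentre (h.scheme k).pos_N, (hn1 k).1, hs0]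
  have hr' : Tendsto b atTop (𝓝 γ₁) := by
    refine hr.congr fun k => ?_
    rw [discreteFun_firstCentre (h.scheme k).pos_N, (hn1 k).1, hs1]
  have ham : ∀ k, a k ∈ Icc (0 : ℝ) 1 := fun k =>
    (h.scheme k).mem _ (hn1 k).2 _ ⟨by have := (h.scheme k).pos_N; omega, by omega⟩
  have hbm : ∀ k, b k ∈ Icc (0 : ℝ) 1 := fun k =>
    (h.scheme k).mem _ (hn1 k).2 _ ⟨by omega, by have := (h.scheme k).pos_N; omega⟩
  have hstep := fun k => (h.scheme k).step (n k) (hn1 k).2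
  have hF : ∀ k, |P.interfaceFluxL (N k) (a k) (c k (n k + 1))| ≤ C := fun k => by
    have := (h.scheme k).flux_le (n k) (hn1 k).2 0 ⟨by omega, by omega⟩
    rwa [flux_zero _ (h.scheme k).pos_N] at this
  have hCN : Tendsto (fun k => C / (N k : ℝ)) atTop (𝓝 0) :=
    (tendsto_const_div_atTop_nhds_zero_nat C).comp h.tendsto_N
  -- Flux and convective part are bounded by `C`, so the half-cell gradient gives a difference of at
  -- most `C / N`: interface and cell values share their limit.
  have hφc : Tendsto (fun k => P.phi 0 (c k (n k + 1)) - P.phi 0 (a k)) atTop (𝓝 0) := by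
    refine squeeze_zero_norm (fun k => ?_) hCN
    have e1 := hF k
    have e2 := h.G_le 0 _ (ham k) _ (hstep k).left_mem
    rw [interfaceFluxL_eq] at e1
    rw [abs_le] at e1 e2
    rw [Real.norm_eq_abs, abs_le, le_div_iff₀ (hN0 k), neg_le_iff_add_nonneg,
      ← sub_neg_eq_add, sub_nonneg, neg_le, ← neg_sub, neg_neg, le_div_iff₀ (hN0 k)]
    constructor <;> nlinarith [e1.1, e1.2, e2.1, e2.2]
  have hφd : Tendsto (fun k => P.phi 1 (d k (n k + 1)) - P.phi 1 (b k)) atTop (𝓝 0) := by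
    refine squeeze_zero_norm (fun k => ?_) hCN
    have e1 := hF k
    have e2 := h.G_le 1 _ (hstep k).right_mem _ (hbm k)
    rw [(hstep k).flux_eq, interfaceFluxR_eq] at e1
    rw [abs_le] at e1 e2
    rw [Real.norm_eq_abs, abs_le, le_div_iff₀ (hN0 k), neg_le_iff_add_nonneg,
      ← sub_neg_eq_add, sub_nonneg, neg_le, ← neg_sub, neg_neg, le_div_iff₀ (hN0 k)]
    constructor <;> nlinarith [e1.1, e1.2, e2.1, e2.2]
  have hc : Tendsto (fun k => c k (n k + 1)) atTop (𝓝 γ₀) := by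
    refine tendsto_of_phi_tendsto (P := P) (i := 0)
      (Eventually.of_forall fun k => (hstep k).left_mem) h0 ?_
    have e := hφc.add ((P.phi_continuousOn 0 _ h0).tendsto.comp
      (tendsto_nhdsWithin_iff.2 ⟨hl', Eventually.of_forall ham⟩))
    rw [zero_add] at e
    refine e.congr fun k => ?_
    simp
  have hd : Tendsto (fun k => d k (n k + 1)) atTop (𝓝 γ₁) := by
    refine tendsto_of_phi_tendsto (P := P) (i := 1)
      (Eventually.of_forall fun k => (hstep k).right_mem) h1 ?_
    have e := hφd.add ((P.phi_continuousOn 1 _ h1).tendsto.comp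
      (tendsto_nhdsWithin_iff.2 ⟨hr', Eventually.of_forall hbm⟩))
    rw [zero_add] at e
    refine e.congr fun k => ?_
    simp
  exact Rock.Connected.of_tendsto P.toRock (fun k => (hstep k).left_mem) (fun k => (hstep k).right_mem)
    hc hd fun k => (hstep k).connected

end TwoPhase

namespace TwoPhase

open Problem

variable {P : Problem} {u₀ : ℝ → ℝ} {C : ℝ} {N M : ℕ → ℕ} {v : ℕ → ℕ → ℤ → ℝ}
  {c d : ℕ → ℕ → ℝ} {u : ℝ × ℝ → ℝ}

/-! ### The limit of the balance at a fixed time. -/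

/-- The discrete time derivative of the mass in a layer, tested against `χ`. -/
noncomputable def massRate (P : Problem) (N M : ℕ) (v : ℕ → ℤ → ℝ) (i : Fin 2) (χ : ℝ → ℝ)
    (t : ℝ) : ℝ :=
  ∫ x in layer i, P.porosity i * ((P.discreteFun N M v (x, t) -
    P.discreteFun N M v (x, t - P.T / M)) / (P.T / M)) * χ x

/-- The discrete flux inside a layer, tested against the difference quotients of `χ`. -/
noncomputable def innerFlux (P : Problem) (N M : ℕ) (v : ℕ → ℤ → ℝ) (i : Fin 2) (χ : ℝ → ℝ)
    (t : ℝ) : ℝ :=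
  ∫ x in (layerStart i + 1 / N)..(layerStart i + 1),
    P.cellFlux N i (P.discreteFun N M v (x - 1 / N, t)) (P.discreteFun N M v (x, t)) *
      ((χ x - χ (x - 1 / N)) / (1 / N))

/-- The mean of `χ` on the `r`-th cell of a layer. -/
noncomputable def cellMean (N : ℕ) (i : Fin 2) (χ : ℝ → ℝ) (r : ℕ) : ℝ :=
  N * ∫ x in (layerStart i + r / N)..(layerStart i + (r + 1 : ℕ) / N), χ x

theorem abs_cellMean_le {N : ℕ} (hN : 0 < N) (i : Fin 2) {χ : ℝ → ℝ} {B : ℝ}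
    (hB : ∀ x, |χ x| ≤ B) (r : ℕ) : |cellMean N i χ r| ≤ B := by
  have hNR : (0 : ℝ) < N := by exact_mod_cast hN
  have h1 := intervalIntegral.norm_integral_le_of_norm_le_const
    (a := layerStart i + r / N) (b := layerStart i + (r + 1 : ℕ) / N) (f := χ) (C := B)
    fun x _ => hB x
  have h2 : layerStart i + (r + 1 : ℕ) / N - (layerStart i + r / N) = 1 / (N : ℝ) := by
    push_cast; ring
  rw [h2, abs_of_pos (by positivity), Real.norm_eq_abs] at h1
  rw [cellMean, abs_mul, abs_of_pos hNR]
  calc (N : ℝ) * |_| ≤ N * (B * (1 / N)) := by gcongr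
    _ = B := by field_simp

theorem tendsto_cellMean {N : ℕ → ℕ} (hN0 : ∀ k, 0 < N k) (hN : Tendsto N atTop atTop) (i : Fin 2)
    {χ : ℝ → ℝ} (hχ : Continuous χ) {B : ℝ} (hB : ∀ x, |χ x| ≤ B) {r : ℕ → ℕ}
    (hr : ∀ k, r k < N k) {z : ℝ}
    (hz : Tendsto (fun k => layerStart i + r k / N k) atTop (𝓝 z)) :
    Tendsto (fun k => cellMean (N k) i χ (r k)) atTop (𝓝 (χ z)) := by
  have hNR : ∀ k, (0 : ℝ) < N k := fun k => by exact_mod_cast hN0 k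
  have hδ : Tendsto (fun k => 1 / (N k : ℝ)) atTop (𝓝 0) :=
    (tendsto_one_div_atTop_nhds_zero_nat (𝕜 := ℝ)).comp hN
  refine (tendsto_integral_shrinking (a := layerStart i) (b := layerStart i + 1) (B := B)
    (h := fun _ => χ) (fun k => one_div_pos.2 (hNR k)) hδ hz (fun k => ?_)
    (fun k => hχ.aestronglyMeasurable) (fun k x _ => hB x)
    (fun x _ hx => (hχ.tendsto z).comp hx)).congr fun k => ?_
  · have h1 : ((r k : ℝ) + 1) ≤ N k := by exact_mod_cast hr k
    have h2 : (r k : ℝ) / N k + 1 / N k ≤ 1 := by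
      rw [← add_div, div_le_one (hNR k)]; exact h1
    have h3 : 0 ≤ (r k : ℝ) / N k := by positivity
    exact Ioo_subset_Ioo (by linarith) (by linarith)
  · rw [cellMean, one_div, inv_inv]
    have e : layerStart i + (r k + 1 : ℕ) / N k = layerStart i + r k / N k + 1 / N k := by
      push_cast; ring
    rw [e, one_div]

theorem massRate_eq {N M : ℕ} {v : ℕ → ℤ → ℝ} {c d : ℕ → ℝ}
    (h : IsBoundedScheme P u₀ C N M v c d) (i : Fin 2) {t : ℝ} {n : ℕ}
    (hn : ⌈t / (P.T / M)⌉₊ = n + 1) (hnM : n < M) {χ : ℝ → ℝ} (hχ : Continuous χ) :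
    massRate P N M v i χ t =
      P.flux N (P.timeMean M P.uL n) (P.timeMean M P.uR n) (v (n + 1)) (c (n + 1))
        (startIndex N i) * cellMean N i χ 0 -
      P.flux N (P.timeMean M P.uL n) (P.timeMean M P.uR n) (v (n + 1)) (c (n + 1))
        (startIndex N i + N) * cellMean N i χ (N - 1) + innerFlux P N M v i χ t := by
  rw [massRate, layer_eq, h.layer_balance (startIndex_eq N i)
    (fun r hr => startIndex_add_mem i hr) hn hnM hχ rfl (Ψ := cellMean N i χ) (fun r => rfl),
    innerFlux]

theorem abs_innerFlux_le (h : SchemeLimit P u₀ C N M v c d u) {i : Fin 2} {t : ℝ}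
    (hL : LayerConvergence P i (layerStart i) (2 * C) N
      (fun k x => P.discreteFun (N k) (M k) (v k) (x, t)) (fun x => u (x, t)))
    {χ : ℝ → ℝ} {B : ℝ} (hB : ∀ x y, |χ x - χ y| ≤ B * |x - y|) (k : ℕ) :
    |innerFlux P (N k) (M k) (v k) i χ t| ≤ 5 * C * B := by
  have hNR : (0 : ℝ) < N k := by exact_mod_cast hL.pos k
  have hC := h.C_pos
  have hm := hL.mesh_pos k
  have hm1 := hL.mesh_le_one k
  have hB0 : 0 ≤ B := by simpa using (abs_nonneg _).trans (hB 1 0)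
  have key := intervalIntegral.norm_integral_le_of_norm_le_const_ae
    (a := layerStart i + 1 / N k) (b := layerStart i + 1) (C := 5 * C * B)
    (f := fun x => P.cellFlux (N k) i (P.discreteFun (N k) (M k) (v k) (x - 1 / N k, t))
      (P.discreteFun (N k) (M k) (v k) (x, t)) * ((χ x - χ (x - 1 / N k)) / (1 / N k))) ?_
  · rw [Real.norm_eq_abs] at key
    refine key.trans ?_
    rw [abs_of_nonneg (by linarith)]
    exact mul_le_of_le_one_right (by positivity) (by linarith)
  · have hne : ∀ᵐ x : ℝ, x ≠ layerStart i + 1 := by simp [ae_iff]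
    filter_upwards [hne] with x hx hxI
    rw [uIoc_of_le (by linarith)] at hxI
    have hx1 : x ∈ Ioo (layerStart i) (layerStart i + 1) :=
      ⟨by linarith [hxI.1], lt_of_le_of_ne hxI.2 hx⟩
    have hx2 : x - 1 / N k ∈ Ioo (layerStart i) (layerStart i + 1) :=
      ⟨by linarith [hxI.1], by linarith [hx1.2]⟩
    have e1 := h.G_le i _ (hL.mem k _ hx2) _ (hL.mem k _ hx1)
    have e2 := hL.lip k _ hx1 _ hx2
    rw [sub_sub_cancel, abs_of_pos hm] at e2
    -- `C` from the convective part and `4C` from the Lipschitz bound across one cell, where the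
    -- mesh error doubles the distance.
    have e3 : |P.cellFlux (N k) i (P.discreteFun (N k) (M k) (v k) (x - 1 / N k, t))
        (P.discreteFun (N k) (M k) (v k) (x, t))| ≤ 5 * C := by
      rw [cellFlux_eq]
      refine (abs_sub _ _).trans ?_
      rw [abs_mul, abs_of_pos hNR]
      have : (N k : ℝ) * |P.phi i (P.discreteFun (N k) (M k) (v k) (x, t)) -
          P.phi i (P.discreteFun (N k) (M k) (v k) (x - 1 / N k, t))| ≤
          N k * (2 * C * (1 / N k + 1 / N k)) := by gcongr
      have e4 : (N k : ℝ) * (2 * C * (1 / N k + 1 / N k)) = 4 * C := by field_simp; ring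
      linarith
    have e4 : |(χ x - χ (x - 1 / N k)) / (1 / N k)| ≤ B := by
      rw [abs_div, abs_of_pos hm, div_le_iff₀ hm]
      have := hB x (x - 1 / N k)
      rwa [sub_sub_cancel, abs_of_pos hm] at this
    rw [norm_mul, Real.norm_eq_abs, Real.norm_eq_abs]
    exact mul_le_mul e3 e4 (abs_nonneg _) (by positivity)

/-- A bound uniform in `k` and `t`, for dominated convergence in time: `C * B` from each of the two
end fluxes and `5 * C * B` from the inside of the layer. -/
theorem abs_massRate_le (h : SchemeLimit P u₀ C N M v c d u) {i : Fin 2} {t : ℝ}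
    (ht : t ∈ Ioo 0 P.T) (hL : LayerConvergence P i (layerStart i) (2 * C) N
      (fun k x => P.discreteFun (N k) (M k) (v k) (x, t)) (fun x => u (x, t)))
    {χ : ℝ → ℝ} (hχ : Continuous χ) {B : ℝ} (hB : ∀ x, |χ x| ≤ B)
    (hBL : ∀ x y, |χ x - χ y| ≤ B * |x - y|) (k : ℕ) :
    |massRate P (N k) (M k) (v k) i χ t| ≤ 7 * C * B := by
  obtain ⟨e1, e2⟩ := ceil_mem_of_mem_Ioo (h.scheme k).pos_M ht
  obtain ⟨n, hn⟩ : ∃ n, ⌈t / (P.T / M k)⌉₊ = n + 1 := ⟨_, (Nat.sub_add_cancel e1).symm⟩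
  have hnM : n < M k := by omega
  rw [massRate_eq (h.scheme k) i hn hnM hχ]
  have hN := (h.scheme k).pos_N
  have hs : startIndex (N k) i ∈ Icc (-(N k) : ℤ) (N k) ∧
      startIndex (N k) i + N k ∈ Icc (-(N k) : ℤ) (N k) := by
    unfold startIndex; split_ifs <;> simp
  have f1 := (h.scheme k).flux_le n hnM _ hs.1
  have f2 := (h.scheme k).flux_le n hnM _ hs.2
  have g1 := abs_cellMean_le hN i hB 0
  have g2 := abs_cellMean_le hN i hB (N k - 1)
  have h3 := abs_innerFlux_le h hL hBL k
  have hC := h.C_pos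
  have p1 := mul_le_mul f1 g1 (abs_nonneg _) hC.le
  have p2 := mul_le_mul f2 g2 (abs_nonneg _) hC.le
  rw [← abs_mul] at p1 p2
  refine (abs_add_le _ _).trans ?_
  refine (add_le_add (abs_sub _ _) le_rfl).trans ?_
  linarith

theorem continuousOn_G (P : Problem) (i : Fin 2) :
    ContinuousOn (fun p : ℝ × ℝ => P.G i p.1 p.2) (Icc 0 1 ×ˢ Icc 0 1) := by
  obtain ⟨K, hK⟩ := P.G_lipschitz i
  exact hK.continuousOn

theorem tendsto_G (P : Problem) (i : Fin 2) {x y : ℕ → ℝ} {a b : ℝ}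
    (hx : ∀ k, x k ∈ Icc (0 : ℝ) 1) (hy : ∀ k, y k ∈ Icc (0 : ℝ) 1) (ha : Tendsto x atTop (𝓝 a))
    (hb : Tendsto y atTop (𝓝 b)) : Tendsto (fun k => P.G i (x k) (y k)) atTop (𝓝 (P.G i a b)) := by
  have ha' := isClosed_Icc.mem_of_tendsto ha (Eventually.of_forall hx)
  have hb' := isClosed_Icc.mem_of_tendsto hb (Eventually.of_forall hy)
  exact ((continuousOn_G P i) (a, b) ⟨ha', hb'⟩).tendsto.comp (tendsto_nhdsWithin_iff.2
    ⟨ha.prodMk_nhds hb, Eventually.of_forall fun k => ⟨hx k, hy k⟩⟩)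

/-- The limit of the discrete balance at a given time. -/
theorem tendsto_massRate (h : SchemeLimit P u₀ C N M v c d u) {t : ℝ} (ht : t ∈ Ioo 0 P.T)
    (hL : ∀ i, LayerConvergence P i (layerStart i) (2 * C) N
      (fun k x => P.discreteFun (N k) (M k) (v k) (x, t)) (fun x => u (x, t)))
    {g : Fin 2 → ℝ → ℝ}
    (hg : ∀ i, IsLipschitzRep P i (layerStart i) (2 * C) (fun x => u (x, t)) (g i))
    {γL γR : ℝ}
    (hγL : Tendsto (fun k => P.discreteFun (N k) (M k) (v k) (firstCentre 0 (N k), t)) atTop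
      (𝓝 γL))
    (hγR : Tendsto (fun k => P.discreteFun (N k) (M k) (v k) (lastCentre 1 (N k), t)) atTop
      (𝓝 γR))
    (huL : Tendsto (fun k => P.timeMean (M k) P.uL (⌈t / (P.T / M k)⌉₊ - 1)) atTop (𝓝 (P.uL t)))
    (huR : Tendsto (fun k => P.timeMean (M k) P.uR (⌈t / (P.T / M k)⌉₊ - 1)) atTop (𝓝 (P.uR t)))
    {χ : ℝ → ℝ} (hχ : ContDiff ℝ 2 χ) {B : ℝ} (hB : ∀ x, |χ x| ≤ B) (hB' : ∀ x, |deriv χ x| ≤ B)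
    (hBL : ∀ x y, |deriv χ x - deriv χ y| ≤ B * |x - y|) :
    Tendsto (fun k => ∑ i, massRate P (N k) (M k) (v k) i χ t) atTop
      (𝓝 ((∑ i, ∫ x in layer i, (P.f i (u (x, t)) - deriv (g i) x) * deriv χ x) +
        P.G 0 (P.uL t) γL * χ (-1) - P.G 1 γR (P.uR t) * χ 1)) := by
  set n : ℕ → ℕ := fun k => ⌈t / (P.T / M k)⌉₊ - 1 with hn
  have hn1 : ∀ k, ⌈t / (P.T / M k)⌉₊ = n k + 1 ∧ n k < M k := fun k => by
    obtain ⟨e1, e2⟩ := ceil_mem_of_mem_Ioo (h.scheme k).pos_M ht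
    simp only [hn]; omega
  have hN := fun k => (h.scheme k).pos_N
  have hNR : ∀ k, (0 : ℝ) < N k := fun k => by exact_mod_cast hN k
  have hχc := hχ.continuous
  have hinner : ∀ i, Tendsto (fun k => innerFlux P (N k) (M k) (v k) i χ t) atTop
      (𝓝 (∫ x in layer i, (P.f i (u (x, t)) - deriv (g i) x) * deriv χ x)) := fun i => by
    rw [layer_eq]
    exact (hL i).tendsto_flux (hg i) hχ hB' hBL
  have hfirst : ∀ i, Tendsto (fun k => cellMean (N k) i χ 0) atTop (𝓝 (χ (layerStart i))) :=
    fun i => tendsto_cellMean hN h.tendsto_N i hχc hB hN (by simp)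
  have hlast : ∀ i, Tendsto (fun k => cellMean (N k) i χ (N k - 1)) atTop
      (𝓝 (χ (layerStart i + 1))) := fun i => by
    refine tendsto_cellMean hN h.tendsto_N i hχc hB (fun k => Nat.sub_lt (hN k) one_pos) ?_
    have e := ((tendsto_one_div_atTop_nhds_zero_nat (𝕜 := ℝ)).comp h.tendsto_N).const_sub 1
      |>.const_add (layerStart i)
    rw [sub_zero] at e
    refine e.congr fun k => ?_
    have := hNR k
    rw [Nat.cast_pred (hN k)]
    simp only [Function.comp]
    field_simp
  have hmem := fun k => (h.scheme k).mem (n k + 1) (hn1 k).2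
  have hGL : Tendsto (fun k => P.flux (N k) (P.timeMean (M k) P.uL (n k))
      (P.timeMean (M k) P.uR (n k)) (v k (n k + 1)) (c k (n k + 1)) (startIndex (N k) 0)) atTop
      (𝓝 (P.G 0 (P.uL t) γL)) := by
    have e := tendsto_G P 0 (fun k => timeMean_mem P P.uL_meas P.uL_mem (hn1 k).2)
      (fun k => hmem k (-N k) ⟨le_rfl, by have := hN k; omega⟩) huL (b := γL) ?_
    · refine e.congr fun k => ?_
      rw [← flux_left P (N k) _ (P.timeMean (M k) P.uR (n k)) _ (c k (n k + 1))]
      simp [startIndex, hn]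
    · refine hγL.congr fun k => ?_
      rw [discreteFun_firstCentre (hN k), (hn1 k).1]
      simp [startIndex]
  have hGR : Tendsto (fun k => P.flux (N k) (P.timeMean (M k) P.uL (n k))
      (P.timeMean (M k) P.uR (n k)) (v k (n k + 1)) (c k (n k + 1)) (startIndex (N k) 1 + N k))
      atTop (𝓝 (P.G 1 γR (P.uR t))) := by
    have e := tendsto_G P 1 (fun k => hmem k (N k - 1) ⟨by have := hN k; omega, by omega⟩)
      (fun k => timeMean_mem P P.uR_meas P.uR_mem (hn1 k).2) (a := γR) ?_ huR
    · refine e.congr fun k => ?_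
      rw [← flux_right P (hN k) (P.timeMean (M k) P.uL (n k)) _ _ (c k (n k + 1))]
      simp [startIndex, hn]
    · refine hγR.congr fun k => ?_
      rw [discreteFun_lastCentre (hN k), (hn1 k).1]
      simp [startIndex]
  -- The flux through `x = 0` is bounded but not known to converge. Both layers see the same flux,
  -- and the two test means beside the interface have the same limit, so its contributions cancel.
  have hzero : Tendsto (fun k => P.flux (N k) (P.timeMean (M k) P.uL (n k))
      (P.timeMean (M k) P.uR (n k)) (v k (n k + 1)) (c k (n k + 1)) 0 *
      (cellMean (N k) 1 χ 0 - cellMean (N k) 0 χ (N k - 1))) atTop (𝓝 0) := by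
    have e := ((hfirst 1).sub (hlast 0)).abs.const_mul C
    have e0 : χ (layerStart 1) - χ (layerStart 0 + 1) = 0 := by simp [layerStart]
    rw [e0, abs_zero, mul_zero] at e
    refine squeeze_zero_norm (fun k => ?_) e
    rw [norm_mul, Real.norm_eq_abs, Real.norm_eq_abs]
    exact mul_le_mul_of_nonneg_right
      ((h.scheme k).flux_le (n k) (hn1 k).2 0 ⟨by omega, by omega⟩) (abs_nonneg _)
  have htot := (((hinner 0).add (hinner 1)).add (hGL.mul (hfirst 0))).sub (hGR.mul (hlast 1))
    |>.add hzero
  have e1 : layerStart 0 = -1 := by simp [layerStart]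
  have e2 : layerStart 1 + 1 = 1 := by simp [layerStart]
  rw [e1, e2, add_zero] at htot
  rw [Fin.sum_univ_two]
  refine htot.congr fun k => ?_
  rw [Fin.sum_univ_two, massRate_eq (h.scheme k) 0 (hn1 k).1 (hn1 k).2 hχc,
    massRate_eq (h.scheme k) 1 (hn1 k).1 (hn1 k).2 hχc]
  have e3 : startIndex (N k) 0 + N k = 0 := by simp [startIndex]
  have e4 : startIndex (N k) 1 = 0 := by simp [startIndex]
  rw [e3, e4]
  ring

end TwoPhase

namespace TwoPhase

open Problem

variable {P : Problem} {u₀ : ℝ → ℝ} {C : ℝ} {N M : ℕ → ℕ} {v : ℕ → ℕ → ℤ → ℝ}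
  {c d : ℕ → ℕ → ℝ} {u : ℝ × ℝ → ℝ}

/-! ### The limit of the discrete time derivative. -/

theorem SchemeLimit.ae_tendsto_initial (h : SchemeLimit P u₀ C N M v c d u) (i : Fin 2)
    (hm : ∀ᵐ x ∂volume.restrict (layer i), u₀ x ∈ Icc (0 : ℝ) 1) :
    ∀ᵐ x ∂volume.restrict (layer i),
      Tendsto (fun k => v k 0 ⌊x / (1 / (N k : ℝ))⌋) atTop (𝓝 (u₀ x)) := by
  -- The faces of all the meshes together are countably many, so a single null set removes them.
  have h1 : ∀ᵐ x : ℝ, ∀ k, ∀ j : ℤ, x ≠ (j : ℝ) / N k :=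
    ae_all_iff.2 fun k => ae_all_iff.2 fun j => by simp [ae_iff]
  have h2 : ∀ᵐ x : ℝ, ∀ k, ∀ j : ℤ, j ∈ Ico (-N k : ℤ) (N k) →
      x ∈ Ioo ((j : ℝ) / N k) ((j + 1) / N k) →
      |P.phi (cellLayer j) (v k 0 j) - P.phi (cellLayer j) (u₀ x)| ≤ C / N k := by
    refine ae_all_iff.2 fun k => ae_all_iff.2 fun j => ?_
    by_cases hj : j ∈ Ico (-N k : ℤ) (N k)
    · filter_upwards [(ae_restrict_iff' measurableSet_Ioo).1 ((h.scheme k).initial j hj)] with x hx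
      exact fun _ => hx
    · exact Eventually.of_forall fun x hj' => absurd hj' hj
  filter_upwards [ae_restrict_of_ae h1, ae_restrict_of_ae h2, hm,
    ae_restrict_mem (measurableSet_layer i)] with x hx1 hx2 hx3 hxi
  have hN := fun k => (h.scheme k).pos_N
  have hNR : ∀ k, (0 : ℝ) < N k := fun k => by exact_mod_cast hN k
  have hj := fun k => floor_mem_of_mem_layer (hN k) hxi
  refine tendsto_of_phi_tendsto (P := P) (i := i)
    (Eventually.of_forall fun k => (h.scheme k).mem 0 (Nat.zero_le _) _ (hj k).1) hx3 ?_
  rw [tendsto_iff_norm_sub_tendsto_zero]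
  refine squeeze_zero (fun _ => norm_nonneg _) (fun k => ?_)
    ((tendsto_const_div_atTop_nhds_zero_nat C).comp h.tendsto_N)
  have e : x / (1 / (N k : ℝ)) = x * N k := by rw [div_div_eq_mul_div, div_one]
  have h3 := hx2 k ⌊x / (1 / (N k : ℝ))⌋ (hj k).1 ⟨lt_of_le_of_ne ?_ (hx1 k _).symm, ?_⟩
  · rwa [(hj k).2] at h3
  · rw [div_le_iff₀ (hNR k), e]; exact Int.floor_le _
  · rw [lt_div_iff₀ (hNR k), e]; exact Int.lt_floor_add_one _

theorem measurable_discreteFun_snd (N M : ℕ) (v : ℕ → ℤ → ℝ) (x : ℝ) :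
    Measurable fun t => P.discreteFun N M v (x, t) :=
  (measurable_discreteFun N M v).comp (measurable_const.prodMk measurable_id)

/-- Discrete integration by parts in time. -/
theorem integral_timeDifference_mul {N M : ℕ} {v : ℕ → ℤ → ℝ} {c d : ℕ → ℝ}
    (h : IsBoundedScheme P u₀ C N M v c d) {i : Fin 2} {x : ℝ} (hx : x ∈ layer i) {χ : ℝ → ℝ}
    (hχ : Continuous χ) (hχT : ∀ t, P.T ≤ t → χ t = 0) :
    ∫ t in Ioo 0 P.T, P.porosity i * ((P.discreteFun N M v (x, t) -
      P.discreteFun N M v (x, t - P.T / M)) / (P.T / M)) * χ t =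
    P.porosity i * (-(∫ t in Ioo 0 P.T, P.discreteFun N M v (x, t) *
      ((χ (t + P.T / M) - χ t) / (P.T / M))) -
      v 0 ⌊x / (1 / (N : ℝ))⌋ * ((P.T / M)⁻¹ * ∫ t in (0 : ℝ)..(0 + P.T / M), χ t)) := by
  have hT := P.T_pos
  have hMR : (1 : ℝ) ≤ M := by exact_mod_cast h.pos_M
  have hδ : 0 < P.T / M := by positivity
  rw [← integral_time_shift hT hδ (div_le_self hT.le hMR)
    (U := fun t => P.discreteFun N M v (x, t)) ?_ ?_ hχ hχT, ← integral_const_mul]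
  · simp only [mul_assoc]
  · intro t ht
    simp only [discreteFun]
    rw [Nat.ceil_eq_zero.2 (div_nonpos_of_nonpos_of_nonneg ht hδ.le)]
  · intro p q hpq hq
    rw [intervalIntegrable_iff_integrableOn_Ioc_of_le hpq]
    refine IntegrableOn.of_bound (C := 1) (by simp)
      (measurable_discreteFun_snd N M v x).aestronglyMeasurable ?_
    filter_upwards [ae_restrict_mem measurableSet_Ioc] with t ht
    have := h.discreteFun_mem_of_le hx (ht.2.trans hq)
    rw [Real.norm_eq_abs, abs_le]; exact ⟨by linarith [this.1], this.2⟩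

theorem SchemeLimit.tendsto_timeStep (h : SchemeLimit P u₀ C N M v c d u) :
    Tendsto (fun k => P.T / (M k : ℝ)) atTop (𝓝 0) :=
  (tendsto_const_div_atTop_nhds_zero_nat P.T).comp h.tendsto_M

theorem SchemeLimit.timeStep_pos (h : SchemeLimit P u₀ C N M v c d u) (k : ℕ) :
    0 < P.T / (M k : ℝ) := div_pos P.T_pos (by exact_mod_cast (h.scheme k).pos_M)

theorem SchemeLimit.timeStep_le (h : SchemeLimit P u₀ C N M v c d u) (k : ℕ) :
    P.T / (M k : ℝ) ≤ P.T := div_le_self P.T_pos.le (by exact_mod_cast (h.scheme k).pos_M)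

variable {i : Fin 2} {x : ℝ} {χ : ℝ → ℝ} {B : ℝ}

theorem SchemeLimit.abs_discreteFun_mul_le (h : SchemeLimit P u₀ C N M v c d u)
    (hx : x ∈ layer i) (hBL : ∀ s t, |χ s - χ t| ≤ B * |s - t|) (k : ℕ) {t : ℝ}
    (ht : t ∈ Ioo 0 P.T) :
    |P.discreteFun (N k) (M k) (v k) (x, t) * ((χ (t + P.T / M k) - χ t) / (P.T / M k))| ≤ B := by
  have hδ := h.timeStep_pos k
  have h1 := (h.scheme k).discreteFun_mem hx ht
  have h2 : |(χ (t + P.T / M k) - χ t) / (P.T / M k)| ≤ B := by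
    rw [abs_div, abs_of_pos hδ, div_le_iff₀ hδ]
    have := hBL (t + P.T / M k) t
    rwa [add_sub_cancel_left, abs_of_pos hδ] at this
  rw [abs_mul, abs_of_nonneg h1.1]
  exact (mul_le_of_le_one_left (abs_nonneg _) h1.2).trans h2

/-- The difference quotient in time has no bound uniform in `k`. The bound appears only after
summation by parts has put it on the test function. -/
theorem SchemeLimit.abs_integral_timeDifference_le (h : SchemeLimit P u₀ C N M v c d u)
    (hx : x ∈ layer i) (hχ : Continuous χ) (hχT : ∀ t, P.T ≤ t → χ t = 0)
    (hB : ∀ t, |χ t| ≤ B) (hBL : ∀ s t, |χ s - χ t| ≤ B * |s - t|) (k : ℕ) :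
    |∫ t in Ioo 0 P.T, P.porosity i * ((P.discreteFun (N k) (M k) (v k) (x, t) -
      P.discreteFun (N k) (M k) (v k) (x, t - P.T / M k)) / (P.T / M k)) * χ t| ≤
      B * P.T + B := by
  have hT := P.T_pos
  have hδ := h.timeStep_pos k
  have hB0 : 0 ≤ B := (abs_nonneg _).trans (hB 0)
  rw [integral_timeDifference_mul (h.scheme k) hx hχ hχT, abs_mul,
    abs_of_pos (P.porosity_mem i).1]
  refine (mul_le_of_le_one_left (abs_nonneg _) (P.porosity_mem i).2.le).trans ?_
  refine (abs_sub _ _).trans (add_le_add ?_ ?_)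
  · rw [abs_neg]
    have := norm_setIntegral_le_of_norm_le_const (μ := volume) (s := Ioo 0 P.T) (C := B)
      (f := fun t => P.discreteFun (N k) (M k) (v k) (x, t) *
        ((χ (t + P.T / M k) - χ t) / (P.T / M k))) (by simp)
      fun t ht => h.abs_discreteFun_mul_le hx hBL k ht
    rwa [Real.volume_real_Ioo, sub_zero, max_eq_left hT.le] at this
  · have h1 := (h.scheme k).discreteFun_mem_of_le hx hT.le |>.1
    have h2 : v k 0 ⌊x / (1 / (N k : ℝ))⌋ ∈ Icc (0 : ℝ) 1 :=
      (h.scheme k).mem 0 (Nat.zero_le _) _ (floor_mem_of_mem_layer (h.scheme k).pos_N hx).1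
    have h3 := intervalIntegral.norm_integral_le_of_norm_le_const (a := 0)
      (b := 0 + P.T / M k) (f := χ) (C := B) fun t _ => hB t
    rw [zero_add, sub_zero, abs_of_pos hδ, Real.norm_eq_abs] at h3
    rw [abs_mul, abs_of_nonneg h2.1, zero_add]
    refine (mul_le_of_le_one_left (abs_nonneg _) h2.2).trans ?_
    rw [abs_mul, abs_of_pos (inv_pos.2 hδ), inv_mul_le_iff₀ hδ]
    linarith

theorem SchemeLimit.tendsto_integral_timeDifference (h : SchemeLimit P u₀ C N M v c d u)
    (hx : x ∈ layer i) (hu : ∀ᵐ t ∂volume.restrict (Ioo 0 P.T),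
      Tendsto (fun k => P.discreteFun (N k) (M k) (v k) (x, t)) atTop (𝓝 (u (x, t))))
    (hu₀ : Tendsto (fun k => v k 0 ⌊x / (1 / (N k : ℝ))⌋) atTop (𝓝 (u₀ x)))
    (hχ : ContDiff ℝ 1 χ) (hχT : ∀ t, P.T ≤ t → χ t = 0)
    (hB : ∀ t, |χ t| ≤ B) (hBL : ∀ s t, |χ s - χ t| ≤ B * |s - t|) :
    Tendsto (fun k => ∫ t in Ioo 0 P.T, P.porosity i *
      ((P.discreteFun (N k) (M k) (v k) (x, t) -
        P.discreteFun (N k) (M k) (v k) (x, t - P.T / M k)) / (P.T / M k)) * χ t) atTop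
      (𝓝 (P.porosity i * (-(∫ t in Ioo 0 P.T, u (x, t) * deriv χ t) - u₀ x * χ 0))) := by
  have hδ : Tendsto (fun k => P.T / (M k : ℝ)) atTop (𝓝[≠] 0) :=
    tendsto_nhdsWithin_iff.2 ⟨h.tendsto_timeStep,
      Eventually.of_forall fun k => (h.timeStep_pos k).ne'⟩
  simp_rw [integral_timeDifference_mul (h.scheme _) hx hχ.continuous hχT]
  refine ((Tendsto.neg ?_).sub (hu₀.mul ?_)).const_mul _
  · refine tendsto_integral_of_dominated_convergence (fun _ => B) (fun k => ?_) ?_ (fun k => ?_) ?_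
    · exact ((measurable_discreteFun_snd _ _ _ _).mul (((hχ.continuous.measurable.comp
        (measurable_id.add_const _)).sub hχ.continuous.measurable).div_const _)).aestronglyMeasurable
    · exact integrableOn_const (by simp)
    · filter_upwards [ae_restrict_mem measurableSet_Ioo] with t ht
      exact h.abs_discreteFun_mul_le hx hBL k ht
    · filter_upwards [hu] with t ht
      refine ht.mul ?_
      have hd := (hχ.differentiable (by simp) t).hasDerivAt
      refine ((hasDerivAt_iff_tendsto_slope_zero.1 hd).comp hδ).congr fun k => ?_
      simp only [Function.comp, smul_eq_mul]
      rw [div_eq_inv_mul (χ _ - χ t)]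
  · exact tendsto_integral_shrinking (a := 0) (b := P.T) (h := fun _ => χ) (p := fun _ => 0)
      h.timeStep_pos h.tendsto_timeStep tendsto_const_nhds
      (fun k => Ioo_subset_Ioo le_rfl (by rw [zero_add]; exact h.timeStep_le k))
      (fun k => hχ.continuous.aestronglyMeasurable) (fun k t _ => hB t)
      (fun t _ ht => (hχ.continuous.tendsto 0).comp ht)

/-- The limit of the discrete time derivative, tested against `ψ`. -/
theorem SchemeLimit.tendsto_integral_massRate (h : SchemeLimit P u₀ C N M v c d u) (i : Fin 2)
    (hm : ∀ᵐ x ∂volume.restrict (layer i), u₀ x ∈ Icc (0 : ℝ) 1)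
    (hu₀ : AEStronglyMeasurable u₀ (volume.restrict (layer i)))
    {ψ : ℝ × ℝ → ℝ} (hψ : P.IsTest ψ) :
    (∀ k, IntegrableOn (fun t => massRate P (N k) (M k) (v k) i (fun x => ψ (x, t)) t)
      (Ioo 0 P.T)) ∧
    Tendsto (fun k => ∫ t in Ioo 0 P.T,
      massRate P (N k) (M k) (v k) i (fun x => ψ (x, t)) t) atTop
      (𝓝 (-(∫ p in P.cyl i, P.porosity i * u p * deriv (fun s => ψ (p.1, s)) p.2) -
        ∫ x in layer i, P.porosity i * u₀ x * ψ (x, 0))) := by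
  obtain ⟨hψs, hψc, hψT⟩ := hψ
  obtain ⟨B, hB0, hB, hBL⟩ := exists_bound_lipschitz hψs hψc
  have hT := P.T_pos
  have hψ0 : ∀ x t, P.T ≤ t → ψ (x, t) = 0 := fun x t ht =>
    image_eq_zero_of_notMem_tsupport fun hxt => absurd (hψT hxt) (not_lt.2 ht)
  have hslice : ∀ x s t, |ψ (x, s) - ψ (x, t)| ≤ B * |s - t| := fun x s t => by
    have := hBL (x, s) (x, t)
    rwa [Prod.dist_eq, dist_self, Real.dist_eq, max_eq_right (abs_nonneg _)] at this
  have hp := P.porosity_mem i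
  have hint : ∀ k, IntegrableOn (fun p : ℝ × ℝ => P.porosity i *
      ((P.discreteFun (N k) (M k) (v k) p -
        P.discreteFun (N k) (M k) (v k) (p.1, p.2 - P.T / M k)) / (P.T / M k)) * ψ p)
      (P.cyl i) := fun k => by
    have hδ := h.timeStep_pos k
    refine integrableOn_cyl_of_bound (B := 1 / (P.T / M k) * B) ?_ ?_
    · exact ((((measurable_discreteFun _ _ _).sub ((measurable_discreteFun _ _ _).comp
        (by fun_prop))).div_const _).const_mul _ |>.mul hψs.continuous.measurable).aestronglyMeasurable
    · filter_upwards [ae_restrict_mem (measurableSet_cyl i)] with p hpi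
      have e1 := (h.scheme k).discreteFun_mem hpi.1 hpi.2
      have e2 := (h.scheme k).discreteFun_mem_of_le hpi.1
        (t := p.2 - P.T / M k) (by linarith [hpi.2.2])
      rw [abs_mul, abs_mul, abs_of_pos hp.1, abs_div, abs_of_pos hδ]
      refine mul_le_mul ?_ (hB p) (abs_nonneg _) (by positivity)
      refine (mul_le_of_le_one_left (by positivity) hp.2.le).trans ?_
      refine div_le_div_of_nonneg_right ?_ hδ.le
      rw [abs_le]; constructor <;> linarith [e1.1, e1.2, e2.1, e2.2]
  refine ⟨fun k => integrable_integral_layer (hint k), ?_⟩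
  have hum := h.mem_cyl i
  have hum' := h.aestronglyMeasurable i
  obtain ⟨B', hB0', hB', -⟩ := exists_bound_lipschitz (contDiff_fderiv_apply hψs (0, 1))
    ((hψc.fderiv (𝕜 := ℝ)).comp_left (g := fun A : ℝ × ℝ →L[ℝ] ℝ => A (0, 1)) (by simp))
  have hlimint : IntegrableOn (fun p => P.porosity i * u p * deriv (fun s => ψ (p.1, s)) p.2)
      (P.cyl i) := by
    simp_rw [deriv_slice_snd hψs]
    refine integrableOn_cyl_of_bound (B := 1 * B') ((hum'.const_mul _).mul
      (contDiff_fderiv_apply hψs (0, 1)).continuous.aestronglyMeasurable) ?_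
    filter_upwards [hum] with p hpu
    rw [abs_mul, abs_mul, abs_of_pos hp.1, abs_of_nonneg hpu.1]
    exact mul_le_mul (mul_le_one₀ hp.2.le hpu.1 hpu.2) (hB' p) (abs_nonneg _) zero_le_one
  have hfin : volume (layer i) < ⊤ := by rw [layer_eq]; simp
  have hinit : IntegrableOn (fun x => P.porosity i * u₀ x * ψ (x, 0)) (layer i) := by
    refine IntegrableOn.of_bound hfin ((hu₀.const_mul _).mul
      (contDiff_slice_fst hψs 0).continuous.aestronglyMeasurable) (1 * B) ?_
    filter_upwards [hm] with x hx
    rw [Real.norm_eq_abs, abs_mul, abs_mul, abs_of_pos hp.1, abs_of_nonneg hx.1]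
    exact mul_le_mul (mul_le_one₀ hp.2.le hx.1 hx.2) (hB _) (abs_nonneg _) zero_le_one
  have hinner : IntegrableOn (fun x => ∫ t in Ioo 0 P.T,
      P.porosity i * u (x, t) * deriv (fun s => ψ (x, s)) t) (layer i) := by
    rw [IntegrableOn, volume_restrict_cyl] at hlimint
    exact hlimint.integral_prod_left
  have e0 := integral_sub hinner.neg hinit
  rw [integral_neg'] at e0
  rw [integral_cyl' hlimint]
  simp only [Pi.neg_apply] at e0 ⊢
  rw [← e0]
  -- The order of integration is exchanged because the time term is treated at fixed `x`, while the
  -- fluxes are treated at fixed `t`.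
  have e1 : ∀ k, ∫ t in Ioo 0 P.T, massRate P (N k) (M k) (v k) i (fun x => ψ (x, t)) t =
      ∫ x in layer i, ∫ t in Ioo 0 P.T, P.porosity i *
      ((P.discreteFun (N k) (M k) (v k) (x, t) -
        P.discreteFun (N k) (M k) (v k) (x, t - P.T / M k)) / (P.T / M k)) * ψ (x, t) := fun k => by
    rw [← integral_cyl' (hint k), integral_cyl (hint k)]
    rfl
  simp_rw [e1]
  refine tendsto_integral_of_dominated_convergence (fun _ => B * P.T + B) (fun k => ?_) ?_
    (fun k => ?_) ?_
  · have := hint k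
    rw [IntegrableOn, volume_restrict_cyl] at this
    exact this.integral_prod_left.aestronglyMeasurable
  · exact integrableOn_const hfin.ne
  · filter_upwards [ae_restrict_mem (measurableSet_layer i)] with x hx
    exact h.abs_integral_timeDifference_le hx (contDiff_slice_snd hψs x).continuous (hψ0 x)
      (fun t => hB _) (hslice x) k
  · filter_upwards [ae_restrict_mem (measurableSet_layer i), ae_ae_of_ae_cyl' (h.conv i),
      h.ae_tendsto_initial i hm] with x hx hx1 hx2
    have := h.tendsto_integral_timeDifference hx hx1 hx2
      ((contDiff_slice_snd hψs x).of_le (by exact_mod_cast le_top)) (hψ0 x) (fun t => hB _)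
      (hslice x)
    convert this using 2
    rw [mul_sub, mul_neg, ← integral_const_mul]
    simp only [mul_assoc]

end TwoPhase

namespace TwoPhase

open Problem

variable {P : Problem} {u₀ : ℝ → ℝ} {C : ℝ} {N M : ℕ → ℕ} {v : ℕ → ℕ → ℤ → ℝ}
  {c d : ℕ → ℕ → ℝ} {u : ℝ × ℝ → ℝ}

/-! ### The limit is a bounded-flux solution. -/

theorem abs_sub_slice_le {η : ℝ × ℝ → ℝ} {B : ℝ} (h : ∀ p q, |η p - η q| ≤ B * dist p q)
    (t x y : ℝ) : |η (x, t) - η (y, t)| ≤ B * |x - y| := by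
  have := h (x, t) (y, t)
  rwa [Prod.dist_eq, dist_self, Real.dist_eq, max_eq_left (abs_nonneg _)] at this

theorem integrable_boundaryFlux {i : Fin 2} {a b : ℝ → ℝ} {χ : ℝ → ℝ}
    (ha : AEStronglyMeasurable a (volume.restrict (Ioo 0 P.T)))
    (hb : AEStronglyMeasurable b (volume.restrict (Ioo 0 P.T)))
    (ham : ∀ᵐ t ∂volume.restrict (Ioo 0 P.T), a t ∈ Icc (0 : ℝ) 1)
    (hbm : ∀ᵐ t ∂volume.restrict (Ioo 0 P.T), b t ∈ Icc (0 : ℝ) 1) (hχ : Continuous χ) {B : ℝ}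
    (hB : ∀ t, |χ t| ≤ B) : IntegrableOn (fun t => P.G i (a t) (b t) * χ t) (Ioo 0 P.T) := by
  obtain ⟨C, hC⟩ := (isCompact_Icc.prod isCompact_Icc).exists_bound_of_continuousOn
    (continuousOn_G P i)
  have hG : IntegrableOn (fun t => P.G i (a t) (b t)) (Ioo 0 P.T) := by
    refine IntegrableOn.of_bound (C := C) (by simp)
      (aestronglyMeasurable_comp_uncurry (continuousOn_G P i) ha hb ham hbm) ?_
    filter_upwards [ham, hbm] with t h1 h2
    exact hC (a t, b t) ⟨h1, h2⟩
  exact hG.mul_bdd hχ.aestronglyMeasurable (Eventually.of_forall hB)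

theorem aestronglyMeasurable_f_comp {α : Type*} [MeasurableSpace α] {μ : Measure α} {u : α → ℝ}
    (i : Fin 2) (hu : AEStronglyMeasurable u μ) (hm : ∀ᵐ x ∂μ, u x ∈ Icc (0 : ℝ) 1) :
    AEStronglyMeasurable (fun x => P.f i (u x)) μ := by
  refine (aestronglyMeasurable_comp_uncurry (continuousOn_G P i) hu hu hm hm).congr ?_
  filter_upwards [hm] with x hx using P.G_diag i _ hx

/-- The integrated mass rate converges to the flux and boundary terms by the balance, and to minus
the time and initial terms by summation by parts; limits are unique. -/
theorem SchemeLimit.weakIdentity (h : SchemeLimit P u₀ C N M v c d u)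
    (hu₀ : P.IsRegularInitial u₀) {w : Fin 2 → ℝ × ℝ → ℝ}
    (hw : ∀ i, IsSpaceDeriv P i (2 * C) u (w i)) {γL γR : ℝ → ℝ} (hγLm : Measurable γL)
    (hγRm : Measurable γR)
    (hγL : ∀ᵐ t ∂volume.restrict (Ioo 0 P.T), γL t ∈ Icc (0 : ℝ) 1 ∧
      Tendsto (fun k => P.discreteFun (N k) (M k) (v k) (firstCentre 0 (N k), t)) atTop
        (𝓝 (γL t)))
    (hγR : ∀ᵐ t ∂volume.restrict (Ioo 0 P.T), γR t ∈ Icc (0 : ℝ) 1 ∧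
      Tendsto (fun k => P.discreteFun (N k) (M k) (v k) (lastCentre 1 (N k), t)) atTop
        (𝓝 (γR t)))
    {ψ : ℝ × ℝ → ℝ} (hψ : P.IsTest ψ) : P.WeakIdentity u₀ u w γL γR ψ := by
  obtain ⟨hψs, hψc, hψT⟩ := id hψ
  obtain ⟨B₀, hB0, hB₀, hBL₀⟩ := exists_bound_lipschitz hψs hψc
  obtain ⟨B₁, -, hB₁, hBL₁⟩ := exists_bound_lipschitz (contDiff_fderiv_apply hψs (1, 0))
    ((hψc.fderiv (𝕜 := ℝ)).comp_left (g := fun A : ℝ × ℝ →L[ℝ] ℝ => A (1, 0)) (by simp))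
  set B := max B₀ B₁ with hBdef
  have hC := h.C_pos
  have hderiv : ∀ t, deriv (fun y => ψ (y, t)) = fun x => fderiv ℝ ψ (x, t) (1, 0) :=
    fun t => funext fun x => deriv_slice_fst hψs (x, t)
  have hu := h.mem_cyl
  have hum := h.aestronglyMeasurable
  have hflux : ∀ i, IntegrableOn (fun p => (P.f i (u p) - w i p) *
      deriv (fun y => ψ (y, p.2)) p.1) (P.cyl i) := fun i => by
    obtain ⟨A, hA0, hA⟩ := exists_f_bound P i
    have h1 : IntegrableOn (fun p => P.f i (u p)) (P.cyl i) :=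
      integrableOn_cyl_of_bound (aestronglyMeasurable_f_comp i (hum i) (hu i))
        ((hu i).mono fun p hp => hA _ hp)
    have h2 : IntegrableOn (w i) (P.cyl i) :=
      integrableOn_cyl_of_bound (hw i).1.aestronglyMeasurable
        ((hw i).ae_abs_le (by linarith))
    simp_rw [deriv_slice_fst hψs]
    exact (h1.sub h2).mul_bdd (contDiff_fderiv_apply hψs (1, 0)).continuous.aestronglyMeasurable
      (Eventually.of_forall hB₁)
  set H : ℝ → ℝ := fun t => (∑ i, ∫ x in layer i, (P.f i (u (x, t)) - w i (x, t)) *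
    deriv (fun y => ψ (y, t)) x) + P.G 0 (P.uL t) (γL t) * ψ (-1, t) -
    P.G 1 (γR t) (P.uR t) * ψ (1, t) with hH
  have hmass := fun i => h.tendsto_integral_massRate i (hu₀.mem_layer i)
    (hu₀.aestronglyMeasurable_layer i) hψ
  have hLC : ∀ᵐ t ∂volume.restrict (Ioo 0 P.T), ∀ i, LayerConvergence P i (layerStart i) (2 * C)
      N (fun k x => P.discreteFun (N k) (M k) (v k) (x, t)) (fun x => u (x, t)) :=
    ae_all_iff.2 h.layerConvergence
  have hwt : ∀ᵐ t ∂volume.restrict (Ioo 0 P.T), ∀ i, ∃ g,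
      IsLipschitzRep P i (layerStart i) (2 * C) (fun x => u (x, t)) g ∧
        ∀ᵐ x ∂volume.restrict (layer i), w i (x, t) = deriv g x := ae_all_iff.2 fun i => (hw i).2
  have hUL : IntegrableOn P.uL (Ioo 0 P.T) := by
    refine IntegrableOn.of_bound (C := 1) (by simp) P.uL_meas ?_
    filter_upwards [P.uL_mem] with t ht
    rw [Real.norm_eq_abs, abs_of_nonneg ht.1]; exact ht.2
  have hUR : IntegrableOn P.uR (Ioo 0 P.T) := by
    refine IntegrableOn.of_bound (C := 1) (by simp) P.uR_meas ?_
    filter_upwards [P.uR_mem] with t ht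
    rw [Real.norm_eq_abs, abs_of_nonneg ht.1]; exact ht.2
  have hM0 := fun k => (h.scheme k).pos_M
  have hlim : Tendsto (fun k => ∫ t in Ioo 0 P.T, ∑ i,
      massRate P (N k) (M k) (v k) i (fun x => ψ (x, t)) t) atTop (𝓝 (∫ t in Ioo 0 P.T, H t)) := by
    refine tendsto_integral_of_dominated_convergence (fun _ => 7 * C * B + 7 * C * B)
      (fun k => ?_) ?_ (fun k => ?_) ?_
    · exact (integrable_finsetSum _ fun i _ => (hmass i).1 k).aestronglyMeasurable
    · exact integrableOn_const (by simp)
    · filter_upwards [hLC, ae_restrict_mem measurableSet_Ioo] with t hL ht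
      rw [Fin.sum_univ_two]
      have key := fun i => abs_massRate_le h ht (hL i) (B := B)
        (contDiff_slice_fst hψs t).continuous (fun x => (hB₀ _).trans (le_max_left _ _))
        (fun x y => (abs_sub_slice_le hBL₀ t x y).trans
          (mul_le_mul_of_nonneg_right (le_max_left _ _) (abs_nonneg _))) k
      exact (abs_add_le _ _).trans (add_le_add (key 0) (key 1))
    · filter_upwards [hLC, hwt, hγL, hγR, ae_restrict_mem measurableSet_Ioo,
        ae_tendsto_timeMean hUL hM0 h.tendsto_M,
        ae_tendsto_timeMean hUR hM0 h.tendsto_M] with t hL hg hl hr ht hul hur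
      choose g hg hwg using hg
      have key := tendsto_massRate h ht hL hg hl.2 hr.2 hul hur (B := B)
        (contDiff_infty.1 (contDiff_slice_fst hψs t) 2)
        (fun x => (hB₀ _).trans (le_max_left _ _))
        (fun x => by rw [hderiv]; exact (hB₁ _).trans (le_max_right _ _))
        (fun x y => by
          rw [hderiv]
          exact (abs_sub_slice_le hBL₁ t x y).trans
            (mul_le_mul_of_nonneg_right (le_max_right _ _) (abs_nonneg _)))
      convert key using 5 with i
      refine integral_congr_ae ?_
      filter_upwards [hwg i] with x hx
      rw [hx]
  have hlim2 := (hmass 0).2.add (hmass 1).2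
  have hsum : ∀ k, ∫ t in Ioo 0 P.T, ∑ i,
      massRate P (N k) (M k) (v k) i (fun x => ψ (x, t)) t =
      (∫ t in Ioo 0 P.T, massRate P (N k) (M k) (v k) 0 (fun x => ψ (x, t)) t) +
      ∫ t in Ioo 0 P.T, massRate P (N k) (M k) (v k) 1 (fun x => ψ (x, t)) t := fun k => by
    simp only [Fin.sum_univ_two]
    exact integral_add ((hmass 0).1 k) ((hmass 1).1 k)
  simp_rw [hsum] at hlim
  have heq := tendsto_nhds_unique hlim hlim2
  have i1 := integrable_boundaryFlux (P := P) (i := 0) P.uL_meas hγLm.aestronglyMeasurable P.uL_mem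
    (hγL.mono fun t ht => ht.1) (contDiff_slice_snd hψs (-1)).continuous (fun t => hB₀ (-1, t))
  have i2 := integrable_boundaryFlux (P := P) (i := 1) hγRm.aestronglyMeasurable P.uR_meas
    (hγR.mono fun t ht => ht.1) P.uR_mem (contDiff_slice_snd hψs 1).continuous
    (fun t => hB₀ (1, t))
  have i3 : ∀ i ∈ Finset.univ, IntegrableOn (fun t => ∫ x in layer i,
      (P.f i (u (x, t)) - w i (x, t)) * deriv (fun y => ψ (y, t)) x) (Ioo 0 P.T) :=
    fun i _ => integrable_integral_layer (hflux i)
  have i4 : IntegrableOn (fun t => ∑ i, ∫ x in layer i,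
      (P.f i (u (x, t)) - w i (x, t)) * deriv (fun y => ψ (y, t)) x) (Ioo 0 P.T) :=
    integrable_finsetSum _ i3
  have i5 : IntegrableOn (fun t => (∑ i, ∫ x in layer i,
      (P.f i (u (x, t)) - w i (x, t)) * deriv (fun y => ψ (y, t)) x) +
      P.G 0 (P.uL t) (γL t) * ψ (-1, t)) (Ioo 0 P.T) := i4.add i1
  have hHint : ∫ t in Ioo 0 P.T, H t =
      (∑ i, ∫ p in P.cyl i, (P.f i (u p) - w i p) * deriv (fun y => ψ (y, p.2)) p.1) +
      (∫ t in Ioo 0 P.T, P.G 0 (P.uL t) (γL t) * ψ (-1, t)) -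
      ∫ t in Ioo 0 P.T, P.G 1 (γR t) (P.uR t) * ψ (1, t) := by
    simp only [hH]
    rw [integral_sub i5 i2, integral_add i4 i1, integral_finsetSum _ i3]
    congr 2
    exact Finset.sum_congr rfl fun i _ => (integral_cyl (hflux i)).symm
  unfold WeakIdentity
  rw [hHint] at heq
  simp only [Fin.sum_univ_two] at heq ⊢
  linarith

/-- The limit of discrete solutions is a bounded-flux solution. -/
theorem SchemeLimit.isBoundedFluxSolution (h : SchemeLimit P u₀ C N M v c d u)
    (hu₀ : P.IsRegularInitial u₀) : P.IsBoundedFluxSolution u₀ u := by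
  have hC : 0 ≤ 2 * C := by linarith [h.C_pos]
  have hN := fun k => (h.scheme k).pos_N
  have hum := h.aestronglyMeasurable
  have hmem := h.mem_cyl
  choose w hw hwd using h.exists_deriv
  have hsd : ∀ i, IsSpaceDeriv P i (2 * C) u (w i) := fun i => ⟨hw i, hwd i⟩
  obtain ⟨γL, hγLm, hγL⟩ := h.exists_trace 0 (fun k => firstCentre_mem (hN k) 0)
    (tendsto_firstCentre h.tendsto_N 0)
  obtain ⟨γ₀, -, hγ₀⟩ := h.exists_trace 0 (fun k => lastCentre_mem (hN k) 0)
    (tendsto_lastCentre h.tendsto_N 0)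
  obtain ⟨γ₁, -, hγ₁⟩ := h.exists_trace 1 (fun k => firstCentre_mem (hN k) 1)
    (tendsto_firstCentre h.tendsto_N 1)
  obtain ⟨γR, hγRm, hγR⟩ := h.exists_trace 1 (fun k => lastCentre_mem (hN k) 1)
    (tendsto_lastCentre h.tendsto_N 1)
  have e0 : layerStart 0 = -1 := by simp [layerStart]
  have e1 : layerStart 0 + 1 = 0 := by simp [layerStart]
  have e2 : layerStart 1 = 0 := by simp [layerStart]
  have e3 : layerStart 1 + 1 = 1 := by simp [layerStart]
  rw [e0] at hγL
  rw [e1] at hγ₀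
  rw [e2] at hγ₁
  rw [e3] at hγR
  refine ⟨⟨?_, ?_, w, ![γ₀, γ₁], γL, γR, fun i => ⟨memLp_phi (hum i) (hmem i) 2,
    (hsd i).memLp hC 2, (hsd i).hasWeakDerivX hC (hum i) (hmem i)⟩, ?_, ?_, ?_, ?_,
    fun ψ hψ => h.weakIdentity hu₀ hsd hγLm hγRm ?_ ?_ hψ⟩,
    fun i => ⟨w i, (hsd i).hasWeakDerivX hC (hum i) (hmem i), (hsd i).memLp hC ⊤⟩⟩
  · exact (aestronglyMeasurable_union_iff.2 ⟨hum 0, hum 1⟩).mono_measure restrict_domain_le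
  · exact ae_mono restrict_domain_le (ae_restrict_union_iff _ _ _ |>.2 ⟨hmem 0, hmem 1⟩)
  · intro i
    fin_cases i
    · exact hγ₀.mono fun t ht => ht.2.1
    · exact hγ₁.mono fun t ht => ht.2.1
  · exact hγL.mono fun t ht => ht.2.1
  · exact hγR.mono fun t ht => ht.2.1
  · filter_upwards [hγ₀, hγ₁, ae_restrict_mem measurableSet_Ioo] with t h0 h1 ht
    exact h.connected ht h0.1 h1.1 h0.2.2 h1.2.2
  · exact hγL.mono fun t ht => ⟨ht.1, ht.2.2⟩
  · exact hγR.mono fun t ht => ⟨ht.1, ht.2.2⟩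

end TwoPhase

theorem mainTheorem4 (P : TwoPhase.Problem) (u₀ : ℝ → ℝ) (hu₀ : P.IsRegularInitial u₀) :
    (∀ (N M : ℕ → ℕ), (∀ p, 0 < N p) → (∀ p, 0 < M p) →
      Tendsto N atTop atTop → Tendsto M atTop atTop →
      ∀ v : ℕ → ℕ → ℤ → ℝ, (∀ p, P.IsDiscreteSolution u₀ (N p) (M p) (v p)) →
      ∀ r : ENNReal, 1 ≤ r → r ≠ ⊤ →
      ∀ u : ℝ × ℝ → ℝ,
        P.IsAdherenceValue r (fun p => P.discreteFun (N p) (M p) (v p)) u →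
        P.IsBoundedFluxSolution u₀ u) ∧
    ∃ u : ℝ × ℝ → ℝ, P.IsBoundedFluxSolution u₀ u := by
  obtain ⟨C, hC0, hC, hCs⟩ := hu₀.exists_isBoundedScheme
  constructor
  · intro N M hN hM hNt hMt v hv r hr1 hr u ⟨hur, k, hk, hku⟩
    choose c d hcd using fun p => hCs (N p) (M p) (hN p) (hM p) (v p) (hv p)
    -- Convergence in `L^r` gives convergence in measure, hence almost everywhere along a further
    -- subsequence, which is all that `SchemeLimit` asks.
    have hmeas : TendstoInMeasure (volume.restrict P.domain)
        (fun p => P.discreteFun (N (k p)) (M (k p)) (v (k p))) atTop u :=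
      tendstoInMeasure_of_tendsto_eLpNorm (by rintro rfl; simp at hr1)
        (fun p => (TwoPhase.Problem.measurable_discreteFun _ _ _).aestronglyMeasurable) hur.1 hku
    obtain ⟨κ, hκ, hκu⟩ := hmeas.exists_seq_tendsto_ae
    have hσ := hk.comp hκ
    refine TwoPhase.SchemeLimit.isBoundedFluxSolution (C := C) (N := fun p => N (k (κ p)))
      (M := fun p => M (k (κ p))) (v := fun p => v (k (κ p))) (c := fun p => c (k (κ p)))
      (d := fun p => d (k (κ p))) ⟨hC0, hC, hNt.comp hσ.tendsto_atTop,
        hMt.comp hσ.tendsto_atTop, fun p => hcd _, fun i => ?_⟩ hu₀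
    exact ae_restrict_of_ae_restrict_of_subset (TwoPhase.Problem.cyl_subset_domain i) hκu
  · have hv := fun p : ℕ => hu₀.exists_isDiscreteSolution (N := p + 1) (M := p + 1)
      (Nat.succ_pos p) (Nat.succ_pos p)
    choose v hv using hv
    choose c d hcd using fun p : ℕ => hCs (p + 1) (p + 1) (Nat.succ_pos p) (Nat.succ_pos p)
      (v p) (hv p)
    have ht := tendsto_add_atTop_nat 1
    obtain ⟨κ, hκ, hlim⟩ := TwoPhase.Problem.exists_subseq_tendsto hC0 hC ht ht hcd
    -- The subsequence converges at every point of both cylinders; elsewhere in the domain, on the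
    -- null set `x = 0`, the value is immaterial.
    refine ⟨fun p => limUnder atTop fun k =>
      P.discreteFun (κ k + 1) (κ k + 1) (v (κ k)) p,
      TwoPhase.SchemeLimit.isBoundedFluxSolution (C := C) (N := fun k => κ k + 1)
        (M := fun k => κ k + 1) (v := fun k => v (κ k)) (c := fun k => c (κ k))
        (d := fun k => d (κ k)) ⟨hC0, hC, ht.comp hκ.tendsto_atTop, ht.comp hκ.tendsto_atTop,
          fun k => hcd _, fun i => ?_⟩ hu₀⟩
    filter_upwards [ae_restrict_mem (TwoPhase.Problem.measurableSet_cyl i)] with p hp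
    exact tendsto_nhds_limUnder (hlim i p hp)
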